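/- Let $n\ge 3$, let $\zeta_n$ be a primitive $n$th root of unity, $\mathcal O_n=\mathbb Z[\zeta_n]\subset\mathbb C=\mathbb R^2$, $K_n=\mathbb Q(\zeta_n)$ and $k=\phi(n)/2-1$. Choose one automorphism from each pair of complex conjugate elements of $\mathrm{Gal}(K_n/\mathbb Q)$, namely $\sigma_1=\mathrm{id},\sigma_2,\dots,\sigma_{k+1}$, and let $z^\star=(\sigma_2(z),\dots,\sigma_{k+1}(z))\in(\mathbb R^2)^k$ for $z\in\mathcal O_n$. Let $W=\{x\in(\mathbb R^2)^k : Ax\le b\}$, with a real matrix $A$ and a real vector $b$, be a window, i.e. $\varnothing\ne W^\circ\subset W\subset\overline{W^\circ}$ with $\overline{W^\circ}$ compact. The $W^\circ$-sets are the sets $t+\{z\in\mathcal O_n : z^\star\in\tau+W^\circ\}$ with $t\in\mathbb R^2$, $\tau\in(\mathbb R^2)^k$. Let $o_1,\dots,o_m\in\mathcal O_n\setminus\{0\}$, $m\ge2$, be pairwise non-parallel. The X-ray $X_{o}F$ of a finite set $F\subset\mathbb R^2$ is the function that maps each line $\ell$ parallel to $o$ to $\operatorname{card}(F\cap\ell)$.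 All of $n$, the star map, $W$ and the $o_i$ are fixed. Consider the following problems. Consistency: given functions $p_i$ from the lines parallel to $o_i$ to $\mathbb N_0$ ($1\le i\le m$), with finite supports consisting of lines that meet $\mathcal O_n$, decide whether there is a finite subset $F$ of a $W^\circ$-set with $X_{o_i}F=p_i$ for all $i$. Reconstruction: in addition, construct one such $F$ if there is one. Uniqueness: given a finite subset $F$ of a $W^\circ$-set, decide whether there is a finite subset $F'\ne F$ of a $W^\circ$-set with $X_{o_i}F'=X_{o_i}F$ for all $i$. The anchored versions of the three problems ask the same questions for arbitrary planar data with a prescribed set $S\subset\mathbb R^2$: given $s\in\mathbb N_0$, functions $p_i$ with supports of at most $s$ lines (respectively, a finite set $F\subset\mathbb R^2$ whose X-rays have supports of at most $s$ lines) and a set $S$ of at most $s^2$ points, decide whether there is $F\subset S$ with $X_{o_i}F=p_i$ for all $i$; in addition, construct one such $F$ if there is one; respectively, decide whether there is $F'\subset S$ with $F'\ne F$ and $X_{o_i}F'=X_{o_i}F$ for all $i$. The model of computation is the real RAM, in which the arithmetic operations on reals, comparisons, the test whether a real number is an integer, and memory access through integer addresses have unit cost. Module lines in the input are given by the $\mathbb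 Z$-coordinates, with respect to $1,\zeta_n,\dots,\zeta_n^{\phi(n)-1}$, of a point of $\mathcal O_n$ on them, and the set $F$ in Uniqueness by some $t\in\mathbb R^2$ and the $\mathbb Z$-coordinates of the points of $F-t\subset\mathcal O_n$; other points and lines are given by planar real coordinates. Theorem. Each of Consistency, Reconstruction and Uniqueness can be solved by a real RAM program that uses an arbitrary oracle for the anchored version of the same problem, and whose numbers of operations and of oracle calls are bounded by a polynomial in $s$, the maximum of the cardinalities of the supports of the X-ray data $p_i$ (for Uniqueness, of $X_{o_i}F$). Every oracle call is made for an anchored instance with parameter at most $s$, hence with a candidate set of at most $s^2$ points. -/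

import Mathlib

noncomputable section

namespace RealRAM

/-! ### A real random access machine with an oracle

Real numbers are stored in finitely many unbounded arrays, addressed by natural-number index
registers. Programs are finite; they may contain real constants. Every elementary operation costs
one unit. -/

/-- Memory contents: the index registers, and the real cells `mem a i` (cell `i` of array `a`). -/
@[ext] structure State where
  reg : ℕ → ℕ
  mem : ℕ → ℕ → ℝ

/-- Index arithmetic (subtraction is truncated). -/
inductive NExp where
  | const (k : ℕ)
  | reg (r : ℕ)
  | add (e f : NExp)
  | sub (e f : NExp)
  | mul (e f : NExp)

def NExp.eval (σ : State) : NExp → ℕ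
  | .const k => k
  | .reg r => σ.reg r
  | .add e f => e.eval σ + f.eval σ
  | .sub e f => e.eval σ - f.eval σ
  | .mul e f => e.eval σ * f.eval σ

/-- Number of elementary operations needed to evaluate the expression. -/
def NExp.size : NExp → ℕ
  | .const _ => 1
  | .reg _ => 1
  | .add e f => e.size + f.size + 1
  | .sub e f => e.size + f.size + 1
  | .mul e f => e.size + f.size + 1

/-- Real arithmetic. The cell `i` of array `a` is accessed with a computed index `i` (indirect
addressing); `ofNat` regards an index as a real number. Division by zero yields zero. -/
inductive RExp where
  | const (c : ℝ)
  | cell (a : ℕ) (i : NExp)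
  | ofNat (e : NExp)
  | add (e f : RExp)
  | sub (e f : RExp)
  | mul (e f : RExp)
  | div (e f : RExp)

def RExp.eval (σ : State) : RExp → ℝ
  | .const c => c
  | .cell a i => σ.mem a (i.eval σ)
  | .ofNat e => (e.eval σ : ℝ)
  | .add e f => e.eval σ + f.eval σ
  | .sub e f => e.eval σ - f.eval σ
  | .mul e f => e.eval σ * f.eval σ
  | .div e f => e.eval σ / f.eval σ

def RExp.size : RExp → ℕ
  | .const _ => 1
  | .cell _ i => i.size + 1
  | .ofNat e => e.size + 1
  | .add e f => e.size + f.size + 1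
  | .sub e f => e.size + f.size + 1
  | .mul e f => e.size + f.size + 1
  | .div e f => e.size + f.size + 1

/-- Tests: comparisons of indices and of reals, and the test whether a real is an integer. -/
inductive Test where
  | natLt (e f : NExp)
  | natEq (e f : NExp)
  | realLt (e f : RExp)
  | realEq (e f : RExp)
  | isInt (e : RExp)
  | not (c : Test)
  | and (c d : Test)

def Test.holds (σ : State) : Test → Prop
  | .natLt e f => e.eval σ < f.eval σ
  | .natEq e f => e.eval σ = f.eval σ
  | .realLt e f => e.eval σ < f.eval σ
  | .realEq e f => e.eval σ = f.eval σ
  | .isInt e => ∃ k : ℤ, e.eval σ = (k : ℝ)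
  | .not c => ¬ c.holds σ
  | .and c d => c.holds σ ∧ d.holds σ

def Test.size : Test → ℕ
  | .natLt e f => e.size + f.size + 1
  | .natEq e f => e.size + f.size + 1
  | .realLt e f => e.size + f.size + 1
  | .realEq e f => e.size + f.size + 1
  | .isInt e => e.size + 1
  | .not c => c.size + 1
  | .and c d => c.size + d.size + 1

/-- Programs. `call len r` submits the first `len` cells of array `2` to the oracle, which writes
its answer to the beginning of array `3` and the length of the answer to register `r`. -/
inductive Prog where
  | skip
  | setReg (r : ℕ) (e : NExp)
  | setCell (a : ℕ) (i : NExp) (e : RExp)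
  | seq (p q : Prog)
  | ite (c : Test) (p q : Prog)
  | loop (c : Test) (p : Prog)
  | call (len : NExp) (r : ℕ)

def State.setReg (σ : State) (r v : ℕ) : State :=
  { σ with reg := Function.update σ.reg r v }

def State.setCell (σ : State) (a i : ℕ) (x : ℝ) : State :=
  { σ with mem := Function.update σ.mem a (Function.update (σ.mem a) i x) }

/-- The first `k` cells of array `a`. -/
def State.read (σ : State) (a k : ℕ) : List ℝ := (List.range k).map (σ.mem a)

/-- Write the word `w` to the beginning of array `a`. -/
def State.write (σ : State) (a : ℕ) (w : List ℝ) : State :=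
  { σ with mem := Function.update σ.mem a (fun i => w.getD i (σ.mem a i)) }

/-- `Run O p σ T qs σ'`: with oracle `O`, the program `p` started in the state `σ` halts in the
state `σ'` after `T` elementary operations, having submitted the queries `qs` in this order. -/
inductive Run (O : List ℝ → List ℝ) :
    Prog → State → ℕ → List (List ℝ) → State → Prop where
  | skip (σ : State) : Run O .skip σ 0 [] σ
  | setReg (r : ℕ) (e : NExp) (σ : State) :
      Run O (.setReg r e) σ (e.size + 1) [] (σ.setReg r (e.eval σ))
  | setCell (a : ℕ) (i : NExp) (e : RExp) (σ : State) :
      Run O (.setCell a i e) σ (i.size + e.size + 1) [] (σ.setCell a (i.eval σ) (e.eval σ))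
  | seq {p q : Prog} {σ₁ σ₂ σ₃ : State} {T₁ T₂ : ℕ} {qs₁ qs₂ : List (List ℝ)} :
      Run O p σ₁ T₁ qs₁ σ₂ → Run O q σ₂ T₂ qs₂ σ₃ →
      Run O (.seq p q) σ₁ (T₁ + T₂) (qs₁ ++ qs₂) σ₃
  | ite_true {c : Test} {p q : Prog} {σ₁ σ₂ : State} {T : ℕ} {qs : List (List ℝ)} :
      c.holds σ₁ → Run O p σ₁ T qs σ₂ → Run O (.ite c p q) σ₁ (c.size + T) qs σ₂
  | ite_false {c : Test} {p q : Prog} {σ₁ σ₂ : State} {T : ℕ} {qs : List (List ℝ)} :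
      ¬ c.holds σ₁ → Run O q σ₁ T qs σ₂ → Run O (.ite c p q) σ₁ (c.size + T) qs σ₂
  | loop_true {c : Test} {p : Prog} {σ₁ σ₂ σ₃ : State} {T₁ T₂ : ℕ}
      {qs₁ qs₂ : List (List ℝ)} :
      c.holds σ₁ → Run O p σ₁ T₁ qs₁ σ₂ → Run O (.loop c p) σ₂ T₂ qs₂ σ₃ →
      Run O (.loop c p) σ₁ (c.size + T₁ + T₂) (qs₁ ++ qs₂) σ₃
  | loop_false {c : Test} {p : Prog} {σ : State} :
      ¬ c.holds σ → Run O (.loop c p) σ c.size [] σ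
  | call (len : NExp) (r : ℕ) (σ : State) (q : List ℝ) :
      q = σ.read 2 (len.eval σ) →
      Run O (.call len r) σ (len.size + 1 + q.length + (O q).length) [q]
        ((σ.write 3 (O q)).setReg r (O q).length)

/-- Initial state: the input word is in array `0`, its length in register `0`; all else is `0`. -/
def State.init (w : List ℝ) : State where
  reg := fun r => if r = 0 then w.length else 0
  mem := fun a i => if a = 0 then w.getD i 0 else 0

/-- The output word: the first cells of array `1`, as many as register `1` says. -/
def State.output (σ : State) : List ℝ := σ.read 1 (σ.reg 1)

/-- A computational problem: instances with a size, the words that describe an instance, and the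
words that are correct answers. -/
structure Problem where
  Inst : Type
  size : Inst → ℕ
  Describes : List ℝ → Inst → Prop
  Answers : List ℝ → Inst → Prop

/-- `O` answers every correctly described instance of `Q` correctly. -/
def Problem.SolvedBy (Q : Problem) (O : List ℝ → List ℝ) : Prop :=
  ∀ (J : Q.Inst) (w : List ℝ), Q.Describes w J → Q.Answers (O w) J

/-- One program solves `P` with any oracle for `Q`, with polynomially many (in the size of the
instance) operations and polynomially many oracle calls, each of them on an instance of `Q`
whose size is at most that of the given instance. -/
def PolySolvableWithOracle (P Q : Problem) : Prop :=
  ∃ (prog : Prog) (C k : ℕ), ∀ O : List ℝ → List ℝ, Q.SolvedBy O →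
    ∀ (I : P.Inst) (w : List ℝ), P.Describes w I →
      ∃ (T : ℕ) (qs : List (List ℝ)) (σ : State),
        Run O prog (State.init w) T qs σ ∧
        P.Answers σ.output I ∧
        T ≤ C * (P.size I + 1) ^ k ∧
        qs.length ≤ C * (P.size I + 1) ^ k ∧
        ∀ q ∈ qs, ∃ J : Q.Inst, Q.Describes q J ∧ Q.size J ≤ P.size I

end RealRAM

namespace ModelSet

open RealRAM

/-! ### Cyclotomic model sets -/

/-- The ring `ℤ[ζ]`. -/
def ringO (ζ : ℂ) : Subalgebra ℤ ℂ := Algebra.adjoin ℤ {ζ}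

/-- The field `ℚ(ζ)`. -/
abbrev fieldK (ζ : ℂ) : IntermediateField ℚ ℂ := IntermediateField.adjoin ℚ {ζ}

/-- The identity together with `σ` contains exactly one member of each pair of complex conjugate
automorphisms of `ℚ(ζ)`. -/
def IsStarChoice (ζ : ℂ) {k : ℕ} (σ : Fin k → (fieldK ζ ≃ₐ[ℚ] fieldK ζ)) : Prop :=
  ∀ g : fieldK ζ ≃ₐ[ℚ] fieldK ζ, ∃! j : Option (Fin k),
    (∀ x, ((j.elim AlgEquiv.refl σ : fieldK ζ ≃ₐ[ℚ] fieldK ζ) x : ℂ) = (g x : ℂ)) ∨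
    (∀ x, ((j.elim AlgEquiv.refl σ : fieldK ζ ≃ₐ[ℚ] fieldK ζ) x : ℂ) = star (g x : ℂ))

/-- The internal space `(ℝ²)ᵏ`. -/
abbrev Internal (k : ℕ) : Type := Fin k × Fin 2 → ℝ

/-- The star map, with `ℂ = ℝ²`. -/
def starMap {ζ : ℂ} {k : ℕ} (σ : Fin k → (fieldK ζ ≃ₐ[ℚ] fieldK ζ)) (z : fieldK ζ) :
    Internal k :=
  fun j => ![((σ j.1 z : fieldK ζ) : ℂ).re, ((σ j.1 z : fieldK ζ) : ℂ).im] j.2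

/-- Windows: `∅ ≠ W° ⊆ W ⊆ closure W°`, and `closure W°` is compact. -/
def IsWindow {k : ℕ} (W : Set (Internal k)) : Prop :=
  (interior W).Nonempty ∧ W ⊆ closure (interior W) ∧ IsCompact (closure (interior W))

/-- The polyhedron `{x | A x ≤ b}`. -/
def polyhedron {k l : ℕ} (A : Matrix (Fin l) (Fin k × Fin 2) ℝ) (b : Fin l → ℝ) :
    Set (Internal k) :=
  {x | ∀ i, (A.mulVec x) i ≤ b i}

/-- The model set `Λ(t, W) = t + {z ∈ ℤ[ζ] | z⋆ ∈ W}`. -/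
def modelSet {ζ : ℂ} {k : ℕ} (σ : Fin k → (fieldK ζ ≃ₐ[ℚ] fieldK ζ)) (t : ℂ)
    (W : Set (Internal k)) : Set ℂ :=
  {x | ∃ z : fieldK ζ, (z : ℂ) ∈ ringO ζ ∧ starMap σ z ∈ W ∧ x = t + (z : ℂ)}

/-- The `W°`-sets: the sets `Λ(t, τ + W°)`. -/
def IsWSet {ζ : ℂ} {k : ℕ} (σ : Fin k → (fieldK ζ ≃ₐ[ℚ] fieldK ζ)) (W : Set (Internal k))
    (Λ : Set ℂ) : Prop :=
  ∃ (t : ℂ) (τ : Internal k), Λ = modelSet σ t ((fun x => τ + x) '' interior W)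

/-! ### X-rays -/

/-- The line `t + ℝ o`. -/
def line (t o : ℂ) : Set ℂ := {z | ∃ r : ℝ, z = t + (r : ℂ) * o}

/-- The lines in direction `o`. -/
abbrev LineIn (o : ℂ) : Type := {ℓ : Set ℂ // ∃ t : ℂ, ℓ = line t o}

/-- The line in direction `o` through `t`. -/
def lineThrough (t o : ℂ) : LineIn o := ⟨line t o, t, rfl⟩

/-- The discrete parallel X-ray of `F` in direction `o`. -/
def xray (o : ℂ) (F : Finset ℂ) (ℓ : LineIn o) : ℕ := ((F : Set ℂ) ∩ ℓ.1).ncard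

/-- The maximum of the cardinalities of the supports of X-ray data. -/
def maxSupport {m : ℕ} {o : Fin m → ℂ} (p : ∀ i, LineIn (o i) → ℕ) : ℕ :=
  Finset.univ.sup fun i => (Function.support (p i)).ncard

/-! ### Description of the data by real words -/

/-- The list `L` enumerates the finite set `F` without repetition. -/
def Enumerates (L : List ℂ) (F : Finset ℂ) : Prop := L.Nodup ∧ ∀ z, z ∈ L ↔ z ∈ F

/-- The list `L` gives the data function `p`: each line of the support of `p` is listed once,
through one of its points, together with the value of `p`. -/
def ListsData {o : ℂ} (L : List (ℂ × ℕ)) (p : LineIn o → ℕ) : Prop :=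
  (L.map fun e => lineThrough e.1 o).Nodup ∧ (∀ e ∈ L, e.2 ≠ 0) ∧
    ∀ (ℓ : LineIn o) (v : ℕ), v ≠ 0 → (p ℓ = v ↔ ∃ e ∈ L, lineThrough e.1 o = ℓ ∧ e.2 = v)

/-- The element of `ℤ[ζ]` with given coordinates with respect to `1, ζ, …, ζ^(d-1)`. -/
def ofCoords (ζ : ℂ) {d : ℕ} (c : Fin d → ℤ) : ℂ := ∑ j, (c j : ℂ) * ζ ^ (j : ℕ)

/-- Points of the plane as pairs of reals. -/
def encPoints (L : List ℂ) : List ℝ := L.flatMap fun z => [z.re, z.im]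

def encCoords {d : ℕ} (c : Fin d → ℤ) : List ℝ := List.ofFn fun j => (c j : ℝ)

/-- X-ray data in one direction, lines being given by a point in the plane. -/
def encData (L : List (ℂ × ℕ)) : List ℝ :=
  (L.length : ℝ) :: L.flatMap fun e => [e.1.re, e.1.im, (e.2 : ℝ)]

/-- X-ray data in one direction, lines being given by the coordinates of a point of `ℤ[ζ]`. -/
def encCoordData {d : ℕ} (L : List ((Fin d → ℤ) × ℕ)) : List ℝ :=
  (L.length : ℝ) :: L.flatMap fun e => encCoords e.1 ++ [(e.2 : ℝ)]

/-- The answer `1` (yes) or `0` (no) to a decision problem. -/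
def Decides (w : List ℝ) (yes : Prop) : Prop := (yes ∧ w = [1]) ∨ (¬ yes ∧ w = [0])

/-- The answer to a construction problem: `1` followed by the points of a solution, or `0` if
there is no solution. -/
def Constructs (w : List ℝ) (sol : Finset ℂ → Prop) : Prop :=
  (∃ (F : Finset ℂ) (L : List ℂ), sol F ∧ Enumerates L F ∧ w = 1 :: encPoints L) ∨
    ((¬ ∃ F, sol F) ∧ w = [0])

/-! ### The tomographic problems for fixed `ζ`, star map, window and directions -/

/-- X-ray data with finite supports consisting of module lines. -/
structure ModuleData (ζ : ℂ) {m : ℕ} (o : Fin m → ℂ) where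
  p : ∀ i, LineIn (o i) → ℕ
  finite : ∀ i, (Function.support (p i)).Finite
  module_lines : ∀ i, ∀ ℓ ∈ Function.support (p i), ∃ t ∈ ringO ζ, ℓ = lineThrough t (o i)

/-- Module data are given by module points on the lines, in integer coordinates. -/
def ModuleData.IsDescribed (d : ℕ) {ζ : ℂ} {m : ℕ} {o : Fin m → ℂ} (w : List ℝ)
    (I : ModuleData ζ o) : Prop :=
  ∃ L : Fin m → List ((Fin d → ℤ) × ℕ),
    (∀ i, ListsData ((L i).map fun e => (ofCoords ζ e.1, e.2)) (I.p i)) ∧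
    w = (List.ofFn fun i => encCoordData (L i)).flatten

/-- `F` is contained in a `W°`-set and has the X-rays `p`. -/
def IsSolution {ζ : ℂ} {k : ℕ} (σ : Fin k → (fieldK ζ ≃ₐ[ℚ] fieldK ζ)) (W : Set (Internal k))
    {m : ℕ} {o : Fin m → ℂ} (p : ∀ i, LineIn (o i) → ℕ) (F : Finset ℂ) : Prop :=
  (∃ Λ, IsWSet σ W Λ ∧ (F : Set ℂ) ⊆ Λ) ∧ ∀ i, xray (o i) F = p i

/-- Consistency; `d` is the number of coordinates that are used for `ℤ[ζ]`. -/
def consistency (d : ℕ) {ζ : ℂ} {k : ℕ} (σ : Fin k → (fieldK ζ ≃ₐ[ℚ] fieldK ζ))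
    (W : Set (Internal k)) {m : ℕ} (o : Fin m → ℂ) : Problem where
  Inst := ModuleData ζ o
  size := fun I => maxSupport I.p
  Describes := fun w I => I.IsDescribed d w
  Answers := fun w I => Decides w (∃ F, IsSolution σ W I.p F)

/-- Reconstruction. -/
def reconstruction (d : ℕ) {ζ : ℂ} {k : ℕ} (σ : Fin k → (fieldK ζ ≃ₐ[ℚ] fieldK ζ))
    (W : Set (Internal k)) {m : ℕ} (o : Fin m → ℂ) : Problem where
  Inst := ModuleData ζ o
  size := fun I => maxSupport I.p
  Describes := fun w I => I.IsDescribed d w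
  Answers := fun w I => Constructs w (IsSolution σ W I.p)

/-- Uniqueness: is there a different set with the same X-rays? The given set `F` lives on
`ℤ[ζ]`; it is described by a translation vector `t` and the integer coordinates of the points of
`F - t ⊆ ℤ[ζ]`. -/
def uniqueness (d : ℕ) {ζ : ℂ} {k : ℕ} (σ : Fin k → (fieldK ζ ≃ₐ[ℚ] fieldK ζ))
    (W : Set (Internal k)) {m : ℕ} (o : Fin m → ℂ) : Problem where
  Inst := {F : Finset ℂ // ∃ Λ, IsWSet σ W Λ ∧ (F : Set ℂ) ⊆ Λ}
  size := fun F => maxSupport fun i => xray (o i) F.1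
  Describes := fun w F => ∃ (t : ℂ) (L : List (Fin d → ℤ)),
    Enumerates (L.map fun c => t + ofCoords ζ c) F.1 ∧
    w = t.re :: t.im :: (L.length : ℝ) :: L.flatMap encCoords
  Answers := fun w F =>
    Decides w (∃ F' : Finset ℂ, F' ≠ F.1 ∧ IsSolution σ W (fun i => xray (o i) F.1) F')

/-! ### The anchored problems: the solution is sought in a given finite set `S` of the plane -/

/-- X-ray data with supports of cardinality at most `s`, and at most `s²` candidate points. -/
structure AnchoredData {m : ℕ} (o : Fin m → ℂ) where
  s : ℕ
  p : ∀ i, LineIn (o i) → ℕ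
  finite : ∀ i, (Function.support (p i)).Finite
  card_le : ∀ i, (Function.support (p i)).ncard ≤ s
  S : Finset ℂ
  card_S_le : S.card ≤ s ^ 2

def AnchoredData.IsDescribed {m : ℕ} {o : Fin m → ℂ} (w : List ℝ) (J : AnchoredData o) : Prop :=
  ∃ (L : Fin m → List (ℂ × ℕ)) (P : List ℂ),
    (∀ i, ListsData (L i) (J.p i)) ∧ Enumerates P J.S ∧
    w = (J.s : ℝ) :: ((List.ofFn fun i => encData (L i)).flatten ++
      (P.length : ℝ) :: encPoints P)

def AnchoredData.IsSolution {m : ℕ} {o : Fin m → ℂ} (J : AnchoredData o) (F : Finset ℂ) : Prop :=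
  F ⊆ J.S ∧ ∀ i, xray (o i) F = J.p i

/-- Anchored consistency. -/
def anchoredConsistency {m : ℕ} (o : Fin m → ℂ) : Problem where
  Inst := AnchoredData o
  size := fun J => J.s
  Describes := fun w J => J.IsDescribed w
  Answers := fun w J => Decides w (∃ F, J.IsSolution F)

/-- Anchored reconstruction. -/
def anchoredReconstruction {m : ℕ} (o : Fin m → ℂ) : Problem where
  Inst := AnchoredData o
  size := fun J => J.s
  Describes := fun w J => J.IsDescribed w
  Answers := fun w J => Constructs w J.IsSolution

/-- A finite set `F` whose X-rays have supports of cardinality at most `s`, and at most `s²`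
candidate points. -/
structure AnchoredSet {m : ℕ} (o : Fin m → ℂ) where
  s : ℕ
  F : Finset ℂ
  card_le : ∀ i, (Function.support (xray (o i) F)).ncard ≤ s
  S : Finset ℂ
  card_S_le : S.card ≤ s ^ 2

/-- Anchored uniqueness: is there a set in `S`, different from `F`, with the X-rays of `F`? -/
def anchoredUniqueness {m : ℕ} (o : Fin m → ℂ) : Problem where
  Inst := AnchoredSet o
  size := fun J => J.s
  Describes := fun w J => ∃ L P : List ℂ, Enumerates L J.F ∧ Enumerates P J.S ∧
    w = (J.s : ℝ) :: (L.length : ℝ) :: (encPoints L ++ (P.length : ℝ) :: encPoints P)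
  Answers := fun w J => Decides w
    (∃ F' : Finset ℂ, F' ≠ J.F ∧ F' ⊆ J.S ∧ ∀ i, xray (o i) F' = xray (o i) J.F)

end ModelSet

end

/-! A nonempty solution lies in the grid of intersections of the supporting lines in the first two
directions, which has at most `s ^ 2` points. The difficulty is that the translation and the window
position of the `W°`-set are unknown. They matter only through finitely many points. Two points of a
solution differ by an element of `ℤ[ζ]`, so one reference point fixes the class modulo `ℤ[ζ]`. The
interior of the window is given by `l` strict inequalities, and the `r`-th one holds on the whole
solution as soon as it holds at a point where the form `A_r z⋆` is maximal. Hence `l + 1` grid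
points determine a candidate set: the grid points congruent to the reference point whose forms do
not exceed those of the chosen maximisers.

If some translate of the window fits the maximisers, the candidate set lies in one `W°`-set
(`exists_isWSet_of_feasible`), so every anchored solution in it is a genuine solution. Conversely,
every nonempty solution lies in the candidate set of some feasible tuple
(`exists_feasible_of_isWSet`). Since `l` is fixed, only polynomially many tuples have to be tried,
with one oracle call for each feasible one; the empty solution gets a call of its own.

Everything needed is computable with constants depending only on the fixed data. The projection
along one direction onto another preserves `ℚ(ζ)`, so grid points have rational coordinates given by
a fixed matrix (`exists_gridMatrix`). Congruence is integrality of coordinate differences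
(`ratPoint_mem_ringO`). The star map is `ℚ`-linear, so the forms `A_r z⋆` have fixed real
coefficients (`mulVec_starMap`). The existence of a window position is a fixed finite list of strict
linear inequalities, by Fourier-Motzkin elimination (`exists_feasibility_test`).

The program logic `Ok` yields correctness, time bound and validity of the queries at once.
`ok_search` treats the enumeration, `ok_gridSearch` combines it with the geometry, and the rest is
the parsing of the inputs. -/

noncomputable section

namespace RealRAM

/-! ### A program logic with built-in time bounds -/

/-- A time bound, if every loop makes at most `B` iterations and every oracle call concerns words
of total length at most `B`. -/
def Prog.cost (B : ℕ) : Prog → ℕ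
  | .skip => 0
  | .setReg _ e => e.size + 1
  | .setCell _ i e => i.size + e.size + 1
  | .seq p q => p.cost B + q.cost B
  | .ite c p q => c.size + (p.cost B + q.cost B)
  | .loop c p => B * (c.size + p.cost B) + c.size
  | .call len _ => len.size + 1 + B

/-- Functions of polynomial growth. -/
def PolyBounded (f : ℕ → ℕ) : Prop := ∃ C k : ℕ, ∀ s, f s ≤ C * (s + 1) ^ k

theorem PolyBounded.const (c : ℕ) : PolyBounded fun _ => c :=
  ⟨c, 0, fun s => by simp⟩

theorem PolyBounded.id : PolyBounded fun s => s :=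
  ⟨1, 1, fun s => by simp⟩

theorem PolyBounded.add {f g : ℕ → ℕ} (hf : PolyBounded f) (hg : PolyBounded g) :
    PolyBounded fun s => f s + g s := by
  obtain ⟨C, k, hC⟩ := hf
  obtain ⟨D, l, hD⟩ := hg
  refine ⟨C + D, k + l, fun s => ?_⟩
  have h1 : (s + 1) ^ k ≤ (s + 1) ^ (k + l) := Nat.pow_le_pow_right (by omega) (by omega)
  have h2 : (s + 1) ^ l ≤ (s + 1) ^ (k + l) := Nat.pow_le_pow_right (by omega) (by omega)
  calc f s + g s ≤ C * (s + 1) ^ k + D * (s + 1) ^ l := add_le_add (hC s) (hD s)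
    _ ≤ C * (s + 1) ^ (k + l) + D * (s + 1) ^ (k + l) := by gcongr
    _ = _ := by ring

theorem PolyBounded.mul {f g : ℕ → ℕ} (hf : PolyBounded f) (hg : PolyBounded g) :
    PolyBounded fun s => f s * g s := by
  obtain ⟨C, k, hC⟩ := hf
  obtain ⟨D, l, hD⟩ := hg
  refine ⟨C * D, k + l, fun s => ?_⟩
  calc f s * g s ≤ (C * (s + 1) ^ k) * (D * (s + 1) ^ l) := Nat.mul_le_mul (hC s) (hD s)
    _ = _ := by ring

theorem PolyBounded.comp {f g : ℕ → ℕ} (hf : PolyBounded f) (hg : PolyBounded g) :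
    PolyBounded fun s => f (g s) := by
  obtain ⟨C, k, hC⟩ := hf
  obtain ⟨D, l, hD⟩ := hg
  refine ⟨C * (D + 1) ^ k, l * k, fun s => ?_⟩
  have h1 : 1 ≤ (s + 1) ^ l := Nat.one_le_pow _ _ (by omega)
  calc f (g s) ≤ C * (g s + 1) ^ k := hC _
    _ ≤ C * ((D + 1) * (s + 1) ^ l) ^ k := by
        gcongr
        have := hD s
        nlinarith
    _ = _ := by rw [mul_pow, ← pow_mul, mul_assoc]

/-- Each loop contributes one factor `B`, and the nesting depth is fixed by the program text. -/
theorem Prog.polyBounded_cost (p : Prog) : PolyBounded fun B => p.cost B := by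
  induction p with
  | skip => exact .const _
  | setReg r e => exact .const _
  | setCell a i e => exact .const _
  | seq p q hp hq => exact hp.add hq
  | ite c p q hp hq => exact (PolyBounded.const _).add (hp.add hq)
  | loop c p hp => exact (PolyBounded.id.mul ((PolyBounded.const _).add hp)).add (.const _)
  | call len r => exact (PolyBounded.const _).add .id

/-- The number of oracle calls is at most the number of operations. -/
theorem Run.length_le {O : List ℝ → List ℝ} {p : Prog} {σ σ' : State} {T : ℕ}
    {qs : List (List ℝ)} (h : Run O p σ T qs σ') : qs.length ≤ T := by
  induction h <;>
    try simp only [List.length_append, List.length_nil, List.length_cons]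
  all_goals omega

/-- From `σ`, the program `p` halts within its time bound, all its queries satisfy `G`, and the
final state satisfies `Q`. -/
def Ok (O : List ℝ → List ℝ) (G : List ℝ → Prop) (B : ℕ) (p : Prog) (σ : State)
    (Q : State → Prop) : Prop :=
  ∃ T qs σ', Run O p σ T qs σ' ∧ T ≤ p.cost B ∧ (∀ q ∈ qs, G q) ∧ Q σ'

section

variable {O : List ℝ → List ℝ} {G : List ℝ → Prop} {B : ℕ} {σ : State} {Q Q' : State → Prop}
  {p q : Prog} {c : Test}

theorem Ok.mono (h : Ok O G B p σ Q) (hQ : ∀ σ', Q σ' → Q' σ') : Ok O G B p σ Q' := by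
  obtain ⟨T, qs, σ', h1, h2, h3, h4⟩ := h
  exact ⟨T, qs, σ', h1, h2, h3, hQ _ h4⟩

theorem Ok.weaken {G' : List ℝ → Prop} (h : Ok O G B p σ Q) (hG : ∀ q, G q → G' q) :
    Ok O G' B p σ Q := by
  obtain ⟨T, qs, σ', h1, h2, h3, h4⟩ := h
  exact ⟨T, qs, σ', h1, h2, fun q hq => hG q (h3 q hq), h4⟩

theorem Ok.skip (h : Q σ) : Ok O G B .skip σ Q :=
  ⟨_, _, _, .skip σ, by simp [Prog.cost], by simp, h⟩

theorem Ok.setReg {r : ℕ} {e : NExp} (h : Q (σ.setReg r (e.eval σ))) :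
    Ok O G B (.setReg r e) σ Q :=
  ⟨_, _, _, .setReg r e σ, by simp [Prog.cost], by simp, h⟩

theorem Ok.setCell {a : ℕ} {i : NExp} {e : RExp}
    (h : Q (σ.setCell a (i.eval σ) (e.eval σ))) : Ok O G B (.setCell a i e) σ Q :=
  ⟨_, _, _, .setCell a i e σ, by simp [Prog.cost], by simp, h⟩

theorem Ok.setReg_eq {r v : ℕ} {e : NExp} (he : e.eval σ = v) (h : Q (σ.setReg r v)) :
    Ok O G B (.setReg r e) σ Q :=
  .setReg (he ▸ h)

theorem Ok.setCell_eq {a k : ℕ} {i : NExp} {e : RExp} {x : ℝ} (hi : i.eval σ = k)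
    (he : e.eval σ = x) (h : Q (σ.setCell a k x)) : Ok O G B (.setCell a i e) σ Q :=
  .setCell (he ▸ hi ▸ h)

theorem Ok.seq (h : Ok O G B p σ fun σ' => Ok O G B q σ' Q) : Ok O G B (.seq p q) σ Q := by
  obtain ⟨T, qs, σ', h1, h2, h3, T', qs', σ'', h1', h2', h3', h4'⟩ := h
  refine ⟨_, _, _, .seq h1 h1', by simp only [Prog.cost]; omega, ?_, h4'⟩
  intro x hx
  rcases List.mem_append.1 hx with hx | hx
  exacts [h3 x hx, h3' x hx]

theorem Ok.ite (h1 : c.holds σ → Ok O G B p σ Q) (h2 : ¬ c.holds σ → Ok O G B q σ Q) :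
    Ok O G B (.ite c p q) σ Q := by
  by_cases hc : c.holds σ
  · obtain ⟨T, qs, σ', h1, h2, h3, h4⟩ := h1 hc
    exact ⟨_, _, _, .ite_true hc h1, by simp only [Prog.cost]; omega, h3, h4⟩
  · obtain ⟨T, qs, σ', h1, h2, h3, h4⟩ := h2 hc
    exact ⟨_, _, _, .ite_false hc h1, by simp only [Prog.cost]; omega, h3, h4⟩

theorem Ok.call {len : NExp} {r : ℕ} {w : List ℝ} (hw : σ.read 2 (len.eval σ) = w) (hG : G w)
    (hB : w.length + (O w).length ≤ B)
    (h : Q ((σ.write 3 (O w)).setReg r (O w).length)) : Ok O G B (.call len r) σ Q := by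
  refine ⟨_, _, _, .call len r σ w hw.symm, ?_, ?_, h⟩
  · simp only [Prog.cost]; omega
  · simpa using hG

/-- The invariant is indexed by the number of completed iterations, so termination after exactly `N`
rounds comes with it. The program itself need not know `N`. -/
theorem Ok.loop {N : ℕ} (Inv : ℕ → State → Prop) (hN : N ≤ B) (h0 : Inv 0 σ)
    (hc : ∀ i σ, i ≤ N → Inv i σ → (c.holds σ ↔ i < N))
    (hb : ∀ i σ, i < N → Inv i σ → Ok O G B p σ (Inv (i + 1)))
    (hQ : ∀ σ, Inv N σ → Q σ) : Ok O G B (.loop c p) σ Q := by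
  -- Induction on the number `j` of iterations that remain.
  have key : ∀ j ≤ N, ∀ σ, Inv (N - j) σ → ∃ T qs σ', Run O (.loop c p) σ T qs σ' ∧
      T ≤ j * (c.size + p.cost B) + c.size ∧ (∀ q ∈ qs, G q) ∧ Q σ' := by
    intro j
    induction j with
    | zero =>
      intro _ σ h
      rw [Nat.sub_zero] at h
      exact ⟨_, _, _, .loop_false (by rw [hc N σ le_rfl h]; simp), by simp, by simp, hQ _ h⟩
    | succ j ih =>
      intro hj σ h
      obtain ⟨T, qs, σ', h1, h2, h3, h4⟩ := hb (N - (j + 1)) σ (by omega) h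
      rw [show N - (j + 1) + 1 = N - j by omega] at h4
      obtain ⟨T', qs', σ'', h1', h2', h3', h4'⟩ := ih (by omega) σ' h4
      refine ⟨_, _, _, .loop_true ((hc _ σ (by omega) h).2 (by omega)) h1 h1', ?_, ?_, h4'⟩
      · rw [add_mul, one_mul]; omega
      · intro x hx
        rcases List.mem_append.1 hx with hx | hx
        exacts [h3 x hx, h3' x hx]
  obtain ⟨T, qs, σ', h1, h2, h3, h4⟩ := key N le_rfl σ (by simpa using h0)
  refine ⟨T, qs, σ', h1, h2.trans ?_, h3, h4⟩
  simp only [Prog.cost]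
  gcongr

/-- Count the register `r` from `0` up to the bound `b`. -/
def Prog.count (r : ℕ) (b : NExp) (p : Prog) : Prog :=
  .seq (.setReg r (.const 0))
    (.loop (.natLt (.reg r) b) (.seq p (.setReg r (.add (.reg r) (.const 1)))))

/-- The bound `b` is re-evaluated before every round, so the invariant has to fix its value; the
body has to preserve the counter. -/
theorem Ok.count {r : ℕ} {b : NExp} {N : ℕ} (Inv : ℕ → State → Prop) (hN : N ≤ B)
    (h0 : Inv 0 (σ.setReg r 0)) (hr : ∀ i σ, Inv i σ → σ.reg r = i)
    (hbd : ∀ i σ, Inv i σ → b.eval σ = N)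
    (hb : ∀ i σ, i < N → Inv i σ →
      Ok O G B p σ fun σ' => σ'.reg r = i ∧ Inv (i + 1) (σ'.setReg r (i + 1)))
    (hQ : ∀ σ, Inv N σ → Q σ) : Ok O G B (.count r b p) σ Q := by
  refine .seq (.setReg (.loop Inv hN h0 ?_ ?_ hQ))
  · intro i σ _ h
    simp only [Test.holds, NExp.eval, hr i σ h, hbd i σ h]
  · intro i σ hi h
    refine .seq ((hb i σ hi h).mono fun σ' h' => .setReg ?_)
    simpa only [NExp.eval, h'.1] using h'.2

end

theorem polySolvable_of_ok {P Q : Problem} {prog : Prog} {f : ℕ → ℕ} (hf : PolyBounded f)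
    (h : ∀ O : List ℝ → List ℝ, Q.SolvedBy O → ∀ (I : P.Inst) (w : List ℝ), P.Describes w I →
      Ok O (fun q => ∃ J : Q.Inst, Q.Describes q J ∧ Q.size J ≤ P.size I) (f (P.size I)) prog
        (State.init w) fun σ => P.Answers σ.output I) : PolySolvableWithOracle P Q := by
  obtain ⟨C, k, hC⟩ := prog.polyBounded_cost.comp hf
  refine ⟨prog, C, k, fun O hO I w hw => ?_⟩
  obtain ⟨T, qs, σ, h1, h2, h3, h4⟩ := h O hO I w hw
  have hT := h2.trans (hC _)
  exact ⟨T, qs, σ, h1, h4, hT, h1.length_le.trans hT, h3⟩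

/-! ### Words in memory -/

@[simp] theorem State.setReg_mem (σ : State) (r v : ℕ) : (σ.setReg r v).mem = σ.mem := rfl
@[simp] theorem State.setReg_reg_self (σ : State) (r v : ℕ) : (σ.setReg r v).reg r = v := by
  simp [State.setReg]
theorem State.setReg_reg_of_ne (σ : State) {r r' : ℕ} (v : ℕ) (h : r' ≠ r) :
    (σ.setReg r v).reg r' = σ.reg r' := by
  simp [State.setReg, h]
@[simp] theorem State.setReg_reg (σ : State) (r v r' : ℕ) :
    (σ.setReg r v).reg r' = if r' = r then v else σ.reg r' := by
  simp [State.setReg, Function.update_apply]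
@[simp] theorem State.setCell_reg (σ : State) (a i : ℕ) (x : ℝ) :
    (σ.setCell a i x).reg = σ.reg := rfl
@[simp] theorem State.setCell_mem (σ : State) (a i : ℕ) (x : ℝ) (a' : ℕ) :
    (σ.setCell a i x).mem a' = if a' = a then Function.update (σ.mem a) i x else σ.mem a' := by
  simp [State.setCell, Function.update_apply]
@[simp] theorem State.write_reg (σ : State) (a : ℕ) (w : List ℝ) :
    (σ.write a w).reg = σ.reg := rfl
@[simp] theorem State.write_mem (σ : State) (a : ℕ) (w : List ℝ) (a' : ℕ) :
    (σ.write a w).mem a' = if a' = a then (fun i => w.getD i (σ.mem a i)) else σ.mem a' := by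
  simp [State.write, Function.update_apply]

/-- The word `w` stands in the array `f` from cell `off` on. -/
def Stored (f : ℕ → ℝ) (off : ℕ) (w : List ℝ) : Prop :=
  ∀ k < w.length, f (off + k) = w.getD k 0

theorem Stored.nil (f : ℕ → ℝ) (off : ℕ) : Stored f off [] := by simp [Stored]

theorem Stored.congr {f g : ℕ → ℝ} {off : ℕ} {w : List ℝ} (h : Stored f off w)
    (hfg : ∀ i, off ≤ i → i < off + w.length → g i = f i) : Stored g off w := by
  intro k hk
  rw [hfg _ (by omega) (by omega), h k hk]

theorem stored_append {f : ℕ → ℝ} {off : ℕ} {v w : List ℝ} :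
    Stored f off (v ++ w) ↔ Stored f off v ∧ Stored f (off + v.length) w := by
  constructor
  · intro h
    constructor
    · intro k hk
      rw [h k (by simp; omega), List.getD_append _ _ _ _ hk]
    · intro k hk
      rw [add_assoc, h (v.length + k) (by simp; omega), List.getD_append_right _ _ _ _ (by omega)]
      simp
  · rintro ⟨h1, h2⟩ k hk
    by_cases hkv : k < v.length
    · rw [h1 k hkv, List.getD_append _ _ _ _ hkv]
    · rw [List.getD_append_right _ _ _ _ (by omega), ← h2 (k - v.length)
        (by simp at hk; omega)]
      congr 1; omega

theorem stored_singleton {f : ℕ → ℝ} {off : ℕ} {x : ℝ} : Stored f off [x] ↔ f off = x := by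
  simp [Stored]

theorem stored_cons {f : ℕ → ℝ} {off : ℕ} {x : ℝ} {w : List ℝ} :
    Stored f off (x :: w) ↔ f off = x ∧ Stored f (off + 1) w := by
  rw [← List.singleton_append, stored_append, stored_singleton]; rfl

theorem Stored.update {f : ℕ → ℝ} {off i : ℕ} {w : List ℝ} (h : Stored f off w) (x : ℝ)
    (hi : off + w.length ≤ i ∨ i < off) : Stored (Function.update f i x) off w :=
  h.congr fun j _ _ => Function.update_of_ne (by omega) _ _

theorem Stored.snoc {f : ℕ → ℝ} {off i : ℕ} {w : List ℝ} (h : Stored f off w) {x : ℝ}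
    (hi : i = off + w.length) : Stored (Function.update f i x) off (w ++ [x]) := by
  rw [stored_append, stored_singleton]
  exact ⟨h.update x (by omega), by simp [hi]⟩

theorem State.read_eq {σ : State} {a k : ℕ} {w : List ℝ} (hk : k = w.length)
    (h : Stored (σ.mem a) 0 w) : σ.read a k = w := by
  subst hk
  apply List.ext_getElem
  · simp [State.read]
  · intro i h1 h2
    have := h i h2
    simp only [zero_add] at this
    simp [State.read, this, h2]

theorem stored_write (σ : State) (a : ℕ) (w : List ℝ) : Stored ((σ.write a w).mem a) 0 w := by
  intro k hk
  simp [hk]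

theorem stored_init (w : List ℝ) : Stored ((State.init w).mem 0) 0 w := by
  intro k hk
  simp [State.init]

/-! ### Compound expressions -/

/-- The sum of a finite family of expressions. -/
def RExp.sum {d : ℕ} (f : Fin d → RExp) : RExp := (List.ofFn f).foldr .add (.const 0)

@[simp] theorem RExp.eval_sum {d : ℕ} (f : Fin d → RExp) (σ : State) :
    (RExp.sum f).eval σ = ∑ i, (f i).eval σ := by
  rw [← List.sum_ofFn, RExp.sum, ← Function.comp_def (fun e : RExp => e.eval σ) f,
    ← List.map_ofFn]
  induction List.ofFn f with
  | nil => simp [RExp.eval]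
  | cons a t ih => simp [RExp.eval, ih]

/-- The conjunction of a list of tests. -/
def Test.all (L : List Test) : Test := L.foldr .and (.natEq (.const 0) (.const 0))

@[simp] theorem Test.holds_all (L : List Test) (σ : State) :
    (Test.all L).holds σ ↔ ∀ c ∈ L, c.holds σ := by
  unfold Test.all
  induction L with
  | nil => simp [Test.holds, NExp.eval]
  | cons a t ih => simp [Test.holds, ih]

end RealRAM

namespace ModelSet

open RealRAM

/-! ### The search program -/

/-- Append the point `(xr, xi)` to the candidate set of the query that is being written. -/
def appendPoint (xr xi : RExp) : Prog :=
  -- In array 2, `reg 2` is the length of the fixed part of the query. The next cell is reserved for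
  -- the number of candidates, and `reg 22` counts those written so far.
  .seq (.setCell 2 (.add (.add (.reg 2) (.const 1)) (.mul (.const 2) (.reg 22))) xr)
    (.seq (.setCell 2 (.add (.add (.reg 2) (.const 2)) (.mul (.const 2) (.reg 22))) xi)
      (.setReg 22 (.add (.reg 22) (.const 1))))

/-- Copy the answer of the oracle to the output. -/
def copyAnswer : Prog :=
  .seq (.count 24 (.reg 23) (.setCell 1 (.reg 24) (.cell 3 (.reg 24)))) (.setReg 1 (.reg 23))

/-- Collect the points `(xr, xi)` with property `c`. -/
def collect (c : Test) (xr xi : RExp) : Prog :=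
  .seq (.setReg 22 (.const 0))
    -- Registers 20 and 21 hold the indices of the current grid point; registers 3 and 4 hold the
    -- numbers of indices in the two directions.
    (.count 20 (.reg 3) (.count 21 (.reg 4) (.ite c (appendPoint xr xi) .skip)))

/-- Query the oracle for the set of points with property `c`; keep a positive answer. -/
def query (c : Test) (xr xi : RExp) : Prog :=
  .seq (collect c xr xi)
    (.seq (.setCell 2 (.reg 2) (.ofNat (.reg 22)))
      (.seq (.call (.add (.add (.reg 2) (.const 1)) (.mul (.const 2) (.reg 22))) 23)
        (.ite (.realEq (.cell 3 (.const 0)) (.const 1)) copyAnswer .skip)))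

/-- Let the register pairs `25, 26`, `27, 28`, … run over all pairs of indices. -/
def nest (p : Prog) : ℕ → Prog
  | 0 => p
  | k + 1 => .count (25 + 2 * k) (.reg 3) (.count (26 + 2 * k) (.reg 4) (nest p k))

/-- Query the oracle for the empty set, and for all feasible tuples of length `K`. -/
def search (K : ℕ) (feas memb : Test) (xr xi : RExp) : Prog :=
  -- With cell 0 of array 1 still zero, this presets the negative output `[0]`.
  .seq (.setReg 1 (.const 1))
    -- The test never holds, so the candidate set of this query is empty.
    (.seq (query (.natLt (.const 0) (.const 0)) xr xi)
      (nest (.ite feas (query memb xr xi) .skip) K))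

/-- The input data of the search, in a state that is reached from `σ₀` by the search. -/
structure Base (σ₀ : State) (pre : List ℝ) (NA NB : ℕ) (σ : State) : Prop where
  -- The search works in register 1, the registers from 20 on and the arrays 1, 2, 3. All else, such
  -- as the input and data prepared by the parser, is frozen.
  reg : ∀ r, r ≠ 1 → r < 20 → σ.reg r = σ₀.reg r
  mem : ∀ a, a ≠ 1 → a ≠ 2 → a ≠ 3 → σ.mem a = σ₀.mem a
  stored : Stored (σ.mem 2) 0 pre
  reg_two : σ.reg 2 = pre.length
  reg_three : σ.reg 3 = NA
  reg_four : σ.reg 4 = NB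

variable {σ₀ : State} {pre : List ℝ} {NA NB : ℕ} {σ σr : State}

theorem Base.setReg (h : Base σ₀ pre NA NB σ) {r : ℕ} (v : ℕ) (hr : r = 1 ∨ 20 ≤ r) :
    Base σ₀ pre NA NB (σ.setReg r v) where
  reg r' h1 h2 := by rw [State.setReg_reg_of_ne _ _ (by omega), h.reg r' h1 h2]
  mem := h.mem
  stored := h.stored
  reg_two := by rw [State.setReg_reg_of_ne _ _ (by omega), h.reg_two]
  reg_three := by rw [State.setReg_reg_of_ne _ _ (by omega), h.reg_three]
  reg_four := by rw [State.setReg_reg_of_ne _ _ (by omega), h.reg_four]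

theorem Base.setCell (h : Base σ₀ pre NA NB σ) {a i : ℕ} (x : ℝ)
    (ha : a = 1 ∨ a = 3 ∨ a = 2 ∧ pre.length ≤ i) : Base σ₀ pre NA NB (σ.setCell a i x) where
  reg := h.reg
  mem a' h1 h2 h3 := by
    rw [State.setCell_mem, if_neg (by omega), h.mem a' h1 h2 h3]
  stored := by
    rw [State.setCell_mem]
    split_ifs with h2
    · subst h2
      exact h.stored.update _ (by omega)
    · exact h.stored
  reg_two := h.reg_two
  reg_three := h.reg_three
  reg_four := h.reg_four

theorem Base.write (h : Base σ₀ pre NA NB σ) (w : List ℝ) :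
    Base σ₀ pre NA NB (σ.write 3 w) where
  reg := h.reg
  mem a' h1 h2 h3 := by
    rw [State.write_mem, if_neg h3, h.mem a' h1 h2 h3]
  stored := by
    rw [State.write_mem, if_neg (by omega)]
    exact h.stored
  reg_two := h.reg_two
  reg_three := h.reg_three
  reg_four := h.reg_four

theorem length_encPoints (L : List ℂ) : (encPoints L).length = 2 * L.length := by
  induction L with
  | nil => rfl
  | cons z t ih => simp only [encPoints, List.flatMap_cons, List.length_append] at ih ⊢
                   simp [ih]; omega

theorem encPoints_append (L L' : List ℂ) : encPoints (L ++ L') = encPoints L ++ encPoints L' := by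
  simp [encPoints]

/-- The query whose data part is `pre`, for the candidate set `L`. -/
def queryWord (pre : List ℝ) (L : List ℂ) : List ℝ := pre ++ (L.length : ℝ) :: encPoints L

/-- The candidate set `L` has been written to memory, starting from the state `σr`. -/
structure Building (σ₀ : State) (pre : List ℝ) (NA NB : ℕ) (σr : State) (L : List ℂ)
    (σ : State) : Prop where
  base : Base σ₀ pre NA NB σ
  count : σ.reg 22 = L.length
  points : Stored (σ.mem 2) (pre.length + 1) (encPoints L)
  reg : ∀ r, r = 1 ∨ 25 ≤ r → σ.reg r = σr.reg r
  mem : σ.mem 1 = σr.mem 1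

theorem Building.setReg {L : List ℂ} (h : Building σ₀ pre NA NB σr L σ) {r : ℕ} (v : ℕ)
    (hr : 20 ≤ r) (hr' : r < 22) : Building σ₀ pre NA NB σr L (σ.setReg r v) where
  base := h.base.setReg v (.inr hr)
  count := by rw [State.setReg_reg_of_ne _ _ (by omega), h.count]
  points := h.points
  reg r' h' := by rw [State.setReg_reg_of_ne _ _ (by omega), h.reg r' h']
  mem := h.mem

variable {O : List ℝ → List ℝ} {G : List ℝ → Prop} {B : ℕ} {xr xi : RExp} {pt : ℕ → ℕ → ℂ}
  {c : Test}

/-- The hypotheses on `xr` and `xi` range over all states with `Base`, because `xi` is evaluated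
after the first coordinate has already been stored. -/
theorem ok_appendPoint {L : List ℂ} (h : Building σ₀ pre NA NB σr L σ)
    (hxr : ∀ σ, Base σ₀ pre NA NB σ → σ.reg 20 < NA → σ.reg 21 < NB →
      xr.eval σ = (pt (σ.reg 20) (σ.reg 21)).re)
    (hxi : ∀ σ, Base σ₀ pre NA NB σ → σ.reg 20 < NA → σ.reg 21 < NB →
      xi.eval σ = (pt (σ.reg 20) (σ.reg 21)).im)
    (hi : σ.reg 20 < NA) (hj : σ.reg 21 < NB) :
    Ok O G B (appendPoint xr xi) σ fun σ' =>
      Building σ₀ pre NA NB σr (L ++ [pt (σ.reg 20) (σ.reg 21)]) σ' ∧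
      σ'.reg 20 = σ.reg 20 ∧ σ'.reg 21 = σ.reg 21 := by
  have hl := length_encPoints L
  have e1 : (NExp.add (.add (.reg 2) (.const 1)) (.mul (.const 2) (.reg 22))).eval σ =
      pre.length + 1 + (encPoints L).length := by
    simp only [NExp.eval, h.base.reg_two, h.count, hl]
  refine .seq (.setCell ?_)
  rw [e1, hxr σ h.base hi hj]
  set z := pt (σ.reg 20) (σ.reg 21)
  set σ1 := σ.setCell 2 (pre.length + 1 + (encPoints L).length) z.re
  have hb1 : Base σ₀ pre NA NB σ1 := h.base.setCell _ (.inr (.inr ⟨rfl, by omega⟩))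
  have e2 : (NExp.add (.add (.reg 2) (.const 2)) (.mul (.const 2) (.reg 22))).eval σ1 =
      pre.length + 1 + (encPoints L ++ [z.re]).length := by
    simp only [NExp.eval, hb1.reg_two, List.length_append, List.length_singleton, hl,
      show σ1.reg 22 = L.length from h.count]
    omega
  refine .seq (.setCell (.setReg ?_))
  rw [e2, show xi.eval σ1 = z.im from hxi σ1 hb1 hi hj]
  refine ⟨⟨(hb1.setCell _ (.inr (.inr ⟨rfl, by omega⟩))).setReg _ (.inr (by omega)), ?_, ?_, ?_, ?_⟩,
    ?_, ?_⟩
  · simp [NExp.eval, σ1, h.count]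
  · simp only [State.setReg_mem, State.setCell_mem, if_true, encPoints_append]
    have h1 : Stored (σ1.mem 2) (pre.length + 1) (encPoints L ++ [z.re]) := by
      simp only [σ1, State.setCell_mem, if_true]
      exact h.points.snoc rfl
    have h2 := h1.snoc (x := z.im) rfl
    simpa [encPoints] using h2
  · intro r hr
    rw [State.setReg_reg_of_ne _ _ (by omega)]
    exact h.reg r hr
  · simp [σ1, h.mem]
  · simp [σ1]
  · simp [σ1]

open Classical in
/-- The points with index pairs `(i, 0), …, (i, j - 1)` in the selection `M`. -/
def rowPoints (pt : ℕ → ℕ → ℂ) (M : ℕ → ℕ → Prop) (i j : ℕ) : List ℂ :=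
  ((List.range j).filter fun j' => M i j').map (pt i)

/-- The points with index pairs in the selection `M`. -/
def pointList (pt : ℕ → ℕ → ℂ) (M : ℕ → ℕ → Prop) (NA NB : ℕ) : List ℂ :=
  (List.range NA).flatMap fun i => rowPoints pt M i NB

theorem rowPoints_succ (pt : ℕ → ℕ → ℂ) (M : ℕ → ℕ → Prop) (i j : ℕ) [Decidable (M i j)] :
    rowPoints pt M i (j + 1) = rowPoints pt M i j ++ if M i j then [pt i j] else [] := by
  simp only [rowPoints, List.range_succ, List.filter_append, List.map_append]
  split_ifs with h <;> simp [h]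

theorem pointList_succ (pt : ℕ → ℕ → ℂ) (M : ℕ → ℕ → Prop) (i NB : ℕ) :
    pointList pt M (i + 1) NB = pointList pt M i NB ++ rowPoints pt M i NB := by
  simp [pointList, List.range_succ]

theorem mem_pointList {pt : ℕ → ℕ → ℂ} {M : ℕ → ℕ → Prop} {z : ℂ} :
    z ∈ pointList pt M NA NB ↔ ∃ i < NA, ∃ j < NB, M i j ∧ pt i j = z := by
  simp [pointList, rowPoints, and_assoc]

theorem pointList_empty (pt : ℕ → ℕ → ℂ) : pointList pt (fun _ _ => False) NA NB = [] := by
  simp [pointList, rowPoints]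

/-- The selection may depend on the registers from 25 on, which hold the current tuple and do not
change while points are collected. -/
theorem ok_collect {M : ℕ → ℕ → Prop} (h : Base σ₀ pre NA NB σ) (hNA : NA ≤ B) (hNB : NB ≤ B)
    (hxr : ∀ σ, Base σ₀ pre NA NB σ → σ.reg 20 < NA → σ.reg 21 < NB →
      xr.eval σ = (pt (σ.reg 20) (σ.reg 21)).re)
    (hxi : ∀ σ, Base σ₀ pre NA NB σ → σ.reg 20 < NA → σ.reg 21 < NB →
      xi.eval σ = (pt (σ.reg 20) (σ.reg 21)).im)
    (hc : ∀ σ', Base σ₀ pre NA NB σ' → (∀ r, 25 ≤ r → σ'.reg r = σ.reg r) → σ'.reg 20 < NA →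
      σ'.reg 21 < NB → (c.holds σ' ↔ M (σ'.reg 20) (σ'.reg 21))) :
    Ok O G B (collect c xr xi) σ (Building σ₀ pre NA NB σ (pointList pt M NA NB)) := by
  classical
  refine .seq (.setReg (.count (N := NA) (fun i σ' =>
    Building σ₀ pre NA NB σ (pointList pt M i NB) σ' ∧ σ'.reg 20 = i) hNA ?_ (fun i σ h => h.2)
    (fun i σ h => h.1.base.reg_three) ?_ (fun σ h => h.1)))
  · refine ⟨⟨(h.setReg _ (by simp)).setReg _ (by simp), ?_, ?_, ?_, ?_⟩, by simp⟩
    · simp [NExp.eval, pointList]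
    · simp [pointList, encPoints, Stored.nil]
    · intro r hr
      rw [State.setReg_reg_of_ne _ _ (by omega), State.setReg_reg_of_ne _ _ (by omega)]
    · simp
  · rintro i σ1 hi ⟨h1, h1i⟩
    refine .count (N := NB) (fun j σ' =>
      Building σ₀ pre NA NB σ (pointList pt M i NB ++ rowPoints pt M i j) σ' ∧ σ'.reg 20 = i ∧
        σ'.reg 21 = j) hNB ?_ (fun i σ h => h.2.2) (fun i σ h => h.1.base.reg_four) ?_ ?_
    · refine ⟨?_, by simp [h1i], by simp⟩
      simpa [rowPoints] using h1.setReg 0 (by omega) (by omega)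
    · rintro j σ2 hj ⟨h2, h2i, h2j⟩
      have hc' := hc σ2 h2.base (fun r hr => h2.reg r (.inr hr)) (h2i ▸ hi) (h2j ▸ hj)
      rw [h2i, h2j] at hc'
      refine .ite (fun hM => ?_) (fun hM => ?_)
      · refine (ok_appendPoint h2 hxr hxi (h2i ▸ hi) (h2j ▸ hj)).mono fun σ3 h3 => ?_
        obtain ⟨h3, h3i, h3j⟩ := h3
        rw [h2i, h2j] at h3
        rw [h2i] at h3i
        rw [h2j] at h3j
        refine ⟨h3j, ?_, by simp [h3i], by simp⟩
        rw [rowPoints_succ, if_pos (hc'.1 hM), ← List.append_assoc]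
        exact h3.setReg _ (by omega) (by omega)
      · refine .skip ⟨h2j, ?_, by simp [h2i], by simp⟩
        rw [rowPoints_succ, if_neg (fun h => hM (hc'.2 h)), List.append_nil]
        exact h2.setReg _ (by omega) (by omega)
    · rintro σ2 ⟨h2, h2i, h2j⟩
      refine ⟨h2i, ?_, by simp⟩
      rw [pointList_succ]
      exact h2.setReg _ (by omega) (by omega)

/-- The output is a positive answer of the oracle to a query with property `G`. -/
def Found (O : List ℝ → List ℝ) (G : List ℝ → Prop) (σ : State) : Prop :=
  ∃ q, G q ∧ (O q).head? = some 1 ∧ Stored (σ.mem 1) 0 (O q) ∧ σ.reg 1 = (O q).length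

theorem Found.congr (h : Found O G σ) {σ' : State} (h1 : σ'.mem 1 = σ.mem 1)
    (h2 : σ'.reg 1 = σ.reg 1) : Found O G σ' := by
  obtain ⟨q, h⟩ := h
  exact ⟨q, by rwa [h1, h2]⟩

/-- The output is negative. -/
def NotFound (σ : State) : Prop := σ.mem 1 0 = 0 ∧ σ.reg 1 = 1

/-- The invariant of the search. -/
def Searching (O : List ℝ → List ℝ) (G : List ℝ → Prop) (σ₀ : State) (pre : List ℝ) (NA NB : ℕ)
    (σ : State) : Prop :=
  Base σ₀ pre NA NB σ ∧ (NotFound σ ∨ Found O G σ)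

theorem Searching.setReg (h : Searching O G σ₀ pre NA NB σ) {r : ℕ} (v : ℕ) (hr : 20 ≤ r) :
    Searching O G σ₀ pre NA NB (σ.setReg r v) := by
  refine ⟨h.1.setReg v (.inr hr), h.2.imp (fun h => ?_) fun h => h.congr rfl ?_⟩
  · exact ⟨h.1, by rw [State.setReg_reg_of_ne _ _ (by omega)]; exact h.2⟩
  · rw [State.setReg_reg_of_ne _ _ (by omega)]

theorem Found.setReg (h : Found O G σ) {r : ℕ} (v : ℕ) (hr : 20 ≤ r) :
    Found O G (σ.setReg r v) :=
  h.congr rfl (by rw [State.setReg_reg_of_ne _ _ (by omega)])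

theorem ok_copyAnswer {q : List ℝ} (h : Base σ₀ pre NA NB σ) (hq : G q)
    (hq1 : (O q).head? = some 1) (hB : (O q).length ≤ B) (h3 : Stored (σ.mem 3) 0 (O q))
    (h23 : σ.reg 23 = (O q).length) :
    Ok O G B copyAnswer σ fun σ' => Searching O G σ₀ pre NA NB σ' ∧ Found O G σ' ∧
      ∀ r, 25 ≤ r → σ'.reg r = σ.reg r := by
  refine .seq (.count (N := (O q).length) (fun i σ' => Base σ₀ pre NA NB σ' ∧ σ'.reg 24 = i ∧
    σ'.reg 23 = (O q).length ∧ σ'.mem 3 = σ.mem 3 ∧ (∀ k < i, σ'.mem 1 k = (O q).getD k 0) ∧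
      ∀ r, 25 ≤ r → σ'.reg r = σ.reg r) hB ?_ (fun i σ h => h.2.1) (fun i σ h => h.2.2.1) ?_ ?_)
  · refine ⟨h.setReg _ (by simp), by simp, by simpa, by simp, by simp, fun r hr => ?_⟩
    rw [State.setReg_reg_of_ne _ _ (by omega)]
  · rintro i σ' hi ⟨h1, h2, h3', h4, h5, h6⟩
    refine .setCell ?_
    simp only [NExp.eval, RExp.eval]
    refine ⟨h2, (h1.setCell _ (.inl rfl)).setReg _ (by simp), by simp, by simpa, by simpa, ?_, ?_⟩
    · intro k hk
      rw [h2, h4]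
      simp only [State.setReg_mem, State.setCell_mem, if_true, Function.update_apply]
      split_ifs with hki
      · rw [hki]
        simpa using h3 i hi
      · exact h5 k (by omega)
    · intro r hr
      rw [State.setReg_reg_of_ne _ _ (by omega)]
      exact h6 r hr
  · rintro σ' ⟨h1, h2, h3', h4, h5, h6⟩
    have hF : Found O G (σ'.setReg 1 (σ'.reg 23)) :=
      ⟨q, hq, hq1, fun k hk => by simpa using h5 k hk, by simpa⟩
    refine .setReg ⟨⟨h1.setReg _ (.inl rfl), .inr hF⟩, hF, fun r hr => ?_⟩
    rw [State.setReg_reg_of_ne _ _ (by omega)]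
    exact h6 r hr

/-- A positive answer overwrites an earlier one and a negative answer leaves the output alone, so
`Found` is never lost. -/
theorem ok_query {M : ℕ → ℕ → Prop} (h : Searching O G σ₀ pre NA NB σ) (hNA : NA ≤ B)
    (hNB : NB ≤ B)
    (hxr : ∀ σ, Base σ₀ pre NA NB σ → σ.reg 20 < NA → σ.reg 21 < NB →
      xr.eval σ = (pt (σ.reg 20) (σ.reg 21)).re)
    (hxi : ∀ σ, Base σ₀ pre NA NB σ → σ.reg 20 < NA → σ.reg 21 < NB →
      xi.eval σ = (pt (σ.reg 20) (σ.reg 21)).im)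
    (hc : ∀ σ', Base σ₀ pre NA NB σ' → (∀ r, 25 ≤ r → σ'.reg r = σ.reg r) → σ'.reg 20 < NA →
      σ'.reg 21 < NB → (c.holds σ' ↔ M (σ'.reg 20) (σ'.reg 21)))
    (hG : G (queryWord pre (pointList pt M NA NB)))
    (hO : O (queryWord pre (pointList pt M NA NB)) ≠ [])
    (hB : (queryWord pre (pointList pt M NA NB)).length +
      (O (queryWord pre (pointList pt M NA NB))).length ≤ B) :
    Ok O G B (query c xr xi) σ fun σ' => Searching O G σ₀ pre NA NB σ' ∧
      (Found O G σ → Found O G σ') ∧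
      ((O (queryWord pre (pointList pt M NA NB))).head? = some 1 → Found O G σ') ∧
      ∀ r, 25 ≤ r → σ'.reg r = σ.reg r := by
  set L := pointList pt M NA NB
  refine .seq ((ok_collect h.1 hNA hNB hxr hxi hc).mono fun σ1 h1 => ?_)
  refine .seq (.setCell (.seq ?_))
  simp only [NExp.eval, RExp.eval, h1.base.reg_two, h1.count]
  set σ2 := σ1.setCell 2 pre.length (L.length : ℝ)
  have hb2 : Base σ₀ pre NA NB σ2 := h1.base.setCell _ (.inr (.inr ⟨rfl, le_rfl⟩))
  have hlen : (queryWord pre L).length = pre.length + 1 + 2 * L.length := by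
    simp [queryWord, length_encPoints]; omega
  have hread : σ2.read 2 ((NExp.add (.add (.reg 2) (.const 1)) (.mul (.const 2) (.reg 22))).eval σ2)
      = queryWord pre L := by
    apply State.read_eq
    · simp only [NExp.eval, hb2.reg_two, show σ2.reg 22 = L.length from h1.count, hlen]
    · rw [queryWord, stored_append, zero_add, stored_cons]
      refine ⟨hb2.stored, by simp [σ2], ?_⟩
      simp only [σ2, State.setCell_mem, if_true]
      exact h1.points.update _ (by omega)
  refine .call hread hG hB ?_
  set w := O (queryWord pre L)
  set σ3 := (σ2.write 3 w).setReg 23 w.length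
  have hb3 : Base σ₀ pre NA NB σ3 := (hb2.write w).setReg _ (.inr (by omega))
  have h3 : Stored (σ3.mem 3) 0 w := stored_write σ2 3 w
  have hr3 : ∀ r, r = 1 ∨ 25 ≤ r → σ3.reg r = σ.reg r := by
    intro r hr
    rw [State.setReg_reg_of_ne _ _ (by omega)]
    exact h1.reg r hr
  have hm3 : σ3.mem 1 = σ.mem 1 := by simp [σ3, σ2, h1.mem]
  -- Here a nonempty answer is essential: otherwise cell 0 of array 3 would keep its older content.
  have hhead : σ3.mem 3 0 = 1 ↔ w.head? = some 1 := by
    have h30 := h3 0 (List.length_pos_of_ne_nil hO)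
    rw [zero_add] at h30
    rw [h30]
    rcases hw : w with _ | ⟨a, t⟩
    · exact absurd hw hO
    · simp
  refine .ite (fun hc => ?_) (fun hc => ?_)
  · refine (ok_copyAnswer hb3 hG (hhead.1 ?_) ?_ h3 (by simp [σ3, w])).mono fun σ4 h4 =>
      ⟨h4.1, fun _ => h4.2.1, fun _ => h4.2.1, fun r hr => ?_⟩
    · exact hc
    · exact (Nat.le_add_left _ _).trans hB
    · rw [h4.2.2 r hr, hr3 r (.inr hr)]
  · refine .skip ⟨⟨hb3, h.2.imp (fun h => ?_) fun h => ?_⟩, fun h => ?_, fun h => ?_, fun r hr => ?_⟩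
    · exact ⟨by rw [hm3, h.1], by rw [hr3 1 (.inl rfl), h.2]⟩
    · exact h.congr hm3 (hr3 1 (.inl rfl))
    · exact h.congr hm3 (hr3 1 (.inl rfl))
    · exact absurd (hhead.2 h) hc
    · exact hr3 r (.inr hr)

/-- The index tuple `v` stands in the registers `25, 26, …`, as far as its entries from `k` on are
concerned. -/
def TupleAt {K : ℕ} (v : Fin K → ℕ × ℕ) (k : ℕ) (σ : State) : Prop :=
  ∀ q : Fin K, k ≤ q → σ.reg (25 + 2 * q) = (v q).1 ∧ σ.reg (26 + 2 * q) = (v q).2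

/-- The entries of the tuple from `k` on are fixed by the outer loops, and those below `k` run over
all values. As `Found` persists, it suffices that the body is executed once for every tuple `v`. -/
theorem ok_nest {K : ℕ} {p : Prog} {cond : (Fin K → ℕ × ℕ) → Prop} (hNA : NA ≤ B) (hNB : NB ≤ B)
    (hp : ∀ (v : Fin K → ℕ × ℕ) (σ), (∀ q, (v q).1 < NA ∧ (v q).2 < NB) → TupleAt v 0 σ →
      Searching O G σ₀ pre NA NB σ →
      Ok O G B p σ fun σ' => Searching O G σ₀ pre NA NB σ' ∧ (Found O G σ → Found O G σ') ∧
        (cond v → Found O G σ') ∧ ∀ r, 25 ≤ r → σ'.reg r = σ.reg r) :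
    ∀ k ≤ K, ∀ (u : Fin K → ℕ × ℕ) (σ), (∀ q : Fin K, k ≤ q → (u q).1 < NA ∧ (u q).2 < NB) →
      TupleAt u k σ → Searching O G σ₀ pre NA NB σ →
      Ok O G B (nest p k) σ fun σ' => Searching O G σ₀ pre NA NB σ' ∧
        (Found O G σ → Found O G σ') ∧
        (∀ v : Fin K → ℕ × ℕ, (∀ q : Fin K, k ≤ q → v q = u q) →
          (∀ q, (v q).1 < NA ∧ (v q).2 < NB) → cond v → Found O G σ') ∧
        ∀ r, 25 + 2 * k ≤ r → σ'.reg r = σ.reg r := by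
  intro k
  induction k with
  | zero =>
    intro _ u σ hu hut h
    refine (hp u σ (fun q => hu q (Nat.zero_le _)) hut h).mono fun σ' h' =>
      ⟨h'.1, h'.2.1, fun v hv _ hc => ?_, fun r hr => h'.2.2.2 r (by omega)⟩
    obtain rfl : v = u := funext fun q => hv q (Nat.zero_le _)
    exact h'.2.2.1 hc
  | succ k ih =>
    intro hk u σ hu hut h
    have hkK : k < K := hk
    set kk : Fin K := ⟨k, hkK⟩
    refine .count (N := NA) (fun i σ' => Searching O G σ₀ pre NA NB σ' ∧
      (Found O G σ → Found O G σ') ∧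
        (∀ v : Fin K → ℕ × ℕ, (∀ q : Fin K, k + 1 ≤ q → v q = u q) →
          (∀ q, (v q).1 < NA ∧ (v q).2 < NB) → (v kk).1 < i → cond v → Found O G σ') ∧
        (∀ r, 25 + 2 * (k + 1) ≤ r → σ'.reg r = σ.reg r) ∧ σ'.reg (25 + 2 * k) = i) hNA ?_
        (fun i σ h => h.2.2.2.2) (fun i σ h => h.1.1.reg_three) ?_ ?_
    · refine ⟨h.setReg _ (by omega), fun h => h.setReg _ (by omega), by simp, ?_, by simp⟩
      intro r hr
      rw [State.setReg_reg_of_ne _ _ (by omega)]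
    · rintro i σ1 hi ⟨h1, h1f, h1c, h1r, h1i⟩
      refine .count (N := NB) (fun j σ' => Searching O G σ₀ pre NA NB σ' ∧
        (Found O G σ1 → Found O G σ') ∧
          (∀ v : Fin K → ℕ × ℕ, (∀ q : Fin K, k + 1 ≤ q → v q = u q) →
            (∀ q, (v q).1 < NA ∧ (v q).2 < NB) → (v kk).1 = i → (v kk).2 < j → cond v →
              Found O G σ') ∧
          (∀ r, 25 + 2 * (k + 1) ≤ r → σ'.reg r = σ.reg r) ∧ σ'.reg (25 + 2 * k) = i ∧
            σ'.reg (26 + 2 * k) = j) hNB ?_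
          (fun i σ h => h.2.2.2.2.2) (fun i σ h => h.1.1.reg_four) ?_ ?_
      · refine ⟨h1.setReg _ (by omega), fun h => h.setReg _ (by omega), by simp, ?_, ?_, by simp⟩
        · intro r hr
          rw [State.setReg_reg_of_ne _ _ (by omega), h1r r hr]
        · rw [State.setReg_reg_of_ne _ _ (by omega), h1i]
      · rintro j σ2 hj ⟨h2, h2f, h2c, h2r, h2i, h2j⟩
        -- The tuple `u'` records that the two loops for entry `k` have reached `(i, j)`; for the
        -- inner loops this entry is fixed.
        set u' : Fin K → ℕ × ℕ := Function.update u kk (i, j)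
        have hu'k : u' kk = (i, j) := by simp [u']
        have hu'q : ∀ q : Fin K, k + 1 ≤ q → u' q = u q := fun q hq =>
          Function.update_of_ne (Fin.ne_of_val_ne (by simp [kk]; omega)) _ _
        have hsplit : ∀ q : Fin K, k ≤ q → q = kk ∨ k + 1 ≤ (q : ℕ) := fun q hq => by
          by_cases hqk : (q : ℕ) = k
          · exact .inl (Fin.ext hqk)
          · exact .inr (by omega)
        have hu' : ∀ q : Fin K, k ≤ q → (u' q).1 < NA ∧ (u' q).2 < NB := fun q hq => by
          rcases hsplit q hq with rfl | hq
          · rw [hu'k]; exact ⟨hi, hj⟩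
          · rw [hu'q q hq]; exact hu q hq
        have hut' : TupleAt u' k σ2 := fun q hq => by
          rcases hsplit q hq with rfl | hq
          · rw [hu'k]; exact ⟨h2i, h2j⟩
          · rw [hu'q q hq, h2r _ (by omega), h2r _ (by omega)]; exact hut q hq
        refine (ih hkK.le u' σ2 hu' hut' h2).mono fun σ3 h3 => ?_
        obtain ⟨h3, h3f, h3c, h3r⟩ := h3
        refine ⟨by rw [h3r _ (by omega), h2j], h3.setReg _ (by omega),
          fun h => (h3f (h2f h)).setReg _ (by omega), ?_, ?_, ?_, by simp⟩
        · intro v hv hvb hvi hvj hcv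
          refine Found.setReg ?_ _ (by omega)
          -- Either `v` was treated in an earlier round, or it belongs to the current one.
          rcases Nat.lt_succ_iff_lt_or_eq.1 hvj with hvj | hvj
          · exact h3f (h2c v hv hvb hvi hvj hcv)
          · refine h3c v (fun q hq => ?_) hvb hcv
            rcases hsplit q hq with rfl | hq
            · rw [hu'k, ← hvi, ← hvj]
            · rw [hu'q q hq, hv q hq]
        · intro r hr
          rw [State.setReg_reg_of_ne _ _ (by omega), h3r r (by omega), h2r r hr]
        · rw [State.setReg_reg_of_ne _ _ (by omega), h3r _ (by omega), h2i]
      · rintro σ2 ⟨h2, h2f, h2c, h2r, h2i, h2j⟩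
        refine ⟨h2i, h2.setReg _ (by omega), fun h => (h2f (h1f h)).setReg _ (by omega), ?_, ?_,
          by simp⟩
        · intro v hv hvb hvi hcv
          refine Found.setReg ?_ _ (by omega)
          rcases Nat.lt_succ_iff_lt_or_eq.1 hvi with hvi | hvi
          · exact h2f (h1c v hv hvb hvi hcv)
          · exact h2c v hv hvb hvi (hvb kk).2 hcv
        · intro r hr
          rw [State.setReg_reg_of_ne _ _ (by omega), h2r r hr]
    · rintro σ1 ⟨h1, h1f, h1c, h1r, h1i⟩
      exact ⟨h1, h1f, fun v hv hvb hcv => h1c v hv hvb (hvb kk).1 hcv, h1r⟩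

/-- The search program outputs a positive answer to one of its queries, if there is one. -/
theorem ok_search {K : ℕ} {feas memb : Test} {Feas : (Fin K → ℕ × ℕ) → Prop}
    {M : (Fin K → ℕ × ℕ) → ℕ → ℕ → Prop}
    (h₀ : Base σ₀ pre NA NB σ₀) (h₁ : σ₀.mem 1 0 = 0) (hNA : NA ≤ B) (hNB : NB ≤ B)
    (hxr : ∀ σ, Base σ₀ pre NA NB σ → σ.reg 20 < NA → σ.reg 21 < NB →
      xr.eval σ = (pt (σ.reg 20) (σ.reg 21)).re)
    (hxi : ∀ σ, Base σ₀ pre NA NB σ → σ.reg 20 < NA → σ.reg 21 < NB →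
      xi.eval σ = (pt (σ.reg 20) (σ.reg 21)).im)
    (hmemb : ∀ v σ, Base σ₀ pre NA NB σ → (∀ q, (v q).1 < NA ∧ (v q).2 < NB) → TupleAt v 0 σ →
      σ.reg 20 < NA → σ.reg 21 < NB → (memb.holds σ ↔ M v (σ.reg 20) (σ.reg 21)))
    (hfeas : ∀ v σ, Base σ₀ pre NA NB σ → (∀ q, (v q).1 < NA ∧ (v q).2 < NB) → TupleAt v 0 σ →
      (feas.holds σ ↔ Feas v))
    {Ls : Set (List ℂ)} (hnil : [] ∈ Ls) (hLs : ∀ v, Feas v → pointList pt (M v) NA NB ∈ Ls)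
    (hO : ∀ L ∈ Ls, O (queryWord pre L) ≠ [] ∧
      (queryWord pre L).length + (O (queryWord pre L)).length ≤ B) :
    Ok O (fun q => ∃ L ∈ Ls, q = queryWord pre L) B (search K feas memb xr xi) σ₀ fun σ =>
      (∃ L ∈ Ls, (O (queryWord pre L)).head? = some 1 ∧ σ.output = O (queryWord pre L)) ∨
      (σ.output = [0] ∧ (O (queryWord pre [])).head? ≠ some 1 ∧
        ∀ v, (∀ q, (v q).1 < NA ∧ (v q).2 < NB) → Feas v →
          (O (queryWord pre (pointList pt (M v) NA NB))).head? ≠ some 1) := by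
  set G : List ℝ → Prop := fun q => ∃ L ∈ Ls, q = queryWord pre L
  refine .seq (.setReg (.seq ?_))
  have h1 : Searching O G σ₀ pre NA NB (σ₀.setReg 1 ((NExp.const 1).eval σ₀)) :=
    ⟨h₀.setReg _ (.inl rfl), .inl ⟨h₁, by simp [NExp.eval]⟩⟩
  have hO0 := hO [] hnil
  refine (ok_query (pt := pt) (M := fun _ _ => False) h1 hNA hNB hxr hxi
    (fun σ' _ _ _ _ => by simp [Test.holds]) ?_ ?_ ?_).mono fun σ2 h2 => ?_
  · rw [pointList_empty]; exact ⟨[], hnil, rfl⟩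
  · rw [pointList_empty]; exact hO0.1
  · rw [pointList_empty]; exact hO0.2
  rw [pointList_empty] at h2
  obtain ⟨h2, -, h2c, -⟩ := h2
  have hbody : ∀ (v : Fin K → ℕ × ℕ) (σ), (∀ q, (v q).1 < NA ∧ (v q).2 < NB) → TupleAt v 0 σ →
      Searching O G σ₀ pre NA NB σ →
      Ok O G B (.ite feas (query memb xr xi) .skip) σ fun σ' => Searching O G σ₀ pre NA NB σ' ∧
        (Found O G σ → Found O G σ') ∧
        ((Feas v ∧ (O (queryWord pre (pointList pt (M v) NA NB))).head? = some 1) →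
          Found O G σ') ∧ ∀ r, 25 ≤ r → σ'.reg r = σ.reg r := by
    intro v σ hv hvt h
    have hf := hfeas v σ h.1 hv hvt
    refine .ite (fun hc => ?_) (fun hc => ?_)
    · have hL := hLs v (hf.1 hc)
      refine (ok_query h hNA hNB hxr hxi (M := M v) (fun σ' hσ' hr hi hj => ?_) ⟨_, hL, rfl⟩
        (hO _ hL).1 (hO _ hL).2).mono fun σ' h' => ⟨h'.1, h'.2.1, fun h => h'.2.2.1 h.2, h'.2.2.2⟩
      refine hmemb v σ' hσ' hv (fun q hq => ?_) hi hj
      rw [hr _ (by omega), hr _ (by omega)]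
      exact hvt q hq
    · exact .skip ⟨h, _root_.id, fun h => absurd (hf.2 h.1) hc, fun _ _ => rfl⟩
  have hK : ∀ q : Fin K, ¬ K ≤ q := fun q => by omega
  -- At level `K` no entry is fixed yet, so the starting tuple is arbitrary.
  refine (ok_nest hNA hNB hbody K le_rfl (fun _ => (0, 0)) σ2 (fun q hq => absurd hq (hK q))
    (fun q hq => absurd hq (hK q)) h2).mono fun σ3 h3 => ?_
  obtain ⟨⟨-, h3⟩, h3f, h3c, -⟩ := h3
  by_cases hF : Found O G σ3
  · obtain ⟨q, ⟨L, hL, rfl⟩, hq, hs, hr⟩ := hF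
    exact .inl ⟨L, hL, hq, State.read_eq hr hs⟩
  · have h4 := h3.resolve_right hF
    refine .inr ⟨State.read_eq h4.2 (stored_singleton.2 h4.1), fun h => hF (h3f (h2c h)),
      fun v hv hfv h => hF (h3c v (fun q hq => absurd hq (hK q)) hv ⟨hfv, h⟩)⟩

end ModelSet

namespace ModelSet

open RealRAM

/-! ### Linear inequalities -/

/-- Elimination of one direction from a system of strict linear inequalities. -/
theorem exists_elimination_singleton {E : Type*} [AddCommGroup E] [Module ℝ E] (d : E)
    (Ls : List (E →ₗ[ℝ] ℝ)) :
    ∃ Ls' : List (E →ₗ[ℝ] ℝ), ∀ x, (∃ t : ℝ, ∀ φ ∈ Ls, φ (x + t • d) < 0) ↔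
      ∀ ψ ∈ Ls', ψ x < 0 := by
  classical
  -- Forms vanishing at `d` do not involve `t`; those positive at `d` bound `t` from above and those
  -- negative at `d` from below. The combination `φ d • φ' - φ' d • φ` vanishes at `d` and says that
  -- the lower bound from `φ'` is less than the upper bound from `φ`.
  refine ⟨Ls.filter (fun φ => φ d = 0) ++ (Ls.filter fun φ => 0 < φ d).flatMap fun φ =>
    (Ls.filter fun φ' => φ' d < 0).map fun φ' => φ d • φ' - φ' d • φ, fun x => ?_⟩
  simp only [List.mem_append, List.mem_filter, List.mem_flatMap, List.mem_map, decide_eq_true_eq,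
    map_add, map_smul, smul_eq_mul]
  constructor
  · rintro ⟨t, ht⟩ ψ (⟨hψ, h0⟩ | ⟨φ, ⟨hφ, hpos⟩, φ', ⟨hφ', hneg⟩, rfl⟩)
    · simpa [h0] using ht ψ hψ
    · have h1 := ht φ hφ
      have h2 := ht φ' hφ'
      simp only [LinearMap.sub_apply, LinearMap.smul_apply, smul_eq_mul]
      nlinarith [mul_pos hpos (neg_pos.2 h2), mul_pos (neg_pos.2 hneg) (neg_pos.2 h1)]
  · intro h
    -- A real number strictly between two finite sets exists even if one or both are empty.
    have hbetween : ∃ t : ℝ,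
        (∀ a ∈ ((Ls.filter fun φ' => φ' d < 0).map fun φ' => -φ' x / φ' d).toFinset, a < t) ∧
        ∀ b ∈ ((Ls.filter fun φ => 0 < φ d).map fun φ => -φ x / φ d).toFinset, t < b := by
      refine Order.exists_between_finsets _ _ fun a ha b hb => ?_
      simp only [List.mem_toFinset, List.mem_map, List.mem_filter, decide_eq_true_eq] at ha hb
      obtain ⟨φ', ⟨hφ', hneg⟩, rfl⟩ := ha
      obtain ⟨φ, ⟨hφ, hpos⟩, rfl⟩ := hb
      have := h _ (.inr ⟨φ, ⟨hφ, hpos⟩, φ', ⟨hφ', hneg⟩, rfl⟩)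
      simp only [LinearMap.sub_apply, LinearMap.smul_apply, smul_eq_mul] at this
      rw [lt_div_iff₀ hpos, div_mul_eq_mul_div, div_lt_iff_of_neg hneg]
      linarith
    obtain ⟨t, h1, h2⟩ := hbetween
    simp only [List.mem_toFinset, List.mem_map, List.mem_filter, decide_eq_true_eq,
      forall_exists_index, and_imp] at h1 h2
    refine ⟨t, fun φ hφ => ?_⟩
    rcases lt_trichotomy (φ d) 0 with hd | hd | hd
    · have := h1 _ φ hφ hd rfl
      rw [div_lt_iff_of_neg hd] at this
      linarith
    · have := h φ (.inl ⟨hφ, hd⟩)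
      simpa [hd] using this
    · have := h2 _ φ hφ hd rfl
      rw [lt_div_iff₀ hd] at this
      linarith

/-- Fourier-Motzkin elimination of a finitely generated subspace. -/
theorem exists_elimination {E : Type*} [AddCommGroup E] [Module ℝ E] (P : Submodule ℝ E)
    (hP : P.FG) : ∀ Ls : List (E →ₗ[ℝ] ℝ),
    ∃ Ls' : List (E →ₗ[ℝ] ℝ), ∀ x, (∃ y ∈ P, ∀ φ ∈ Ls, φ (x + y) < 0) ↔ ∀ ψ ∈ Ls', ψ x < 0 := by
  induction P, hP using Submodule.fg_induction with
  | singleton d =>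
    intro Ls
    obtain ⟨Ls', h⟩ := exists_elimination_singleton d Ls
    refine ⟨Ls', fun x => ?_⟩
    rw [← h]
    simp [Submodule.mem_span_singleton]
  | sup P₁ P₂ _ _ h₁ h₂ =>
    intro Ls
    obtain ⟨Ls₁, h₁⟩ := h₁ Ls
    obtain ⟨Ls₂, h₂⟩ := h₂ Ls₁
    refine ⟨Ls₂, fun x => ?_⟩
    rw [← h₂]
    constructor
    · rintro ⟨y, hy, hφ⟩
      obtain ⟨y₁, hy₁, y₂, hy₂, rfl⟩ := Submodule.mem_sup.1 hy
      refine ⟨y₂, hy₂, (h₁ _).1 ⟨y₁, hy₁, ?_⟩⟩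
      simpa only [add_assoc, add_comm y₂ y₁] using hφ
    · rintro ⟨y₂, hy₂, hφ⟩
      obtain ⟨y₁, hy₁, h⟩ := (h₁ _).2 hφ
      refine ⟨y₁ + y₂, Submodule.add_mem_sup hy₁ hy₂, ?_⟩
      simpa only [add_assoc, add_comm y₂ y₁] using h

/-- The solvability of `A τ > u` is a finite system of strict linear inequalities in `u`. -/
theorem exists_feasibility_test {l : ℕ} {κ : Type*} [Fintype κ] (A : Matrix (Fin l) κ ℝ) :
    ∃ Λ : List (Fin l → ℝ), ∀ u : Fin l → ℝ,
      (∃ τ : κ → ℝ, ∀ r, u r < A.mulVec τ r) ↔ ∀ c ∈ Λ, ∑ r, c r * u r < 0 := by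
  -- With `y = -A τ`, the condition `u < A τ` says that all coordinates of `u + y` are negative, and
  -- `y` runs over the range of `A`.
  obtain ⟨Ls, h⟩ := exists_elimination (LinearMap.range A.mulVecLin)
    (IsNoetherian.noetherian _) (List.ofFn fun r : Fin l => LinearMap.proj r)
  refine ⟨Ls.map fun φ r => φ (Pi.single r 1), fun u => ?_⟩
  simp only [List.mem_map, forall_exists_index, and_imp, forall_apply_eq_imp_iff₂]
  have h1 : ∀ φ : (Fin l → ℝ) →ₗ[ℝ] ℝ, ∑ r, φ (Pi.single r 1) * u r = φ u := fun φ => by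
    rw [LinearMap.pi_apply_eq_sum_univ φ u]
    refine Finset.sum_congr rfl fun r _ => ?_
    rw [smul_eq_mul, mul_comm]
    congr 2
    ext j
    simp [Pi.single_apply, eq_comm]
  simp only [h1]
  rw [← h]
  constructor
  · rintro ⟨τ, hτ⟩
    refine ⟨_, ⟨-τ, rfl⟩, ?_⟩
    simp only [List.mem_ofFn, forall_exists_index, forall_apply_eq_imp_iff]
    intro r
    simpa [Matrix.mulVec_neg] using hτ r
  · rintro ⟨_, ⟨τ, rfl⟩, hτ⟩
    refine ⟨-τ, fun r => ?_⟩
    have := hτ (LinearMap.proj r) (by simp [List.mem_ofFn])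
    simp only [LinearMap.proj_apply, Pi.add_apply, Matrix.mulVecLin_apply] at this
    rw [Matrix.mulVec_neg, Pi.neg_apply]
    linarith

/-- A right-hand side that describes the interior of the polyhedron by strict inequalities. -/
def interiorBound {k l : ℕ} (A : Matrix (Fin l) (Fin k × Fin 2) ℝ) (b : Fin l → ℝ) (r : Fin l) :
    ℝ :=
  -- A zero row with `b r = 0` is harmless in `A x ≤ b` but unsolvable as a strict inequality; the
  -- bound 1 makes zero rows vacuous.
  open Classical in if A r = 0 then 1 else b r

theorem mem_interior_polyhedron {k l : ℕ} {A : Matrix (Fin l) (Fin k × Fin 2) ℝ} {b : Fin l → ℝ}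
    (hne : (interior (polyhedron A b)).Nonempty) {x : Internal k} :
    x ∈ interior (polyhedron A b) ↔ ∀ r, A.mulVec x r < interiorBound A b r := by
  constructor
  · intro hx r
    unfold interiorBound
    split_ifs with h0
    · simp [Matrix.mulVec, h0]
    · by_contra! hle
      -- A small move along the row `A r` stays in the polyhedron but increases the `r`-th form by
      -- `ε` times the squared length of `A r`, so the inequality at `x` must have been strict.
      have hcont : Filter.Tendsto (fun ε : ℝ => x + ε • A r) (nhdsWithin 0 (Set.Ioi 0))
          (nhds x) := by
        have : Continuous fun ε : ℝ => x + ε • A r := by fun_prop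
        have h2 := this.tendsto 0
        simp only [zero_smul, add_zero] at h2
        exact h2.mono_left nhdsWithin_le_nhds
      have h1 := hcont.eventually (mem_interior_iff_mem_nhds.1 hx)
      obtain ⟨ε, hε, hpos⟩ := (h1.and self_mem_nhdsWithin).exists
      have h2 := hε r
      rw [Matrix.mulVec_add, Matrix.mulVec_smul, Pi.add_apply, Pi.smul_apply, smul_eq_mul] at h2
      have h3 : 0 < A.mulVec (A r) r := by
        have h4 : 0 < A r ⬝ᵥ A r := by
          rw [lt_iff_le_and_ne]
          exact ⟨Finset.sum_nonneg fun i _ => mul_self_nonneg _,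
            fun h => h0 (dotProduct_self_eq_zero.1 h.symm)⟩
        exact h4
      have := mul_pos (Set.mem_Ioi.1 hpos) h3
      linarith
  · intro hx
    have hopen : IsOpen {x : Internal k | ∀ r, A.mulVec x r < interiorBound A b r} := by
      simp only [Set.ofPred_forall]
      refine isOpen_iInter_of_finite fun r => isOpen_lt ?_ continuous_const
      exact (continuous_apply r).comp (Continuous.matrix_mulVec continuous_const continuous_id)
    refine interior_maximal (fun y hy r => ?_) hopen hx
    have := hy r
    unfold interiorBound at this
    split_ifs at this with h0
    -- For a zero row, any point of the polyhedron shows that `0 ≤ b r`.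
    · obtain ⟨z, hz⟩ := hne
      have h1 := interior_subset hz r
      simp only [Matrix.mulVec, h0, zero_dotProduct] at h1 ⊢
      exact h1
    · exact this.le

end ModelSet

namespace ModelSet

open RealRAM

/-! ### Coordinates -/

/-- The element of `ℚ(ζ)` with given rational coordinates. -/
def ratPoint (ζ : ℂ) {d : ℕ} (c : Fin d → ℚ) : ℂ := ∑ j, (c j : ℂ) * ζ ^ (j : ℕ)

theorem ratPoint_intCast (ζ : ℂ) {d : ℕ} (c : Fin d → ℤ) :
    ratPoint ζ (fun j => (c j : ℚ)) = ofCoords ζ c := by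
  simp [ratPoint, ofCoords]

theorem ratPoint_sub (ζ : ℂ) {d : ℕ} (c c' : Fin d → ℚ) :
    ratPoint ζ (fun j => c j - c' j) = ratPoint ζ c - ratPoint ζ c' := by
  simp [ratPoint, sub_mul, Finset.sum_sub_distrib]

/-- The generator of `ℚ(ζ)`. -/
def gen (ζ : ℂ) : fieldK ζ := ⟨ζ, IntermediateField.mem_adjoin_simple_self ℚ ζ⟩

theorem ringO_le_fieldK {ζ x : ℂ} (hx : x ∈ ringO ζ) : x ∈ fieldK ζ := by
  have h : ringO ζ ≤ (fieldK ζ).toSubalgebra.restrictScalars ℤ :=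
    Algebra.adjoin_le (by
      rintro _ rfl
      exact IntermediateField.mem_adjoin_simple_self ℚ _)
  exact h hx

theorem coe_sum_gen (ζ : ℂ) {d : ℕ} (c : Fin d → ℚ) :
    ((∑ j, c j • gen ζ ^ (j : ℕ) : fieldK ζ) : ℂ) = ratPoint ζ c := by
  simp [ratPoint, gen, Algebra.smul_def]

/-- The minimal polynomial of `ζ` over `ℚ` is the cyclotomic polynomial, of degree `φ(n)`. -/
theorem exists_basis {n : ℕ} (hn : 0 < n) {ζ : ℂ} (hζ : IsPrimitiveRoot ζ n) :
    ∃ b : Module.Basis (Fin (Nat.totient n)) ℚ (fieldK ζ), ∀ j, b j = gen ζ ^ (j : ℕ) := by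
  have hint : IsIntegral ℚ ζ := (hζ.isIntegral hn).tower_top
  let pb := IntermediateField.adjoin.powerBasis hint
  have hdim : pb.dim = Nat.totient n := by
    rw [IntermediateField.adjoin.powerBasis_dim, ← Polynomial.cyclotomic_eq_minpoly_rat hζ hn,
      Polynomial.natDegree_cyclotomic]
  refine ⟨pb.basis.reindex (finCongr hdim), fun j => ?_⟩
  simp [pb, IntermediateField.adjoin.powerBasis_gen]
  rfl

theorem ofCoords_mem_ringO (ζ : ℂ) {d : ℕ} (c : Fin d → ℤ) : ofCoords ζ c ∈ ringO ζ := by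
  refine Subalgebra.sum_mem _ fun j _ => Subalgebra.mul_mem _ ?_ (Subalgebra.pow_mem _ ?_ _)
  · exact_mod_cast (ringO ζ).algebraMap_mem (c j)
  · exact Algebra.subset_adjoin rfl

/-- The cyclotomic polynomial is monic, so the remainder on division by it keeps integer
coefficients. -/
theorem exists_ofCoords {n : ℕ} (hn : 0 < n) {ζ : ℂ} (hζ : IsPrimitiveRoot ζ n) {x : ℂ}
    (hx : x ∈ ringO ζ) : ∃ c : Fin (Nat.totient n) → ℤ, x = ofCoords ζ c := by
  rw [ringO, Algebra.adjoin_singleton_eq_range_aeval] at hx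
  obtain ⟨p, rfl⟩ := hx
  set Φ := Polynomial.cyclotomic n ℤ
  have hΦ : Φ.Monic := Polynomial.cyclotomic.monic n ℤ
  have hroot : Polynomial.aeval ζ Φ = 0 := by
    have := hζ.isRoot_cyclotomic hn
    rw [Polynomial.IsRoot.def, ← Polynomial.map_cyclotomic_int, Polynomial.eval_map] at this
    simpa [Polynomial.aeval_def] using this
  have hdeg : (p %ₘ Φ).natDegree < Nat.totient n := by
    rw [← Polynomial.natDegree_cyclotomic n ℤ]
    refine Polynomial.natDegree_modByMonic_lt _ hΦ fun h => ?_
    have := Polynomial.natDegree_cyclotomic n ℤ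
    rw [show Polynomial.cyclotomic n ℤ = 1 from h, Polynomial.natDegree_one] at this
    exact absurd this.symm (Nat.totient_pos.2 hn).ne'
  refine ⟨fun j => (p %ₘ Φ).coeff j, ?_⟩
  have h1 : Polynomial.aeval ζ p = Polynomial.aeval ζ (p %ₘ Φ) := by
    conv_lhs => rw [← Polynomial.modByMonic_add_div p Φ]
    simp [hroot]
  show Polynomial.aeval ζ p = _
  rw [h1, Polynomial.aeval_eq_sum_range' hdeg, ofCoords, Finset.sum_range]
  simp

theorem ratPoint_injective {n : ℕ} (hn : 0 < n) {ζ : ℂ} (hζ : IsPrimitiveRoot ζ n) :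
    Function.Injective (ratPoint ζ : (Fin (Nat.totient n) → ℚ) → ℂ) := by
  obtain ⟨b, hb⟩ := exists_basis hn hζ
  intro c c' h
  rw [← coe_sum_gen, ← coe_sum_gen] at h
  have h := Subtype.ext h
  simp only [← hb, ← b.equivFun_symm_apply] at h
  exact b.equivFun.symm.injective h

/-- Coordinates in the power basis are unique. This reduces congruence modulo `ℤ[ζ]` to integrality
tests, which the machine can perform. -/
theorem ratPoint_mem_ringO {n : ℕ} (hn : 0 < n) {ζ : ℂ} (hζ : IsPrimitiveRoot ζ n)
    {c : Fin (Nat.totient n) → ℚ} : ratPoint ζ c ∈ ringO ζ ↔ ∀ j, ∃ k : ℤ, c j = k := by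
  constructor
  · intro h j
    obtain ⟨c', hc'⟩ := exists_ofCoords hn hζ h
    rw [← ratPoint_intCast] at hc'
    exact ⟨c' j, congrFun (ratPoint_injective hn hζ hc') j⟩
  · intro h
    choose k hk using h
    rw [show c = fun j => (k j : ℚ) from funext hk, ratPoint_intCast]
    exact ofCoords_mem_ringO ζ k

/-- On the generator, conjugation is inversion, because `|ζ| = 1`. -/
theorem star_mem_fieldK {n : ℕ} (hn : 0 < n) {ζ : ℂ} (hζ : IsPrimitiveRoot ζ n) {x : ℂ}
    (hx : x ∈ fieldK ζ) : star x ∈ fieldK ζ := by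
  refine IntermediateField.adjoin_induction ℚ (p := fun x _ => star x ∈ fieldK ζ) ?_ ?_ ?_ ?_ ?_ hx
  · intro y hy
    obtain rfl : y = ζ := hy
    have h : star y = y⁻¹ := by
      rw [Complex.inv_def, ← Complex.sq_norm, hζ.norm'_eq_one hn.ne']
      simp
    rw [h]
    exact inv_mem (IntermediateField.mem_adjoin_simple_self ℚ y)
  · intro q
    have : star ((algebraMap ℚ ℂ) q) = algebraMap ℚ ℂ q := by simp
    rw [this]
    exact (fieldK ζ).algebraMap_mem q
  · intro x y _ _ hx hy
    rw [star_add]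
    exact add_mem hx hy
  · intro x _ hx
    rw [star_inv₀]
    exact inv_mem hx
  · intro x y _ _ hx hy
    rw [star_mul]
    exact mul_mem hy hx

/-- Coordinates of the intersection of the lines through `a` and `b`, where `M` is the matrix of
the projection to the first direction along the second one. -/
def gridCoords {d : ℕ} (M : Fin d → Fin d → ℚ) (a b : Fin d → ℤ) : Fin d → ℚ :=
  fun c => a c + ∑ c', M c c' * (b c' - a c')

theorem cross_ne_zero {o o' : ℂ} (ho' : o' ≠ 0) (hpar : ∀ r : ℝ, o ≠ (r : ℂ) * o') :
    o * star o' - star o * o' ≠ 0 := by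
  intro h
  have h2 : star (o / o') = o / o' := by
    rw [star_div₀, div_eq_div_iff (star_ne_zero.2 ho') ho']
    linear_combination -h
  obtain ⟨r, hr⟩ := Complex.conj_eq_iff_real.1 h2
  exact hpar r (by rw [← hr, div_mul_cancel₀ _ ho'])

/-- The projection to `ℝ o` along `ℝ o'` preserves `ℚ(ζ)`. -/
theorem exists_projection {n : ℕ} (hn : 0 < n) {ζ : ℂ} (hζ : IsPrimitiveRoot ζ n) {o o' : ℂ}
    (ho : o ∈ fieldK ζ) (ho' : o' ∈ fieldK ζ) (hne : o' ≠ 0)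
    (hpar : ∀ r : ℝ, o ≠ (r : ℂ) * o') :
    ∃ P : fieldK ζ →ₗ[ℚ] fieldK ζ, ∀ x : fieldK ζ, (∃ r : ℝ, (P x : ℂ) = r * o) ∧
      ∃ r : ℝ, (x : ℂ) - (P x : ℂ) = r * o' := by
  have hD := cross_ne_zero hne hpar
  set D := o * star o' - star o * o'
  have hstar : ∀ {x}, x ∈ fieldK ζ → star x ∈ fieldK ζ := fun hx => star_mem_fieldK hn hζ hx
  have hDK : D ∈ fieldK ζ := sub_mem (mul_mem ho (hstar ho')) (mul_mem (hstar ho) ho')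
  have hsD : star D = -D := by
    simp only [D, star_sub, star_mul, star_star]
    ring
  have hsDne : star D ≠ 0 := star_ne_zero.2 hD
  -- Cramer's rule for `x = α o + β o'` and its conjugate. Both `α` and `β = (o x̄ - ō x) / D` are
  -- quotients of purely imaginary numbers, hence real.
  refine ⟨{ toFun := fun x => ⟨((x : ℂ) * star o' - star (x : ℂ) * o') / D * o,
              mul_mem (div_mem (sub_mem (mul_mem x.2 (hstar ho')) (mul_mem (hstar x.2) ho'))
                hDK) ho⟩
            map_add' := fun x y => Subtype.ext ?_
            map_smul' := fun q x => Subtype.ext ?_ }, fun x => ⟨?_, ?_⟩⟩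
  · simp only [IntermediateField.coe_add, star_add]
    ring
  · simp [Algebra.smul_def]
    ring
  · have h : star (((x : ℂ) * star o' - star (x : ℂ) * o') / D) =
        ((x : ℂ) * star o' - star (x : ℂ) * o') / D := by
      rw [star_div₀, hsD]
      simp only [star_sub, star_mul, star_star]
      rw [div_neg, ← neg_div]
      ring
    obtain ⟨r, hr⟩ := Complex.conj_eq_iff_real.1 h
    exact ⟨r, by simp only [LinearMap.coe_mk, AddHom.coe_mk, hr]⟩
  · have h : star ((o * star (x : ℂ) - star o * (x : ℂ)) / D) =
        (o * star (x : ℂ) - star o * (x : ℂ)) / D := by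
      rw [star_div₀, hsD]
      simp only [star_sub, star_mul, star_star]
      rw [div_neg, ← neg_div]
      ring
    obtain ⟨r, hr⟩ := Complex.conj_eq_iff_real.1 h
    refine ⟨r, ?_⟩
    rw [← hr]
    simp only [LinearMap.coe_mk, AddHom.coe_mk]
    field_simp
    simp only [D]
    ring

/-- With `P` the projection to `ℝ o` along `ℝ o'`, the intersection point is `a + P (b - a)`. As `P`
is `ℚ`-linear, its matrix depends on the directions only and can be a constant of the program. -/
theorem exists_gridMatrix {n : ℕ} (hn : 0 < n) {ζ : ℂ} (hζ : IsPrimitiveRoot ζ n) {o o' : ℂ}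
    (ho : o ∈ fieldK ζ) (ho' : o' ∈ fieldK ζ) (hne : o' ≠ 0)
    (hpar : ∀ r : ℝ, o ≠ (r : ℂ) * o') :
    ∃ M : Fin (Nat.totient n) → Fin (Nat.totient n) → ℚ, ∀ a b,
      ratPoint ζ (gridCoords M a b) ∈ line (ofCoords ζ a) o ∧
      ratPoint ζ (gridCoords M a b) ∈ line (ofCoords ζ b) o' := by
  obtain ⟨P, hP⟩ := exists_projection hn hζ ho ho' hne hpar
  obtain ⟨B, hB⟩ := exists_basis hn hζ
  refine ⟨fun c c' => B.repr (P (B c')) c, fun a b => ?_⟩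
  set x : fieldK ζ := ∑ j, ((b j : ℚ) - (a j : ℚ)) • gen ζ ^ (j : ℕ)
  have hx : (x : ℂ) = ofCoords ζ b - ofCoords ζ a := by
    rw [coe_sum_gen, ← ratPoint_intCast, ← ratPoint_intCast, ← ratPoint_sub]
  have hPx : (P x : ℂ) = ratPoint ζ (gridCoords (fun c c' => B.repr (P (B c')) c) a b) -
      ofCoords ζ a := by
    rw [← ratPoint_intCast, ← ratPoint_sub, ← coe_sum_gen]
    congr 1
    conv_lhs => rw [← B.sum_repr (P x)]
    refine Finset.sum_congr rfl fun c _ => ?_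
    rw [hB]
    congr 1
    simp only [x, map_sum, map_smul, gridCoords, add_sub_cancel_left, ← hB, Finsupp.coe_finsetSum,
      Finset.sum_apply, Finsupp.smul_apply, smul_eq_mul]
    exact Finset.sum_congr rfl fun _ _ => mul_comm _ _
  obtain ⟨⟨r, hr⟩, r', hr'⟩ := hP x
  refine ⟨⟨r, ?_⟩, -r', ?_⟩
  · rw [← hr, hPx]; ring
  · push_cast
    rw [neg_mul, ← hr', hPx, hx]; ring

/-! ### Lines -/

theorem mem_line_self (t o : ℂ) : t ∈ line t o := ⟨0, by simp⟩

theorem line_eq_of_mem {z t o : ℂ} (h : z ∈ line t o) : line z o = line t o := by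
  obtain ⟨r, rfl⟩ := h
  ext w
  constructor
  · rintro ⟨r', rfl⟩
    exact ⟨r + r', by push_cast; ring⟩
  · rintro ⟨r', rfl⟩
    exact ⟨r' - r, by push_cast; ring⟩

theorem lineThrough_eq_iff {z t o : ℂ} : lineThrough z o = lineThrough t o ↔ z ∈ line t o := by
  constructor
  · intro h
    rw [← show line z o = line t o from congrArg Subtype.val h]
    exact mem_line_self z o
  · intro h
    exact Subtype.ext (line_eq_of_mem h)

theorem add_mem_line {z t o : ℂ} (h : z ∈ line t o) (s : ℂ) : s + z ∈ line (s + t) o := by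
  obtain ⟨r, rfl⟩ := h
  exact ⟨r, by ring⟩

theorem eq_of_mem_lines {o o' a b x y : ℂ} (hpar : ∀ r : ℝ, o ≠ (r : ℂ) * o')
    (hxa : x ∈ line a o) (hxb : x ∈ line b o') (hya : y ∈ line a o) (hyb : y ∈ line b o') :
    x = y := by
  obtain ⟨r₁, h₁⟩ := hxa
  obtain ⟨r₂, h₂⟩ := hxb
  obtain ⟨r₃, h₃⟩ := hya
  obtain ⟨r₄, h₄⟩ := hyb
  by_cases hr : r₁ = r₃
  · rw [h₁, h₃, hr]
  · exfalso
    have hr' : ((r₁ : ℂ) - r₃) ≠ 0 := by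
      rw [sub_ne_zero]
      exact_mod_cast hr
    refine hpar ((r₂ - r₄) / (r₁ - r₃)) ?_
    push_cast
    rw [div_mul_eq_mul_div, eq_div_iff hr']
    linear_combination h₂ - h₄ - h₁ + h₃

theorem xray_ne_zero_iff {o : ℂ} {F : Finset ℂ} {ℓ : LineIn o} :
    xray o F ℓ ≠ 0 ↔ ∃ z ∈ F, z ∈ ℓ.1 := by
  rw [xray, Ne, Set.ncard_eq_zero (F.finite_toSet.inter_of_left _), ← Ne,
    ← Set.nonempty_iff_ne_empty]
  rfl

theorem mem_line_iff_eq_lineThrough {o z : ℂ} {ℓ : LineIn o} : z ∈ ℓ.1 ↔ lineThrough z o = ℓ := by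
  obtain ⟨_, t, rfl⟩ := ℓ
  exact lineThrough_eq_iff.symm

theorem support_xray (o : ℂ) (F : Finset ℂ) :
    Function.support (xray o F) = (fun z => lineThrough z o) '' (F : Set ℂ) := by
  ext ℓ
  rw [Function.mem_support, xray_ne_zero_iff]
  simp [mem_line_iff_eq_lineThrough]

/-! ### Windows -/

section

variable {ζ : ℂ} {k l : ℕ} (σ : Fin k → (fieldK ζ ≃ₐ[ℚ] fieldK ζ))
  (A : Matrix (Fin l) (Fin k × Fin 2) ℝ) (b : Fin l → ℝ)

theorem starMap_add (z w : fieldK ζ) : starMap σ (z + w) = starMap σ z + starMap σ w := by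
  ext ⟨j, i⟩
  fin_cases i <;> simp [starMap]

theorem starMap_sub (z w : fieldK ζ) : starMap σ (z - w) = starMap σ z - starMap σ w := by
  ext ⟨j, i⟩
  fin_cases i <;> simp [starMap]

theorem starMap_smul (q : ℚ) (z : fieldK ζ) : starMap σ (q • z) = (q : ℝ) • starMap σ z := by
  ext ⟨j, i⟩
  fin_cases i <;> simp [starMap, Algebra.smul_def]

/-- The real coefficients of the linear form `A_r z⋆` in the coordinates of `z`. -/
def starCoeff (r : Fin l) (j : ℕ) : ℝ := A.mulVec (starMap σ (gen ζ ^ j)) r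

/-- The value of `A_r z⋆` at the point with given coordinates. -/
def starForm {d : ℕ} (r : Fin l) (c : Fin d → ℚ) : ℝ := ∑ j : Fin d, starCoeff σ A r j * (c j : ℝ)

/-- The star map is `ℚ`-linear on `ℚ(ζ)`, so the form is determined by its values on the powers of
`ζ`, also at grid points outside `ℤ[ζ]`. -/
theorem mulVec_starMap {d : ℕ} (c : Fin d → ℚ) (z : fieldK ζ) (hz : (z : ℂ) = ratPoint ζ c)
    (r : Fin l) : A.mulVec (starMap σ z) r = starForm σ A r c := by
  have hz' : z = ∑ j, c j • gen ζ ^ (j : ℕ) := Subtype.ext (by rw [hz, coe_sum_gen])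
  let f : fieldK ζ →+ ℝ := AddMonoidHom.mk' (fun z => A.mulVec (starMap σ z) r) fun x y => by
    rw [starMap_add, Matrix.mulVec_add]; rfl
  have hf : ∀ z, A.mulVec (starMap σ z) r = f z := fun _ => rfl
  rw [hf, hz', map_sum]
  refine Finset.sum_congr rfl fun j _ => ?_
  rw [← hf, starMap_smul, Matrix.mulVec_smul, Pi.smul_apply, smul_eq_mul, mul_comm]
  rfl

/-- The tuple of index pairs `v` gives the supporting hyperplanes of a translate of the window. -/
def Feasible {d : ℕ} (g : ℕ → ℕ → Fin d → ℚ) (v : Fin (l + 1) → ℕ × ℕ) : Prop :=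
  ∃ τ : Internal k, ∀ r : Fin l,
    starForm σ A r (g (v r.succ).1 (v r.succ).2) - interiorBound A b r < A.mulVec τ r

/-- Selection of the grid points that differ from the first point of the tuple `v` by an element of
`ℤ[ζ]`, and do not exceed the other points of `v`. -/
def Selected {d : ℕ} (g : ℕ → ℕ → Fin d → ℚ) (VA VB : ℕ → Prop) (v : Fin (l + 1) → ℕ × ℕ)
    (i j : ℕ) : Prop :=
  (VA i ∧ VB j) ∧ (∀ c, ∃ z : ℤ, g i j c - g (v 0).1 (v 0).2 c = z) ∧
    ∀ r : Fin l, starForm σ A r (g i j) ≤ starForm σ A r (g (v r.succ).1 (v r.succ).2)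

variable {σ A b} {n : ℕ} {g : ℕ → ℕ → Fin (Nat.totient n) → ℚ} {VA VB : ℕ → Prop} {t : ℂ}

/-- The position `τ` makes the `r`-th maximiser satisfy the `r`-th strict inequality, and selected
points do not exceed it in that form. -/
theorem exists_isWSet_of_feasible (hn : 0 < n) (hζ : IsPrimitiveRoot ζ n)
    (hne : (interior (polyhedron A b)).Nonempty) {v : Fin (l + 1) → ℕ × ℕ} (hv : Feasible σ A b g v) :
    ∃ Λ, IsWSet σ (polyhedron A b) Λ ∧
      ∀ i j, Selected σ A g VA VB v i j → t + ratPoint ζ (g i j) ∈ Λ := by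
  obtain ⟨τ, hτ⟩ := hv
  set g0 := g (v 0).1 (v 0).2
  set z0 : fieldK ζ := ∑ j, g0 j • gen ζ ^ (j : ℕ)
  have hz0 : (z0 : ℂ) = ratPoint ζ g0 := coe_sum_gen ζ g0
  -- The module is translated to the reference point, which shifts the star images, and hence the
  -- window, by `-z0⋆`.
  refine ⟨_, ⟨t + ratPoint ζ g0, τ - starMap σ z0, rfl⟩, fun i j hij => ?_⟩
  obtain ⟨-, h1, h2⟩ := hij
  set z : fieldK ζ := ∑ c, g i j c • gen ζ ^ (c : ℕ)
  have hz : (z : ℂ) = ratPoint ζ (g i j) := coe_sum_gen ζ _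
  refine ⟨z - z0, ?_, ⟨starMap σ z - τ, ?_, ?_⟩, ?_⟩
  · rw [AddSubgroupClass.coe_sub, hz, hz0, ← ratPoint_sub, ratPoint_mem_ringO hn hζ]
    exact h1
  · rw [mem_interior_polyhedron hne]
    intro r
    rw [Matrix.mulVec_sub, Pi.sub_apply, mulVec_starMap σ A _ _ hz]
    linarith [hτ r, h2 r]
  · simp only [starMap_sub]
    abel
  · rw [AddSubgroupClass.coe_sub, hz, hz0]
    ring

/-- The tuple consists of an arbitrary point of `F` followed, for each row, by a point of `F` at
which the form of that row is maximal. -/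
theorem exists_feasible_of_isWSet (hn : 0 < n) (hζ : IsPrimitiveRoot ζ n)
    (hne : (interior (polyhedron A b)).Nonempty) {NA NB : ℕ} {F : Finset ℂ} (hF : F.Nonempty)
    (hΛ : ∃ Λ, IsWSet σ (polyhedron A b) Λ ∧ (F : Set ℂ) ⊆ Λ)
    (hgrid : ∀ f ∈ F, ∃ i < NA, ∃ j < NB, (VA i ∧ VB j) ∧ t + ratPoint ζ (g i j) = f) :
    ∃ v : Fin (l + 1) → ℕ × ℕ, (∀ q, (v q).1 < NA ∧ (v q).2 < NB) ∧ Feasible σ A b g v ∧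
      ∀ f ∈ F, ∃ i < NA, ∃ j < NB, Selected σ A g VA VB v i j ∧ t + ratPoint ζ (g i j) = f := by
  obtain ⟨Λ, ⟨t', τ, rfl⟩, hFΛ⟩ := hΛ
  have hFΛ : ∀ f ∈ F, f ∈ modelSet σ t' _ := fun f hf => hFΛ hf
  choose! i hi j hj hV hpt using hgrid
  choose! z hzO hzW hz using hFΛ
  -- The translations `t` and `t'` may differ, so module points and grid coordinates are compared
  -- through differences only.
  have hzc : ∀ f ∈ F, ∀ f' ∈ F, ((z f - z f' : fieldK ζ) : ℂ) =
      ratPoint ζ fun c => g (i f) (j f) c - g (i f') (j f') c := by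
    intro f hf f' hf'
    rw [ratPoint_sub, AddSubgroupClass.coe_sub]
    linear_combination hpt f' hf' - hpt f hf + hz f' hf' - hz f hf
  have hstar : ∀ f ∈ F, ∀ f' ∈ F, ∀ r, A.mulVec (starMap σ (z f)) r -
      A.mulVec (starMap σ (z f')) r =
      starForm σ A r (g (i f) (j f)) - starForm σ A r (g (i f') (j f')) := by
    intro f hf f' hf' r
    have h := mulVec_starMap σ A _ _ (hzc f hf f' hf') r
    rw [starMap_sub, Matrix.mulVec_sub, Pi.sub_apply] at h
    rw [h]
    simp [starForm, mul_sub, Finset.sum_sub_distrib]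
  have hW : ∀ f ∈ F, ∀ r, A.mulVec (starMap σ (z f)) r < A.mulVec τ r + interiorBound A b r := by
    intro f hf r
    obtain ⟨x, hx, hxz⟩ := hzW f hf
    have h := (mem_interior_polyhedron hne).1 hx r
    rw [← hxz]
    simp only [Matrix.mulVec_add, Pi.add_apply]
    linarith
  obtain ⟨f0, hf0⟩ := hF
  have hmax := fun r : Fin l =>
    F.exists_max_image (fun f => starForm σ A r (g (i f) (j f))) ⟨f0, hf0⟩
  choose fm hfm hmax using hmax
  set z0 : fieldK ζ := ∑ c, g (i f0) (j f0) c • gen ζ ^ (c : ℕ)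
  have hz0 : (z0 : ℂ) = ratPoint ζ (g (i f0) (j f0)) := coe_sum_gen ζ _
  refine ⟨Fin.cons (i f0, j f0) fun r => (i (fm r), j (fm r)), ?_, ?_, ?_⟩
  · intro q
    refine Fin.cases ?_ (fun r => ?_) q
    · exact ⟨hi f0 hf0, hj f0 hf0⟩
    · exact ⟨hi _ (hfm r), hj _ (hfm r)⟩
  -- The correction is the star image of the constant difference between grid coordinates and module
  -- points, read off at `f0`.
  · refine ⟨τ + starMap σ z0 - starMap σ (z f0), fun r => ?_⟩
    simp only [Fin.cons_succ, Matrix.mulVec_sub, Matrix.mulVec_add, Pi.sub_apply, Pi.add_apply]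
    rw [mulVec_starMap σ A _ _ hz0]
    linarith [hstar _ (hfm r) f0 hf0 r, hW _ (hfm r) r]
  · intro f hf
    refine ⟨i f, hi f hf, j f, hj f hf, ⟨hV f hf, ?_, fun r => ?_⟩, hpt f hf⟩
    · simp only [Fin.cons_zero]
      rw [← ratPoint_mem_ringO hn hζ, ← hzc f hf f0 hf0, AddSubgroupClass.coe_sub]
      exact sub_mem (hzO f hf) (hzO f0 hf0)
    · simpa only [Fin.cons_succ] using hmax r f hf

end

/-! ### The grid -/

theorem nodup_pointList {pt : ℕ → ℕ → ℂ} {M : ℕ → ℕ → Prop} {NA NB : ℕ}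
    (h : ∀ i < NA, ∀ j < NB, ∀ i' < NA, ∀ j' < NB, M i j → M i' j' → pt i j = pt i' j' →
      i = i' ∧ j = j') : (pointList pt M NA NB).Nodup := by
  rw [pointList, List.nodup_flatMap]
  constructor
  · intro i hi
    refine List.Nodup.map_on ?_ (List.nodup_range.filter _)
    simp only [List.mem_filter, List.mem_range, decide_eq_true_eq] at hi ⊢
    intro j hj j' hj' hjj
    exact (h i hi j hj.1 i hi j' hj'.1 hj.2 hj'.2 hjj).2
  · refine List.nodup_range.imp_of_mem ?_
    intro i i' hi hi' hii z hz hz'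
    simp only [rowPoints, List.mem_map, List.mem_filter, List.mem_range, decide_eq_true_eq]
      at hi hi' hz hz'
    obtain ⟨j, hj, rfl⟩ := hz
    obtain ⟨j', hj', hjj⟩ := hz'
    exact hii (h i hi j hj.1 i' hi' j' hj'.1 hj.2 hj'.2 hjj.symm).1

open Classical in
-- Only marked indices count. In the uniqueness problem several indices can belong to the same line,
-- and `NA * NB` would be too weak a bound.
theorem card_toFinset_pointList_le {pt : ℕ → ℕ → ℂ} {M : ℕ → ℕ → Prop} {NA NB : ℕ}
    {VA VB : ℕ → Prop} (h : ∀ i j, M i j → VA i ∧ VB j) :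
    (pointList pt M NA NB).toFinset.card ≤
      ((Finset.range NA).filter VA).card * ((Finset.range NB).filter VB).card := by
  rw [← Finset.card_product]
  refine (Finset.card_le_card (t := (((Finset.range NA).filter VA) ×ˢ
    ((Finset.range NB).filter VB)).image fun p => pt p.1 p.2) ?_).trans Finset.card_image_le
  intro z hz
  rw [List.mem_toFinset, mem_pointList] at hz
  obtain ⟨i, hi, j, hj, hM, rfl⟩ := hz
  simp only [Finset.mem_image, Finset.mem_product, Finset.mem_filter, Finset.mem_range, Prod.exists]
  exact ⟨i, j, ⟨⟨hi, (h i j hM).1⟩, hj, (h i j hM).2⟩, rfl⟩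

end ModelSet

namespace ModelSet

open RealRAM

/-! ### The search in a grid -/

/-- A linear form with constant coefficients. -/
def formExp {d : ℕ} (a : Fin d → ℝ) (e : Fin d → RExp) : RExp :=
  RExp.sum fun j => .mul (.const (a j)) (e j)

@[simp] theorem eval_formExp {d : ℕ} (a : Fin d → ℝ) (e : Fin d → RExp) (σ : State) :
    (formExp a e).eval σ = ∑ j, a j * (e j).eval σ := by
  simp [formExp, RExp.eval]

/-- The coordinate `c` of the grid point whose indices stand in the registers `ri` and `rj`. -/
def gridExp {d : ℕ} (M : Fin d → Fin d → ℚ) (pA pB : Fin d → ℕ → RExp) (ri rj : ℕ) (c : Fin d) :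
    RExp :=
  .add (pA c ri) (formExp (fun c' => (M c c' : ℝ)) fun c' => .sub (pB c' rj) (pA c' ri))

theorem eval_gridExp {d : ℕ} {M : Fin d → Fin d → ℚ} {pA pB : Fin d → ℕ → RExp} {ri rj : ℕ}
    {σ : State} {a b : Fin d → ℤ} (ha : ∀ c, (pA c ri).eval σ = a c)
    (hb : ∀ c, (pB c rj).eval σ = b c) (c : Fin d) :
    (gridExp M pA pB ri rj c).eval σ = (gridCoords M a b c : ℚ) := by
  simp [gridExp, RExp.eval, ha, hb, gridCoords]

/-- A real coordinate of the point with coordinates `e`. -/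
def reExp (ζ : ℂ) {d : ℕ} (e : Fin d → RExp) : RExp := formExp (fun j => (ζ ^ (j : ℕ)).re) e

/-- The other real coordinate of the point with coordinates `e`. -/
def imExp (ζ : ℂ) {d : ℕ} (e : Fin d → RExp) : RExp := formExp (fun j => (ζ ^ (j : ℕ)).im) e

theorem eval_reExp {ζ : ℂ} {d : ℕ} {e : Fin d → RExp} {σ : State} {c : Fin d → ℚ}
    (h : ∀ j, (e j).eval σ = c j) : (reExp ζ e).eval σ = (ratPoint ζ c).re := by
  simp only [reExp, eval_formExp, h, ratPoint, Complex.re_sum]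
  refine Finset.sum_congr rfl fun j _ => ?_
  rw [← Complex.ofReal_ratCast, Complex.re_ofReal_mul, mul_comm]

theorem eval_imExp {ζ : ℂ} {d : ℕ} {e : Fin d → RExp} {σ : State} {c : Fin d → ℚ}
    (h : ∀ j, (e j).eval σ = c j) : (imExp ζ e).eval σ = (ratPoint ζ c).im := by
  simp only [imExp, eval_formExp, h, ratPoint, Complex.im_sum]
  refine Finset.sum_congr rfl fun j _ => ?_
  rw [← Complex.ofReal_ratCast, Complex.im_ofReal_mul, mul_comm]

theorem eval_reExp_int {ζ : ℂ} {d : ℕ} {e : Fin d → RExp} {σ : State} {c : Fin d → ℤ}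
    (h : ∀ j, (e j).eval σ = c j) : (reExp ζ e).eval σ = (ofCoords ζ c).re := by
  rw [← ratPoint_intCast]
  exact eval_reExp (by simpa using h)

theorem eval_imExp_int {ζ : ℂ} {d : ℕ} {e : Fin d → RExp} {σ : State} {c : Fin d → ℤ}
    (h : ∀ j, (e j).eval σ = c j) : (imExp ζ e).eval σ = (ofCoords ζ c).im := by
  rw [← ratPoint_intCast]
  exact eval_imExp (by simpa using h)

section

variable {ζ : ℂ} {k l d : ℕ} (σ : Fin k → (fieldK ζ ≃ₐ[ℚ] fieldK ζ))
  (A : Matrix (Fin l) (Fin k × Fin 2) ℝ) (b : Fin l → ℝ) (M : Fin d → Fin d → ℚ)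
  (pA pB : Fin d → ℕ → RExp)

/-- The test for `Selected`. -/
def selectTest (vt : Test) : Test :=
  .and vt (.and
    (.all (List.ofFn fun c : Fin d => .isInt (.sub (gridExp M pA pB 20 21 c)
      (gridExp M pA pB (25 + 2 * ((0 : Fin (l + 1)) : ℕ)) (26 + 2 * ((0 : Fin (l + 1)) : ℕ)) c))))
    (.all (List.ofFn fun r : Fin l => .not (.realLt
      (formExp (fun j : Fin d => starCoeff σ A r j)
        (gridExp M pA pB (25 + 2 * (r.succ : ℕ)) (26 + 2 * (r.succ : ℕ))))
      (formExp (fun j : Fin d => starCoeff σ A r j) (gridExp M pA pB 20 21))))))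

/-- The test for `Feasible`. -/
def feasTest (Λ : List (Fin l → ℝ)) : Test :=
  .all (Λ.map fun c => .realLt
    (RExp.sum fun r : Fin l => .mul (.const (c r)) (.sub
      (formExp (fun j : Fin d => starCoeff σ A r j)
        (gridExp M pA pB (25 + 2 * (r.succ : ℕ)) (26 + 2 * (r.succ : ℕ))))
      (.const (interiorBound A b r))))
    (.const 0))

variable {σ A b M pA pB}

theorem holds_selectTest {vt : Test} {S : State} {ca cb : ℕ → Fin d → ℤ} {VA VB : ℕ → Prop}
    {v : Fin (l + 1) → ℕ × ℕ} {NA NB : ℕ}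
    (hpA : ∀ c r, S.reg r < NA → (pA c r).eval S = ca (S.reg r) c)
    (hpB : ∀ c r, S.reg r < NB → (pB c r).eval S = cb (S.reg r) c)
    (hv : ∀ q, (v q).1 < NA ∧ (v q).2 < NB) (hvt : TupleAt v 0 S) (hi : S.reg 20 < NA)
    (hj : S.reg 21 < NB) (hV : vt.holds S ↔ VA (S.reg 20) ∧ VB (S.reg 21)) :
    (selectTest σ A M pA pB vt).holds S ↔
      Selected σ A (fun i j => gridCoords M (ca i) (cb j)) VA VB v (S.reg 20) (S.reg 21) := by
  have hq : ∀ (q : Fin (l + 1)) c, (gridExp M pA pB (25 + 2 * (q : ℕ)) (26 + 2 * (q : ℕ)) c).eval S =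
      (gridCoords M (ca (v q).1) (cb (v q).2) c : ℚ) := by
    intro q c
    obtain ⟨h1, h2⟩ := hvt q (Nat.zero_le _)
    rw [← h1, ← h2]
    exact eval_gridExp (fun c => hpA c _ (h1 ▸ (hv q).1)) (fun c => hpB c _ (h2 ▸ (hv q).2)) c
  have hp : ∀ c, (gridExp M pA pB 20 21 c).eval S =
      (gridCoords M (ca (S.reg 20)) (cb (S.reg 21)) c : ℚ) :=
    eval_gridExp (fun c => hpA c _ hi) (fun c => hpB c _ hj)
  simp only [selectTest, Test.holds, Test.holds_all, List.mem_ofFn, forall_exists_index,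
    forall_apply_eq_imp_iff, RExp.eval, eval_formExp, hp, hq, Selected, starForm, not_lt, hV]
  refine and_congr_right fun _ => and_congr_left fun _ => forall_congr' fun c =>
    exists_congr fun z => ?_
  exact_mod_cast Iff.rfl

theorem holds_feasTest {Λ : List (Fin l → ℝ)}
    (hΛ : ∀ u : Fin l → ℝ, (∃ τ : Fin k × Fin 2 → ℝ, ∀ r, u r < A.mulVec τ r) ↔
      ∀ c ∈ Λ, ∑ r, c r * u r < 0) {S : State} {ca cb : ℕ → Fin d → ℤ}
    {v : Fin (l + 1) → ℕ × ℕ} {NA NB : ℕ}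
    (hpA : ∀ c r, S.reg r < NA → (pA c r).eval S = ca (S.reg r) c)
    (hpB : ∀ c r, S.reg r < NB → (pB c r).eval S = cb (S.reg r) c)
    (hv : ∀ q, (v q).1 < NA ∧ (v q).2 < NB) (hvt : TupleAt v 0 S) :
    (feasTest σ A b M pA pB Λ).holds S ↔
      Feasible σ A b (fun i j => gridCoords M (ca i) (cb j)) v := by
  have hq : ∀ (q : Fin (l + 1)) c, (gridExp M pA pB (25 + 2 * (q : ℕ)) (26 + 2 * (q : ℕ)) c).eval S =
      (gridCoords M (ca (v q).1) (cb (v q).2) c : ℚ) := by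
    intro q c
    obtain ⟨h1, h2⟩ := hvt q (Nat.zero_le _)
    rw [← h1, ← h2]
    exact eval_gridExp (fun c => hpA c _ (h1 ▸ (hv q).1)) (fun c => hpB c _ (h2 ▸ (hv q).2)) c
  unfold Feasible
  rw [hΛ]
  simp only [feasTest, Test.holds, Test.holds_all, List.mem_map, forall_exists_index, and_imp,
    forall_apply_eq_imp_iff₂, RExp.eval, RExp.eval_sum, eval_formExp, hq, starForm]

end

/-- What the search uses about the form of the answers: they begin with `1` if and only if there is
a solution, and a positive answer remains correct for a weaker problem. -/
structure AnswerFormat (Ans : List ℝ → (Finset ℂ → Prop) → Prop) : Prop where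
  mono : ∀ {w sol sol'}, Ans w sol → w.head? = some 1 → (∀ F, sol F → sol' F) → Ans w sol'
  not_exists : ∀ {w sol}, Ans w sol → w.head? ≠ some 1 → ¬ ∃ F, sol F
  zero : ∀ {sol : Finset ℂ → Prop}, (¬ ∃ F, sol F) → Ans [0] sol
  ne_nil : ∀ {w sol}, Ans w sol → w ≠ []
  length_le : ∀ {w sol} {N : ℕ}, Ans w sol → (∀ F, sol F → F.card ≤ N) → w.length ≤ 1 + 2 * N

theorem answerFormat_decides : AnswerFormat fun w sol => Decides w (∃ F, sol F) where
  mono := by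
    rintro w sol sol' (⟨⟨F, hF⟩, rfl⟩ | ⟨-, rfl⟩) hw h
    · exact .inl ⟨⟨F, h F hF⟩, rfl⟩
    · simp at hw
  not_exists := by
    rintro w sol (⟨-, rfl⟩ | ⟨h, rfl⟩) hw
    · simp at hw
    · exact h
  zero := fun h => .inr ⟨h, rfl⟩
  ne_nil := by
    rintro w sol (⟨-, rfl⟩ | ⟨-, rfl⟩) <;> simp
  length_le := by
    rintro w sol N (⟨-, rfl⟩ | ⟨-, rfl⟩) - <;> simp

theorem Enumerates.length_eq {L : List ℂ} {F : Finset ℂ} (h : Enumerates L F) :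
    L.length = F.card := by
  classical
  rw [← List.toFinset_card_of_nodup h.1]
  congr 1
  ext z
  rw [List.mem_toFinset, h.2]

theorem answerFormat_constructs : AnswerFormat Constructs where
  mono := by
    rintro w sol sol' (⟨F, L, hF, hL, rfl⟩ | ⟨-, rfl⟩) hw h
    · exact .inl ⟨F, L, h F hF, hL, rfl⟩
    · simp at hw
  not_exists := by
    rintro w sol (⟨F, L, hF, hL, rfl⟩ | ⟨h, rfl⟩) hw
    · simp at hw
    · exact h
  zero := fun h => .inr ⟨h, rfl⟩
  ne_nil := by
    rintro w sol (⟨F, L, hF, hL, rfl⟩ | ⟨-, rfl⟩) <;> simp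
  length_le := by
    rintro w sol N (⟨F, L, hF, hL, rfl⟩ | ⟨-, rfl⟩) h
    · have := h F hF
      rw [List.length_cons, length_encPoints, hL.length_eq]
      omega
    · simp

/-- The search program for a grid. -/
def gridSearch (ζ : ℂ) {k l d : ℕ} (σ : Fin k → (fieldK ζ ≃ₐ[ℚ] fieldK ζ))
    (A : Matrix (Fin l) (Fin k × Fin 2) ℝ) (b : Fin l → ℝ) (M : Fin d → Fin d → ℚ)
    (Λ : List (Fin l → ℝ)) (pA pB : Fin d → ℕ → RExp) (vt : Test) (tr ti : RExp) : Prog :=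
  search (l + 1) (feasTest σ A b M pA pB Λ) (selectTest σ A M pA pB vt)
    (.add tr (reExp ζ (gridExp M pA pB 20 21))) (.add ti (imExp ζ (gridExp M pA pB 20 21)))

open Classical in
/-- Given the lines in the first two directions that support all solutions, the search solves the
problem of finding a solution in a `W°`-set by means of an oracle for solutions in finite sets. -/
theorem ok_gridSearch {n : ℕ} (hn : 0 < n) {ζ : ℂ} (hζ : IsPrimitiveRoot ζ n) {k l : ℕ}
    {σ : Fin k → (fieldK ζ ≃ₐ[ℚ] fieldK ζ)} {A : Matrix (Fin l) (Fin k × Fin 2) ℝ} {b : Fin l → ℝ}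
    (hne : (interior (polyhedron A b)).Nonempty)
    {M : Fin (Nat.totient n) → Fin (Nat.totient n) → ℚ} {o o' : ℂ}
    (hpar : ∀ r : ℝ, o ≠ (r : ℂ) * o')
    (hM : ∀ a b, ratPoint ζ (gridCoords M a b) ∈ line (ofCoords ζ a) o ∧
      ratPoint ζ (gridCoords M a b) ∈ line (ofCoords ζ b) o')
    {Λ : List (Fin l → ℝ)}
    (hΛ : ∀ u : Fin l → ℝ, (∃ τ : Fin k × Fin 2 → ℝ, ∀ r, u r < A.mulVec τ r) ↔
      ∀ c ∈ Λ, ∑ r, c r * u r < 0)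
    {S₀ : State} {pre : List ℝ} {NA NB s B : ℕ} {O : List ℝ → List ℝ}
    {pA pB : Fin (Nat.totient n) → ℕ → RExp} {vt : Test} {tr ti : RExp}
    {ca cb : ℕ → Fin (Nat.totient n) → ℤ} {VA VB : ℕ → Prop} {t : ℂ}
    (h₀ : Base S₀ pre NA NB S₀) (h₁ : S₀.mem 1 0 = 0)
    (hpA : ∀ S, Base S₀ pre NA NB S → ∀ c r, S.reg r < NA → (pA c r).eval S = ca (S.reg r) c)
    (hpB : ∀ S, Base S₀ pre NA NB S → ∀ c r, S.reg r < NB → (pB c r).eval S = cb (S.reg r) c)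
    (hvt : ∀ S, Base S₀ pre NA NB S → S.reg 20 < NA → S.reg 21 < NB →
      (vt.holds S ↔ VA (S.reg 20) ∧ VB (S.reg 21)))
    (htr : ∀ S, Base S₀ pre NA NB S → tr.eval S = t.re)
    (hti : ∀ S, Base S₀ pre NA NB S → ti.eval S = t.im)
    (hVA : ∀ i < NA, ∀ i' < NA, VA i → VA i' →
      lineThrough (t + ofCoords ζ (ca i)) o = lineThrough (t + ofCoords ζ (ca i')) o → i = i')
    (hVB : ∀ i < NB, ∀ i' < NB, VB i → VB i' →
      lineThrough (t + ofCoords ζ (cb i)) o' = lineThrough (t + ofCoords ζ (cb i')) o' → i = i')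
    (hsA : ((Finset.range NA).filter VA).card ≤ s) (hsB : ((Finset.range NB).filter VB).card ≤ s)
    (hNA : NA ≤ B) (hNB : NB ≤ B) (hB : pre.length + 4 * s ^ 2 + 2 ≤ B)
    {Ans : List ℝ → (Finset ℂ → Prop) → Prop} (hAns : AnswerFormat Ans) {R : Finset ℂ → Prop}
    (hO : ∀ L : List ℂ, L.Nodup → L.length ≤ s ^ 2 →
      Ans (O (queryWord pre L)) fun F => F ⊆ L.toFinset ∧ R F)
    (hRA : ∀ F, R F → ∀ f ∈ F, ∃ i < NA, VA i ∧ f ∈ line (t + ofCoords ζ (ca i)) o)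
    (hRB : ∀ F, R F → ∀ f ∈ F, ∃ i < NB, VB i ∧ f ∈ line (t + ofCoords ζ (cb i)) o') :
    Ok O (fun q => ∃ L : List ℂ, (L.Nodup ∧ L.length ≤ s ^ 2 ∧
        ∃ W, IsWSet σ (polyhedron A b) W ∧ ∀ z ∈ L, z ∈ W) ∧ q = queryWord pre L) B
      (gridSearch ζ σ A b M Λ pA pB vt tr ti) S₀ fun S =>
        Ans S.output fun F => (∃ W, IsWSet σ (polyhedron A b) W ∧ (F : Set ℂ) ⊆ W) ∧ R F := by
  set g : ℕ → ℕ → Fin (Nat.totient n) → ℚ := fun i j => gridCoords M (ca i) (cb j)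
  set pt : ℕ → ℕ → ℂ := fun i j => t + ratPoint ζ (g i j)
  have hptA : ∀ i j, pt i j ∈ line (t + ofCoords ζ (ca i)) o := fun i j =>
    add_mem_line (hM _ _).1 t
  have hptB : ∀ i j, pt i j ∈ line (t + ofCoords ζ (cb j)) o' := fun i j =>
    add_mem_line (hM _ _).2 t
  have hgrid : ∀ S, Base S₀ pre NA NB S → S.reg 20 < NA → S.reg 21 < NB → ∀ c,
      (gridExp M pA pB 20 21 c).eval S = (g (S.reg 20) (S.reg 21) c : ℚ) := fun S hS hi hj =>
    eval_gridExp (fun c => hpA S hS c _ hi) (fun c => hpB S hS c _ hj)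
  -- Marked indices correspond to distinct lines, and a grid point determines its two lines.
  have hnodup : ∀ v, (pointList pt (Selected σ A g VA VB v) NA NB).Nodup := by
    intro v
    refine nodup_pointList fun i hi j hj i' hi' j' hj' hV hV' hpt => ⟨?_, ?_⟩
    · refine hVA i hi i' hi' hV.1.1 hV'.1.1 ?_
      rw [← lineThrough_eq_iff.2 (hptA i j), hpt, lineThrough_eq_iff.2 (hptA i' j')]
    · refine hVB j hj j' hj' hV.1.2 hV'.1.2 ?_
      rw [← lineThrough_eq_iff.2 (hptB i j), hpt, lineThrough_eq_iff.2 (hptB i' j')]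
  have hcard : ∀ v, (pointList pt (Selected σ A g VA VB v) NA NB).length ≤ s ^ 2 := by
    intro v
    rw [← List.toFinset_card_of_nodup (hnodup v), sq]
    exact (card_toFinset_pointList_le fun i j h => h.1).trans (Nat.mul_le_mul hsA hsB)
  refine (ok_search (pt := pt) (Feas := Feasible σ A b g) (M := Selected σ A g VA VB)
    (Ls := {L | L.Nodup ∧ L.length ≤ s ^ 2 ∧ ∃ W, IsWSet σ (polyhedron A b) W ∧ ∀ z ∈ L, z ∈ W})
    h₀ h₁ hNA hNB ?_ ?_ ?_ ?_ ?_ ?_ ?_).mono ?_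
  · intro S hS hi hj
    simp only [RExp.eval, htr S hS, eval_reExp (hgrid S hS hi hj), pt, Complex.add_re]
  · intro S hS hi hj
    simp only [RExp.eval, hti S hS, eval_imExp (hgrid S hS hi hj), pt, Complex.add_im]
  · intro v S hS hv hvS hi hj
    exact holds_selectTest (hpA S hS) (hpB S hS) hv hvS hi hj (hvt S hS hi hj)
  · intro v S hS hv hvS
    exact holds_feasTest hΛ (hpA S hS) (hpB S hS) hv hvS
  · exact ⟨List.nodup_nil, by simp, _, ⟨0, 0, rfl⟩, by simp⟩
  · intro v hv
    obtain ⟨W, hW, hsel⟩ := exists_isWSet_of_feasible (VA := VA) (VB := VB) (t := t) hn hζ hne hv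
    refine ⟨hnodup v, hcard v, W, hW, fun z hz => ?_⟩
    obtain ⟨i, -, j, -, hij, rfl⟩ := mem_pointList.1 hz
    exact hsel i j hij
  · rintro L ⟨hL, hL', -⟩
    have h := hO L hL hL'
    refine ⟨hAns.ne_nil h, ?_⟩
    have h2 := hAns.length_le (N := s ^ 2) h fun F hF =>
      (Finset.card_le_card hF.1).trans ((List.toFinset_card_le L).trans hL')
    simp only [queryWord, List.length_append, List.length_cons, length_encPoints] at h2 ⊢
    omega
  · rintro S (⟨L, ⟨hL, hL', W, hW, hLW⟩, hhead, hout⟩ | ⟨hout, h0, hv⟩)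
    · rw [hout]
      -- The queried set lies in a `W°`-set, so anchored solutions solve the original problem.
      exact hAns.mono (hO L hL hL') hhead fun F hF =>
        ⟨⟨W, hW, fun z hz => hLW z (List.mem_toFinset.1 (hF.1 hz))⟩, hF.2⟩
    · rw [hout]
      refine hAns.zero ?_
      rintro ⟨F, hFW, hR⟩
      rcases F.eq_empty_or_nonempty with rfl | hF
      -- The empty solution has no maximisers and yields no tuple; the extra query takes care of it.
      · exact hAns.not_exists (hO [] List.nodup_nil (by simp)) h0 ⟨∅, by simp, hR⟩
      · have hFgrid : ∀ f ∈ F, ∃ i < NA, ∃ j < NB, (VA i ∧ VB j) ∧ t + ratPoint ζ (g i j) = f := by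
          intro f hf
          obtain ⟨i, hi, hVi, hfi⟩ := hRA F hR f hf
          obtain ⟨j, hj, hVj, hfj⟩ := hRB F hR f hf
          exact ⟨i, hi, j, hj, ⟨hVi, hVj⟩,
            eq_of_mem_lines hpar (hptA i j) (hptB i j) hfi hfj⟩
        obtain ⟨v, hvb, hvf, hsel⟩ := exists_feasible_of_isWSet hn hζ hne hF hFW hFgrid
        refine hAns.not_exists (hO _ (hnodup v) (hcard v)) (hv v hvb hvf) ⟨F, ?_, hR⟩
        intro f hf
        rw [List.mem_toFinset]
        exact mem_pointList.2 (hsel f hf)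

end ModelSet

namespace ModelSet

open RealRAM

/-! ### Reading the data of consistency and reconstruction -/

theorem _root_.RealRAM.Stored.block {α : Type*} {f : ℕ → ℝ} {off k : ℕ} {L : List α} {e : α → List ℝ}
    (hk : ∀ x, (e x).length = k) (h : Stored f off (L.flatMap e)) {i : ℕ} (hi : i < L.length) :
    Stored f (off + k * i) (e L[i]) := by
  induction L generalizing off i with
  | nil => simp at hi
  | cons x t ih =>
    rw [List.flatMap_cons, stored_append, hk] at h
    cases i with
    | zero => simpa using h.1
    | succ i =>
      have := ih h.2 (i := i) (by simpa using hi)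
      rw [List.getElem_cons_succ, show off + k * (i + 1) = off + k + k * i by ring]
      exact this

theorem length_encCoords {d : ℕ} (c : Fin d → ℤ) : (encCoords c).length = d := by
  simp [encCoords]

theorem _root_.RealRAM.Stored.encCoords {f : ℕ → ℝ} {off d : ℕ} {c : Fin d → ℤ}
    (h : Stored f off (encCoords c)) (j : Fin d) : f (off + j) = c j := by
  rw [h j (by simp [ModelSet.encCoords])]
  simp [ModelSet.encCoords]

theorem length_flatMap_of_length {α : Type*} {k : ℕ} (L : List α) {e : α → List ℝ}
    (hk : ∀ x, (e x).length = k) : (L.flatMap e).length = k * L.length := by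
  induction L with
  | nil => simp
  | cons x t ih => simp [ih, hk]; ring

theorem length_encCoordData {d : ℕ} (L : List ((Fin d → ℤ) × ℕ)) :
    (encCoordData L).length = 1 + (d + 1) * L.length := by
  rw [encCoordData, List.length_cons, length_flatMap_of_length L (k := d + 1)]
  · ring
  · simp [length_encCoords]

theorem length_encData (L : List (ℂ × ℕ)) : (encData L).length = 1 + 3 * L.length := by
  rw [encData, List.length_cons, length_flatMap_of_length L (k := 3)]
  · ring
  · simp

/-- Address of entry `c` of the block with number `r` behind the head cell `P`. -/
def entry (d : ℕ) (P : NExp) (c r : ℕ) : RExp :=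
  .cell 0 (.add (.add (.add P (.const 1)) (.mul (.const (d + 1)) (.reg r))) (.const c))

theorem eval_entry {d c r : ℕ} {P : NExp} {σ : State} :
    (entry d P c r).eval σ = σ.mem 0 (P.eval σ + 1 + (d + 1) * σ.reg r + c) := rfl

theorem eval_entry_coord {d r p : ℕ} {P : NExp} {σ : State} {L : List ((Fin d → ℤ) × ℕ)}
    (hp : P.eval σ = p) (h : Stored (σ.mem 0) p (encCoordData L)) (hr : σ.reg r < L.length)
    (c : Fin d) : (entry d P c r).eval σ = L[σ.reg r].1 c := by
  rw [encCoordData, stored_cons] at h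
  have h1 := h.2.block (k := d + 1) (by simp [length_encCoords]) hr
  rw [eval_entry, hp]
  exact (stored_append.1 h1).1.encCoords c

theorem eval_entry_value {d r p : ℕ} {P : NExp} {σ : State} {L : List ((Fin d → ℤ) × ℕ)}
    (hp : P.eval σ = p) (h : Stored (σ.mem 0) p (encCoordData L)) (hr : σ.reg r < L.length) :
    (entry d P d r).eval σ = L[σ.reg r].2 := by
  rw [encCoordData, stored_cons] at h
  have h1 := h.2.block (k := d + 1) (by simp [length_encCoords]) hr
  rw [eval_entry, hp]
  have h2 := (stored_append.1 h1).2
  rwa [length_encCoords, stored_singleton] at h2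

/-- Translate the X-ray data in one direction, from coordinates to points of the plane. -/
def parseDirection (ζ : ℂ) (d : ℕ) : Prog :=
  .seq (.setReg 7 (.const 0))
  (.seq (.setCell 2 (.reg 2) (.cell 0 (.reg 5)))
  -- The length is stored as a real number, which cannot be moved to an index register directly.
  -- Register 7 counts up to it and thereby recovers it.
  (.seq (.loop (.realLt (.ofNat (.reg 7)) (.cell 0 (.reg 5)))
    (.seq (.setCell 2 (.add (.add (.reg 2) (.const 1)) (.mul (.const 3) (.reg 7)))
      (reExp ζ fun c : Fin d => entry d (.reg 5) c 7))
    (.seq (.setCell 2 (.add (.add (.reg 2) (.const 2)) (.mul (.const 3) (.reg 7)))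
      (imExp ζ fun c : Fin d => entry d (.reg 5) c 7))
    (.seq (.setCell 2 (.add (.add (.reg 2) (.const 3)) (.mul (.const 3) (.reg 7)))
      (entry d (.reg 5) d 7))
    (.setReg 7 (.add (.reg 7) (.const 1)))))))
  (.seq (.setReg 2 (.add (.add (.reg 2) (.const 1)) (.mul (.const 3) (.reg 7))))
  (.seq (.setReg 5 (.add (.add (.reg 5) (.const 1)) (.mul (.const (d + 1)) (.reg 7))))
  -- By truncated subtraction this is the maximum of registers 6 and 7, so register 6 ends up with
  -- the value of `s`.
  (.setReg 6 (.add (.reg 6) (.sub (.reg 7) (.reg 6))))))))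

/-- Lines through points of `ℤ[ζ]`, given by points of the plane. -/
def planeData (ζ : ℂ) {d : ℕ} (L : List ((Fin d → ℤ) × ℕ)) : List (ℂ × ℕ) :=
  L.map fun e => (ofCoords ζ e.1, e.2)

variable {O : List ℝ → List ℝ} {G : List ℝ → Prop} {B : ℕ} {σ : State}

theorem ok_parseDirection {ζ : ℂ} {d : ℕ} {L : List ((Fin d → ℤ) × ℕ)} {pre : List ℝ}
    (hL : Stored (σ.mem 0) (σ.reg 5) (encCoordData L)) (hpre : Stored (σ.mem 2) 0 pre)
    (h2 : σ.reg 2 = pre.length) (hB : L.length ≤ B) :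
    Ok O G B (parseDirection ζ d) σ fun σ' =>
      (∀ a, a ≠ 2 → σ'.mem a = σ.mem a) ∧ Stored (σ'.mem 2) 0 (pre ++ encData (planeData ζ L)) ∧
      σ'.reg 2 = (pre ++ encData (planeData ζ L)).length ∧
      σ'.reg 5 = σ.reg 5 + (encCoordData L).length ∧ σ'.reg 7 = L.length ∧
      σ'.reg 6 = max (σ.reg 6) L.length ∧
      ∀ r, r ≠ 2 → r ≠ 5 → r ≠ 6 → r ≠ 7 → σ'.reg r = σ.reg r := by
  set P := σ.reg 5
  have hcount : σ.mem 0 P = L.length := by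
    rw [encCoordData, stored_cons] at hL
    exact hL.1
  refine .seq (.setReg (.seq (.setCell (.seq ?_))))
  refine .loop (N := L.length) (fun i σ' => (∀ a, a ≠ 2 → σ'.mem a = σ.mem a) ∧
    Stored (σ'.mem 2) 0 (pre ++ [(L.length : ℝ)] ++
      ((planeData ζ L).take i).flatMap fun e => [e.1.re, e.1.im, (e.2 : ℝ)]) ∧ σ'.reg 7 = i ∧
    ∀ r, r ≠ 7 → σ'.reg r = σ.reg r) hB ?_ ?_ ?_ ?_
  · refine ⟨fun a ha => by simp [ha], ?_, by simp [NExp.eval], fun r hr => by simp [hr]⟩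
    rw [List.take_zero, List.flatMap_nil, List.append_nil]
    simp only [NExp.eval, RExp.eval, State.setCell_mem, if_true, State.setReg_mem]
    have : (σ.setReg 7 0).reg 5 = P := by simp [P]
    rw [this, hcount]
    exact hpre.snoc (by simp [h2])
  · rintro i σ' - ⟨h0, -, h7, hr⟩
    simp only [Test.holds, RExp.eval, NExp.eval, h7, hr 5 (by simp), h0 0 (by simp)]
    rw [show σ.mem 0 (σ.reg 5) = L.length from hcount]
    exact Nat.cast_lt
  · rintro i σ1 hi ⟨h0, h2s, h7, hr⟩
    have hP : (NExp.reg 5).eval σ1 = P := hr 5 (by simp)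
    have h7L : σ1.reg 7 < L.length := h7 ▸ hi
    set x := L[i]
    have hx : L[σ1.reg 7] = x := by simp only [h7, x]
    set pw := pre ++ [(L.length : ℝ)] ++
      ((planeData ζ L).take i).flatMap fun e => [e.1.re, e.1.im, (e.2 : ℝ)]
    have hlen : pw.length = pre.length + 1 + 3 * i := by
      simp only [pw, List.length_append, List.length_singleton]
      rw [length_flatMap_of_length _ (k := 3) (by simp)]
      simp [planeData, hi.le]
    have hcoord : ∀ σ2 : State, σ2.mem 0 = σ1.mem 0 → σ2.reg = σ1.reg → ∀ c : Fin d,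
        (entry d (.reg 5) c 7).eval σ2 = x.1 c := by
      intro σ2 hm hr2 c
      have h := eval_entry_coord hP (L := L) (by rw [h0 0 (by simp)]; exact hL) h7L c
      rw [hx] at h
      rw [← h, eval_entry, eval_entry, hm]
      simp only [NExp.eval, hr2]
    have hval : ∀ σ2 : State, σ2.mem 0 = σ1.mem 0 → σ2.reg = σ1.reg →
        (entry d (.reg 5) d 7).eval σ2 = x.2 := by
      intro σ2 hm hr2
      have h := eval_entry_value hP (L := L) (by rw [h0 0 (by simp)]; exact hL) h7L
      rw [hx] at h
      rw [← h, eval_entry, eval_entry, hm]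
      simp only [NExp.eval, hr2]
    have hr2 : σ1.reg 2 = pre.length := (hr 2 (by simp)).trans h2
    refine .seq (.setCell_eq (k := pre.length + 1 + 3 * i) (by simp only [NExp.eval, hr2, h7])
      (eval_reExp_int (hcoord _ rfl rfl)) (.seq (.setCell_eq (k := pre.length + 2 + 3 * i)
      (by simp only [NExp.eval, State.setCell_reg, hr2, h7])
      (eval_imExp_int (hcoord _ (by simp) rfl)) (.seq (.setCell_eq (k := pre.length + 3 + 3 * i)
      (by simp only [NExp.eval, State.setCell_reg, hr2, h7])
      (hval _ (by simp) rfl) (.setReg_eq (v := i + 1)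
      (by simp only [NExp.eval, State.setCell_reg, h7]) ?_))))))
    refine ⟨fun a ha => by simp [ha, h0 a ha], ?_, by simp, fun r hr7 => by simp [hr7, hr r hr7]⟩
    have htake : (planeData ζ L).take (i + 1) =
        (planeData ζ L).take i ++ [(ofCoords ζ x.1, x.2)] := by
      rw [List.take_succ_eq_append_getElem (by simpa [planeData] using hi)]
      simp [planeData, x]
    rw [htake, List.flatMap_append, ← List.append_assoc]
    simp only [State.setReg_mem, State.setCell_mem, if_true]
    have h1 := ((h2s.snoc (x := (ofCoords ζ x.1).re) (i := pre.length + 1 + 3 * i)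
      (by omega)).snoc (x := (ofCoords ζ x.1).im) (i := pre.length + 2 + 3 * i)
      (by rw [List.length_append, hlen, List.length_singleton]; omega)).snoc
      (x := (x.2 : ℝ)) (i := pre.length + 3 + 3 * i)
      (by simp only [List.length_append, hlen, List.length_singleton]; omega)
    simpa [pw] using h1
  · rintro σ1 ⟨h0, h2s, h7, hr⟩
    refine .seq (.setReg (.seq (.setReg (.setReg ?_))))
    rw [List.take_of_length_le (by simp [planeData])] at h2s
    have hpl : (planeData ζ L).length = L.length := by simp [planeData]
    refine ⟨h0, ?_, ?_, ?_, ?_, ?_, ?_⟩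
    · simpa [encData, hpl] using h2s
    · simp [NExp.eval, h7, hr, h2, length_encData, hpl]; omega
    · simp [NExp.eval, h7, hr, length_encCoordData, P]; omega
    · simp [h7]
    · simp [NExp.eval, h7, hr]; omega
    · intro r h2 h5 h6 h7
      simp [h2, h5, h6, hr r h7]

/-- Repetition of a program. -/
def repeatProg (p : Prog) : ℕ → Prog
  | 0 => .skip
  | k + 1 => .seq p (repeatProg p k)

theorem ok_repeat_parseDirection {ζ : ℂ} {d : ℕ} (Ls : List (List ((Fin d → ℤ) × ℕ))) :
    ∀ {σ : State} {pre : List ℝ},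
    Stored (σ.mem 0) (σ.reg 5) (Ls.map encCoordData).flatten → Stored (σ.mem 2) 0 pre →
    σ.reg 2 = pre.length → (∀ L ∈ Ls, L.length ≤ B) →
    Ok O G B (repeatProg (parseDirection ζ d) Ls.length) σ fun σ' =>
      (∀ a, a ≠ 2 → σ'.mem a = σ.mem a) ∧
      Stored (σ'.mem 2) 0 (pre ++ (Ls.map fun L => encData (planeData ζ L)).flatten) ∧
      σ'.reg 2 = (pre ++ (Ls.map fun L => encData (planeData ζ L)).flatten).length ∧
      (∀ x, σ'.reg 6 ≤ x ↔ σ.reg 6 ≤ x ∧ ∀ L ∈ Ls, L.length ≤ x) ∧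
      ∀ r, r ≠ 2 → r ≠ 5 → r ≠ 6 → r ≠ 7 → σ'.reg r = σ.reg r := by
  induction Ls with
  | nil =>
    intro σ pre _ hpre h2 _
    exact .skip ⟨fun _ _ => rfl, by simpa, by simpa, by simp, fun _ _ _ _ _ => rfl⟩
  | cons L t ih =>
    intro σ pre h0 hpre h2 hB
    rw [List.map_cons, List.flatten_cons, stored_append] at h0
    refine .seq ((ok_parseDirection h0.1 hpre h2 (hB L (by simp))).mono ?_)
    rintro σ1 ⟨h1m, h1s, h12, h15, -, h16, h1r⟩
    refine (ih (σ := σ1) ?_ h1s h12 fun L hL => hB L (by simp [hL])).mono ?_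
    · rw [h1m 0 (by simp), h15]
      exact h0.2
    · rintro σ2 ⟨h2m, h2s, h22, h26, h2r⟩
      refine ⟨fun a ha => by rw [h2m a ha, h1m a ha], by simpa using h2s, by simpa using h22, ?_, ?_⟩
      · intro x
        rw [h26, h16]
        simp [and_assoc]
      · intro r h2 h5 h6 h7
        rw [h2r r h2 h5 h6 h7, h1r r h2 h5 h6 h7]

/-- Translate X-ray data in `m + 2` directions, from coordinates to points of the plane. -/
def parseData (ζ : ℂ) (d m : ℕ) : Prog :=
  -- Cell 0 of the query is left free for `s`, which is known only after all directions have been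
  -- read.
  .seq (.setReg 2 (.const 1))
  (.seq (parseDirection ζ d)
  (.seq (.setReg 3 (.reg 7))
  -- Register 8 remembers where the data of the second direction begin.
  (.seq (.setReg 8 (.reg 5))
  (.seq (parseDirection ζ d)
  (.seq (.setReg 4 (.reg 7))
  (.seq (repeatProg (parseDirection ζ d) m)
  (.setCell 2 (.const 0) (.ofNat (.reg 6)))))))))

theorem ok_parseData {ζ : ℂ} {d m : ℕ} {L : Fin (m + 2) → List ((Fin d → ℤ) × ℕ)} {w : List ℝ}
    (hw : w = (List.ofFn fun i => encCoordData (L i)).flatten) (hB : ∀ i, (L i).length ≤ B)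
    {s : ℕ} (hs : s = Finset.univ.sup fun i => (L i).length) {pre : List ℝ}
    (hpre : pre = (s : ℝ) :: (List.ofFn fun i => encData (planeData ζ (L i))).flatten) :
    Ok O G B (parseData ζ d m) (State.init w) fun S =>
      (∀ a, a ≠ 2 → S.mem a = (State.init w).mem a) ∧ Stored (S.mem 2) 0 pre ∧
      S.reg 2 = pre.length ∧ S.reg 3 = (L 0).length ∧ S.reg 4 = (L 1).length ∧
      S.reg 8 = (encCoordData (L 0)).length := by
  set Ls := List.ofFn fun i : Fin m => L i.succ.succ
  have hsplit : List.ofFn L = L 0 :: L 1 :: Ls := by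
    rw [List.ofFn_succ, List.ofFn_succ]; rfl
  have hofFn : ∀ f : List ((Fin d → ℤ) × ℕ) → List ℝ,
      (List.ofFn fun i => f (L i)).flatten = f (L 0) ++ (f (L 1) ++ (Ls.map f).flatten) := by
    intro f
    rw [← Function.comp_def f L, ← List.map_ofFn, hsplit]
    simp
  have hin := stored_init w
  nth_rw 2 [hw] at hin
  rw [hofFn, stored_append, stored_append, zero_add] at hin
  refine .seq (.setReg_eq (v := 1) rfl (.seq ((ok_parseDirection
    (σ := (State.init w).setReg 2 1) (L := L 0) (pre := [0]) hin.1 ?_ ?_ (hB 0)).mono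
    ?_)))
  · rw [stored_singleton]; rfl
  · simp
  rintro σ1 ⟨h1m, h1s, h12, h15, h17, h16, h1r⟩
  have h15' : σ1.reg 5 = (encCoordData (L 0)).length := by simpa [State.init] using h15
  refine .seq (.setReg_eq (v := (L 0).length) h17 (.seq (.setReg_eq
    (v := (encCoordData (L 0)).length) (by simpa [NExp.eval] using h15') (.seq
    ((ok_parseDirection (σ := (σ1.setReg 3 (L 0).length).setReg 8 (encCoordData (L 0)).length)
      (L := L 1) ?_ h1s ?_ (hB 1)).mono ?_)))))
  · simp only [State.setReg_mem, h1m 0 (by simp)]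
    simpa [h15, NExp.eval, State.init] using hin.2.1
  · simpa using h12
  rintro σ2 ⟨h2m, h2s, h22, h25, h27, h26, h2r⟩
  refine .seq (.setReg (.seq ?_))
  have hLs : Ls.length = m := by simp [Ls]
  have hrep : repeatProg (parseDirection ζ d) m = repeatProg (parseDirection ζ d) Ls.length := by
    rw [hLs]
  rw [hrep]
  refine (ok_repeat_parseDirection Ls (σ := σ2.setReg 4 ((NExp.reg 7).eval σ2)) ?_ h2s ?_ ?_).mono ?_
  · simp only [State.setReg_mem, h2m 0 (by simp), h1m 0 (by simp)]
    simpa [h25, h15, NExp.eval, State.init, add_assoc] using hin.2.2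
  · simpa using h22
  · intro L' hL'
    obtain ⟨i, rfl⟩ := List.mem_ofFn.1 hL'
    exact hB _
  rintro σ3 ⟨h3m, h3s, h32, h36, h3r⟩
  have hs3 : σ3.reg 6 = s := by
    rw [hs]
    -- The maximum in register 6 and the supremum `s` are identified by their upper bounds.
    refine eq_of_forall_ge_iff fun x => ?_
    rw [h36, Finset.sup_le_iff]
    have : (∀ i ∈ Finset.univ, (L i).length ≤ x) ↔ (L 0).length ≤ x ∧ (L 1).length ≤ x ∧
        ∀ i : Fin m, (L i.succ.succ).length ≤ x := by
      simp only [Finset.mem_univ, true_imp_iff, Fin.forall_fin_succ (n := m + 1),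
        Fin.forall_fin_succ (n := m)]
      rfl
    rw [this]
    simp [h26, h16, State.init, and_assoc, Ls]
  refine .setCell ⟨?_, ?_, ?_, ?_, ?_, ?_⟩
  · intro a ha
    simp [ha, h3m a ha, h2m a ha, h1m a ha]
  · rw [hpre, hofFn (fun L => encData (planeData ζ L)), ← List.singleton_append, stored_append,
      stored_singleton]
    rw [List.append_assoc, List.append_assoc, stored_append] at h3s
    simp only [NExp.eval, RExp.eval, hs3, State.setCell_mem, if_true]
    exact ⟨by simp, h3s.2.update _ (by simp)⟩
  · rw [State.setCell_reg, h32, hpre, hofFn (fun L => encData (planeData ζ L))]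
    simp
  · simp [h3r, h2r, NExp.eval]
  · simp [h3r, NExp.eval, h27]
  · simp [h3r, h2r, NExp.eval]

end ModelSet

/-! ### Consistency and reconstruction -/

namespace ModelSet

open RealRAM

theorem ListsData.mem_support {o : ℂ} {L : List (ℂ × ℕ)} {p : LineIn o → ℕ} (h : ListsData L p)
    {ℓ : LineIn o} : p ℓ ≠ 0 ↔ ∃ e ∈ L, lineThrough e.1 o = ℓ := by
  constructor
  · intro hp
    obtain ⟨e, he, hl, -⟩ := (h.2.2 ℓ _ hp).1 rfl
    exact ⟨e, he, hl⟩
  · rintro ⟨e, he, hl⟩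
    rw [(h.2.2 ℓ _ (h.2.1 e he)).2 ⟨e, he, hl, rfl⟩]
    exact h.2.1 e he

theorem ListsData.ncard_support {o : ℂ} {L : List (ℂ × ℕ)} {p : LineIn o → ℕ}
    (h : ListsData L p) : (Function.support p).ncard = L.length := by
  classical
  have hs : Function.support p = ((L.map fun e => lineThrough e.1 o).toFinset : Set (LineIn o)) := by
    ext ℓ
    rw [Function.mem_support, h.mem_support]
    simp
  rw [hs, Set.ncard_coe_finset, List.toFinset_card_of_nodup h.1, List.length_map]

theorem length_flatten_le {α : Type*} {Ls : List (List α)} {k : ℕ}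
    (h : ∀ L ∈ Ls, L.length ≤ k) : Ls.flatten.length ≤ Ls.length * k := by
  induction Ls with
  | nil => simp
  | cons L t ih =>
    have h1 := h L (by simp)
    have h2 := ih fun L' hL' => h L' (by simp [hL'])
    rw [List.flatten_cons, List.length_append, List.length_cons, add_mul, one_mul]
    omega

theorem enumerates_toFinset [DecidableEq ℂ] {L : List ℂ} (h : L.Nodup) :
    Enumerates L L.toFinset :=
  ⟨h, fun _ => List.mem_toFinset.symm⟩

/-- The lines of X-ray data that are given by a list are distinct. -/
theorem ListsData.index_injective {ζ o : ℂ} {d : ℕ} {L : List ((Fin d → ℤ) × ℕ)}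
    {p : LineIn o → ℕ} (h : ListsData (planeData ζ L) p) {i i' : ℕ} (hi : i < L.length)
    (hi' : i' < L.length) (hl : lineThrough (0 + ofCoords ζ (L.getD i (0, 0)).1) o =
      lineThrough (0 + ofCoords ζ (L.getD i' (0, 0)).1) o) : i = i' := by
  refine (h.1.getElem_inj_iff (hi := by simpa [planeData] using hi)
    (hj := by simpa [planeData] using hi')).1 ?_
  simpa [planeData, hi, hi'] using hl

theorem ListsData.exists_index {ζ o : ℂ} {d : ℕ} {L : List ((Fin d → ℤ) × ℕ)}
    {p : LineIn o → ℕ} (h : ListsData (planeData ζ L) p) {F : Finset ℂ} (hF : xray o F = p) {f : ℂ}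
    (hf : f ∈ F) : ∃ i < L.length, True ∧ f ∈ line (0 + ofCoords ζ (L.getD i (0, 0)).1) o := by
  have h1 : p (lineThrough f o) ≠ 0 := by
    rw [← hF, xray_ne_zero_iff]
    exact ⟨f, hf, mem_line_self f o⟩
  obtain ⟨e, he, hl⟩ := h.mem_support.1 h1
  obtain ⟨x, hx, rfl⟩ := List.mem_map.1 he
  obtain ⟨i, hi, rfl⟩ := List.getElem_of_mem hx
  refine ⟨i, hi, trivial, ?_⟩
  rw [← lineThrough_eq_iff, ← hl]
  simp [hi]

/-- Consistency and reconstruction: find a solution by means of an oracle for solutions in finite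
sets. -/
theorem polySolvable_moduleData {n : ℕ} (hn : 0 < n) {ζ : ℂ} (hζ : IsPrimitiveRoot ζ n) {k l : ℕ}
    {σ : Fin k → (fieldK ζ ≃ₐ[ℚ] fieldK ζ)} {A : Matrix (Fin l) (Fin k × Fin 2) ℝ} {b : Fin l → ℝ}
    (hne : (interior (polyhedron A b)).Nonempty) {m : ℕ} {o : Fin (m + 2) → ℂ}
    (ho : ∀ i, o i ∈ ringO ζ ∧ o i ≠ 0) (hpar : ∀ i j, i ≠ j → ∀ r : ℝ, o i ≠ (r : ℂ) * o j)
    {Ans : List ℝ → (Finset ℂ → Prop) → Prop} (hAns : AnswerFormat Ans) :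
    PolySolvableWithOracle
      { Inst := ModuleData ζ o
        size := fun I => maxSupport I.p
        Describes := fun w I => I.IsDescribed (Nat.totient n) w
        Answers := fun w I => Ans w (IsSolution σ (polyhedron A b) I.p) }
      { Inst := AnchoredData o
        size := fun J => J.s
        Describes := fun w J => J.IsDescribed w
        Answers := fun w J => Ans w J.IsSolution } := by
  classical
  have hpar' := hpar 0 1 (by simp)
  obtain ⟨M, hM⟩ := exists_gridMatrix hn hζ (ringO_le_fieldK (ho 0).1) (ringO_le_fieldK (ho 1).1)
    (ho 1).2 hpar'
  obtain ⟨Λ, hΛ⟩ := exists_feasibility_test A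
  set pA : Fin (Nat.totient n) → ℕ → RExp := fun c r => entry (Nat.totient n) (.const 0) c r
  set pB : Fin (Nat.totient n) → ℕ → RExp := fun c r => entry (Nat.totient n) (.reg 8) c r
  refine polySolvable_of_ok (prog := .seq (parseData ζ (Nat.totient n) m)
    (gridSearch ζ σ A b M Λ pA pB (.all []) (.const 0) (.const 0)))
    -- Up to constants, the first term is the length of the data part of a query; `4 * (s * s)`
    -- covers the candidates in the query and the points in the answer.
    (f := fun s => (m + 2) * (1 + 3 * s) + 4 * (s * s) + s + 3) ?_ ?_
  · exact (((PolyBounded.const _).mul ((PolyBounded.const _).add ((PolyBounded.const _).mul .id))).add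
      ((PolyBounded.const _).mul (PolyBounded.id.mul .id))).add .id |>.add (.const _)
  rintro O hO I w ⟨L, hL, hw⟩
  simp only
  set s := maxSupport I.p
  set B := (m + 2) * (1 + 3 * s) + 4 * (s * s) + s + 3
  have hncard : ∀ i, (Function.support (I.p i)).ncard = (L i).length := fun i => by
    rw [(hL i).ncard_support, List.length_map]
  have hs : s = Finset.univ.sup fun i => (L i).length := by
    simp only [s, maxSupport, hncard]
  have hLs : ∀ i, (L i).length ≤ s := fun i => by
    rw [hs]
    exact Finset.le_sup (f := fun i => (L i).length) (Finset.mem_univ i)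
  set pre := (s : ℝ) :: (List.ofFn fun i => encData (planeData ζ (L i))).flatten with hpre
  have hdesc : ∀ (Lp : List ℂ), Lp.Nodup → ∀ h : Lp.length ≤ s ^ 2,
      AnchoredData.IsDescribed (queryWord pre Lp) (o := o)
        ⟨s, I.p, I.finite, fun i => (hncard i).trans_le (hLs i), Lp.toFinset,
          (List.toFinset_card_le Lp).trans h⟩ := by
    intro Lp hnd h
    exact ⟨fun i => planeData ζ (L i), Lp, hL, enumerates_toFinset hnd, rfl⟩
  have hprelen : pre.length ≤ 1 + (m + 2) * (1 + 3 * s) := by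
    rw [hpre, List.length_cons, add_comm]
    refine Nat.add_le_add_left ((length_flatten_le (k := 1 + 3 * s) ?_).trans ?_) 1
    · intro x hx
      obtain ⟨i, rfl⟩ := List.mem_ofFn.1 hx
      have := hLs i
      rw [length_encData, planeData, List.length_map]
      omega
    · rw [List.length_ofFn]
  refine .seq ((ok_parseData hw (fun i => (hLs i).trans (by omega)) hs hpre).mono ?_)
  rintro S ⟨hSm, hSpre, hS2, hS3, hS4, hS8⟩
  have hbase : Base S pre (L 0).length (L 1).length S :=
    ⟨fun _ _ _ => rfl, fun _ _ _ _ => rfl, hSpre, hS2, hS3, hS4⟩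
  have hin := stored_init w
  nth_rw 2 [hw] at hin
  rw [List.ofFn_succ, List.ofFn_succ, List.flatten_cons, List.flatten_cons, stored_append,
    stored_append, zero_add] at hin
  -- The lists name each supporting line once, so every index counts as marked.
  refine (((ok_gridSearch hn hζ hne hpar' hM hΛ (s := s) (B := B) (O := O) (t := 0)
    (ca := fun i => ((L 0).getD i (0, 0)).1) (cb := fun i => ((L 1).getD i (0, 0)).1)
    (VA := fun _ => True) (VB := fun _ => True) (R := fun F => ∀ i, xray (o i) F = I.p i)
    hbase ?_ ?_ ?_ ?_ ?_ ?_ ?_ ?_ ?_ ?_ ?_ ?_ ?_ hAns ?_ ?_ ?_).weaken ?_).mono ?_)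
  · rw [hSm 1 (by simp)]; rfl
  · intro S' hS' c r hr
    rw [eval_entry_coord (p := 0) (L := L 0) rfl _ hr]
    · simp [hr]
    · rw [hS'.mem 0 (by simp) (by simp) (by simp), hSm 0 (by simp)]
      exact hin.1
  · intro S' hS' c r hr
    rw [eval_entry_coord (p := (encCoordData (L 0)).length) (L := L 1) _ _ hr]
    · simp [hr]
    · exact (hS'.reg 8 (by simp) (by simp)).trans hS8
    · rw [hS'.mem 0 (by simp) (by simp) (by simp), hSm 0 (by simp)]
      exact hin.2.1
  · intro S' _ _ _
    simp
  · intro S' _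
    simp [RExp.eval]
  · intro S' _
    simp [RExp.eval]
  · intro i hi i' hi' _ _ h
    exact (hL 0).index_injective hi hi' h
  · intro i hi i' hi' _ _ h
    exact (hL 1).index_injective hi hi' h
  · simpa using hLs 0
  · simpa using hLs 1
  · exact (hLs 0).trans (by omega)
  · exact (hLs 1).trans (by omega)
  · rw [sq]
    omega
  · intro Lp hnd hlen
    exact hO _ _ (hdesc Lp hnd hlen)
  · intro F hF f hf
    exact (hL 0).exists_index (hF 0) hf
  · intro F hF f hf
    exact (hL 1).exists_index (hF 1) hf
  · rintro q ⟨Lp, ⟨hnd, hlen, -⟩, rfl⟩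
    exact ⟨_, hdesc Lp hnd hlen, le_rfl⟩
  · exact fun _ h => h

end ModelSet

namespace ModelSet

open RealRAM

/-! ### Reading the data of uniqueness -/

/-- Coordinate `c` of the point with number `r` of a set. -/
def pointEntry (d c r : ℕ) : RExp :=
  .cell 0 (.add (.add (.const 3) (.mul (.const d) (.reg r))) (.const c))

/-- The coordinates `ca i`, `i < N`, are stored in the input. -/
def HoldsPoints {d : ℕ} (N : ℕ) (ca : ℕ → Fin d → ℤ) (f : ℕ → ℝ) : Prop :=
  ∀ i < N, ∀ c : Fin d, f (3 + d * i + c) = ca i c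

theorem eval_pointEntry {d N r : ℕ} {ca : ℕ → Fin d → ℤ} {σ : State}
    (h : HoldsPoints N ca (σ.mem 0)) (hr : σ.reg r < N) (c : Fin d) :
    (pointEntry d c r).eval σ = ca (σ.reg r) c :=
  h _ hr c

/-- Copy the points to the query. -/
def parsePoints (ζ : ℂ) (d : ℕ) : Prog :=
  .seq (.setCell 2 (.const 1) (.cell 0 (.const 2)))
  (.seq (.setReg 3 (.const 0))
  (.seq (.loop (.realLt (.ofNat (.reg 3)) (.cell 0 (.const 2)))
    (.seq (.setCell 2 (.add (.const 2) (.mul (.const 2) (.reg 3)))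
      (.add (.cell 0 (.const 0)) (reExp ζ fun c : Fin d => pointEntry d c 3)))
    (.seq (.setCell 2 (.add (.const 3) (.mul (.const 2) (.reg 3)))
      (.add (.cell 0 (.const 1)) (imExp ζ fun c : Fin d => pointEntry d c 3)))
    (.setReg 3 (.add (.reg 3) (.const 1))))))
  (.seq (.setReg 4 (.reg 3))
  (.setReg 2 (.add (.const 2) (.mul (.const 2) (.reg 3)))))))

/-- The test whether the points with numbers in the registers `8` and `10` are on a line in
direction `o`. -/
def sameLineTest (ζ : ℂ) (d : ℕ) (o : ℂ) : Test :=
  -- The difference of the points times `ō` has to be real. The translation `t` cancels, so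
  -- coordinates suffice.
  .realEq (formExp (fun j : Fin d => (ζ ^ (j : ℕ) * star o).im)
    fun c => .sub (pointEntry d c 8) (pointEntry d c 10)) (.const 0)

/-- Mark, in array `a`, the points that are the first ones on their lines in direction `o`. -/
def markFirst (ζ : ℂ) (d a : ℕ) (o : ℂ) : Prog :=
  .seq (.setReg 7 (.const 0))
  (.seq (.count 8 (.reg 3)
    -- Register 9 is a flag, cleared when an earlier point on the same line is met; register 7 sums
    -- the flags and so counts the lines.
    (.seq (.setReg 9 (.const 1))
    (.seq (.count 10 (.reg 8) (.ite (sameLineTest ζ d o) (.setReg 9 (.const 0)) .skip))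
    (.seq (.setCell a (.reg 8) (.ofNat (.reg 9)))
    (.setReg 7 (.add (.reg 7) (.reg 9)))))))
  (.setReg 6 (.add (.reg 6) (.sub (.reg 7) (.reg 6)))))

/-- Mark the first points on the lines in several directions. -/
def markAll (ζ : ℂ) (d : ℕ) : ℕ → List ℂ → Prog
  | _, [] => .skip
  | a, o :: os => .seq (markFirst ζ d a o) (markAll ζ d (a + 1) os)

/-- Prepare the queries for the uniqueness problem. -/
def parseSet (ζ : ℂ) (d : ℕ) (os : List ℂ) : Prog :=
  .seq (parsePoints ζ d) (.seq (markAll ζ d 10 os) (.setCell 2 (.const 0) (.ofNat (.reg 6))))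

/-- Since `o ō` is a positive real, `z - w` is a real multiple of `o` exactly if `(z - w) ō` is
real. -/
theorem mem_line_iff_im {o z w : ℂ} (ho : o ≠ 0) : z ∈ line w o ↔ ((z - w) * star o).im = 0 := by
  have hoo : o * star o = ((Complex.normSq o : ℝ) : ℂ) := Complex.mul_conj o
  constructor
  · rintro ⟨r, rfl⟩
    rw [add_sub_cancel_left, mul_assoc, hoo, ← Complex.ofReal_mul, Complex.ofReal_im]
  · intro h
    have hn : (Complex.normSq o : ℂ) ≠ 0 := by
      exact_mod_cast (Complex.normSq_pos.2 ho).ne'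
    refine ⟨((z - w) * star o).re / Complex.normSq o, ?_⟩
    have h1 : (((z - w) * star o).re : ℂ) = (z - w) * star o := Complex.ext (by simp) (by
      rw [h, Complex.ofReal_im])
    rw [Complex.ofReal_div, h1, div_mul_eq_mul_div, mul_assoc, mul_comm (star o), hoo,
      mul_div_cancel_right₀ _ hn]
    ring

/-- The point with number `i` is the first one on its line. -/
def IsFirst {α : Type*} (f : ℕ → α) (i : ℕ) : Prop := ∀ j < i, f j ≠ f i

open Classical in
-- Every value is attained first at exactly one index. This lets the program compute the number of
-- lines in each direction, and with it `s`.
theorem card_filter_isFirst {α : Type*} (f : ℕ → α) (N : ℕ) :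
    ((Finset.range N).filter (IsFirst f)).card = ((Finset.range N).image f).card := by
  have himg : (Finset.range N).image f = ((Finset.range N).filter (IsFirst f)).image f := by
    apply Finset.Subset.antisymm
    · intro x hx
      simp only [Finset.mem_image, Finset.mem_range, Finset.mem_filter] at hx ⊢
      have h := Nat.find_spec hx
      refine ⟨Nat.find hx, ⟨h.1, fun j hj hfj => Nat.find_min hx hj ⟨hj.trans h.1, ?_⟩⟩, h.2⟩
      rw [hfj, h.2]
    · exact Finset.image_subset_image (Finset.filter_subset _ _)
  rw [himg, Finset.card_image_of_injOn]
  intro i hi j hj hij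
  simp only [Finset.coe_filter, Finset.mem_range, Set.mem_ofPred_eq] at hi hj
  rcases lt_trichotomy i j with h | h | h
  · exact absurd hij (hj.2 i h)
  · exact h
  · exact absurd hij.symm (hi.2 j h)

theorem exists_isFirst {α : Type*} (f : ℕ → α) (i : ℕ) : ∃ j ≤ i, IsFirst f j ∧ f j = f i := by
  classical
  have h : ∃ j, f j = f i := ⟨i, rfl⟩
  refine ⟨Nat.find h, Nat.find_le rfl, fun j hj hfj => Nat.find_min h hj ?_, Nat.find_spec h⟩
  rw [hfj, Nat.find_spec h]

variable {O : List ℝ → List ℝ} {G : List ℝ → Prop} {B : ℕ} {σ : State}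

theorem holds_sameLineTest {ζ o t : ℂ} {d N : ℕ} (ho : o ≠ 0) {ca : ℕ → Fin d → ℤ}
    (h : HoldsPoints N ca (σ.mem 0)) (h8 : σ.reg 8 < N) (h10 : σ.reg 10 < N) :
    (sameLineTest ζ d o).holds σ ↔ lineThrough (t + ofCoords ζ (ca (σ.reg 8))) o =
      lineThrough (t + ofCoords ζ (ca (σ.reg 10))) o := by
  rw [lineThrough_eq_iff, mem_line_iff_im ho]
  simp only [sameLineTest, Test.holds, RExp.eval, eval_formExp, eval_pointEntry h h8,
    eval_pointEntry h h10]
  rw [add_sub_add_left_eq_sub, ofCoords, ofCoords, ← Finset.sum_sub_distrib, Finset.sum_mul,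
    Complex.im_sum]
  refine Eq.congr (Finset.sum_congr rfl fun j _ => ?_) rfl
  have : ((ca (σ.reg 8) j : ℂ) * ζ ^ (j : ℕ) - (ca (σ.reg 10) j : ℂ) * ζ ^ (j : ℕ)) * star o =
      (((ca (σ.reg 8) j : ℝ) - (ca (σ.reg 10) j : ℝ) : ℝ) : ℂ) * (ζ ^ (j : ℕ) * star o) := by
    push_cast
    ring
  rw [this, Complex.im_ofReal_mul, mul_comm]

open Classical in
theorem ok_markFirst {ζ o t : ℂ} {d N a : ℕ} (ho : o ≠ 0) (ha : a ≠ 0) (hN : N ≤ B)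
    {ca : ℕ → Fin d → ℤ} (h0 : HoldsPoints N ca (σ.mem 0)) (h3 : σ.reg 3 = N)
    {ℓ : ℕ → LineIn o} (hℓ : ∀ i, ℓ i = lineThrough (t + ofCoords ζ (ca i)) o) :
    Ok O G B (markFirst ζ d a o) σ fun σ' => (∀ a', a' ≠ a → σ'.mem a' = σ.mem a') ∧
      (∀ i < N, σ'.mem a i = if IsFirst ℓ i then 1 else 0) ∧
      σ'.reg 6 = max (σ.reg 6) ((Finset.range N).filter (IsFirst ℓ)).card ∧
      ∀ r, r < 6 → σ'.reg r = σ.reg r := by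
  refine .seq (.setReg_eq (v := 0) rfl (.seq ?_))
  refine .count (N := N) (fun i σ' => (∀ a', a' ≠ a → σ'.mem a' = σ.mem a') ∧
    (∀ j < i, σ'.mem a j = if IsFirst ℓ j then 1 else 0) ∧
    σ'.reg 7 = ((Finset.range i).filter (IsFirst ℓ)).card ∧ σ'.reg 8 = i ∧
    ∀ r, r ≤ 6 → σ'.reg r = σ.reg r) hN ?_ (fun i σ h => h.2.2.2.1)
    (fun i σ h => (h.2.2.2.2 3 (by simp)).trans h3) ?_ ?_
  · refine ⟨fun _ _ => rfl, by simp, by simp, by simp, fun r hr => ?_⟩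
    rw [State.setReg_reg_of_ne _ _ (by omega), State.setReg_reg_of_ne _ _ (by omega)]
  · rintro i σ1 hi ⟨h1m, h1a, h17, h18, h1r⟩
    -- Register 9 holds the truth value of `U j` after `j` comparisons; `U i` means that point `i`
    -- is the first on its line.
    obtain ⟨U, hU⟩ : ∃ U : ℕ → Prop, ∀ j, U j ↔ ∀ k < j, ℓ k ≠ ℓ i := ⟨_, fun _ => Iff.rfl⟩
    have hU0 : U 0 := by simp [hU]
    have hUi : U i ↔ IsFirst ℓ i := hU i
    refine .seq (.setReg_eq (v := 1) rfl (.seq ?_))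
    refine .count (N := i) (fun j σ' => σ'.mem = σ1.mem ∧
      σ'.reg 9 = (if U j then 1 else 0) ∧ σ'.reg 10 = j ∧
      ∀ r, r ≤ 8 → σ'.reg r = σ1.reg r) (hi.le.trans hN) ?_ (fun i σ h => h.2.2.1)
      (fun j σ h => (h.2.2.2 8 (by simp)).trans h18) ?_ ?_
    · refine ⟨rfl, by simp [hU0], by simp, fun r hr => ?_⟩
      rw [State.setReg_reg_of_ne _ _ (by omega), State.setReg_reg_of_ne _ _ (by omega)]
    · rintro j σ2 hj ⟨h2m, h29, h210, h2r⟩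
      have h28 : σ2.reg 8 = i := (h2r 8 (by simp)).trans h18
      have htest := holds_sameLineTest (ζ := ζ) (o := o) (t := t) (σ := σ2) (N := N) (ca := ca) ho
        (by rw [h2m, h1m 0 ha.symm]; exact h0) (by rw [h28]; exact hi)
        (by rw [h210]; exact hj.trans hi)
      rw [h28, h210, ← hℓ, ← hℓ] at htest
      have hsucc : U (j + 1) ↔ U j ∧ ℓ j ≠ ℓ i := by
        rw [hU, hU]
        exact Nat.forall_lt_succ_right
      refine .ite (fun hc => ?_) (fun hc => ?_)
      · refine .setReg_eq (v := 0) rfl ⟨by simp [h210], h2m, ?_, by simp, fun r hr => ?_⟩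
        · rw [if_neg fun h => (hsucc.1 h).2 (htest.1 hc).symm]
          simp
        · rw [State.setReg_reg_of_ne _ _ (by omega), State.setReg_reg_of_ne _ _ (by omega),
            h2r r hr]
      · refine .skip ⟨h210, h2m, ?_, by simp, fun r hr => ?_⟩
        · rw [State.setReg_reg_of_ne _ _ (by omega), h29]
          simp [hsucc, show ℓ j ≠ ℓ i from fun h => hc (htest.2 h.symm)]
        · rw [State.setReg_reg_of_ne _ _ (by omega), h2r r hr]
    · rintro σ2 ⟨h2m, h29, h210, h2r⟩
      have h28 : σ2.reg 8 = i := (h2r 8 (by simp)).trans h18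
      simp only [hUi] at h29
      refine .seq (.setCell_eq (k := i) (x := if IsFirst ℓ i then 1 else 0) h28 ?_ (.setReg ?_))
      · simp only [RExp.eval, NExp.eval, h29]
        split_ifs <;> simp
      refine ⟨by simp [h28], fun a' ha' => ?_, fun j hj => ?_, ?_, by simp, fun r hr => ?_⟩
      · simp [ha', h2m, h1m a' ha']
      · simp only [State.setReg_mem, State.setCell_mem, if_true]
        by_cases hji : j = i
        · rw [hji, Function.update_self]
        · rw [Function.update_of_ne hji, h2m, h1a j (by omega)]
      · rw [Finset.range_add_one, Finset.filter_insert]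
        rw [State.setReg_reg_of_ne _ _ (by omega), State.setReg_reg_self]
        simp only [NExp.eval, State.setCell_reg, h29, h2r 7 (by simp), h17]
        split_ifs <;> simp
      · rw [State.setReg_reg_of_ne _ _ (by omega), State.setReg_reg_of_ne _ _ (by omega),
          State.setCell_reg, h2r r (by omega), h1r r hr]
  · rintro σ1 ⟨h1m, h1a, h17, h18, h1r⟩
    refine .setReg ⟨h1m, h1a, ?_, fun r hr => ?_⟩
    · simp [NExp.eval, h17, h1r]
      omega
    · rw [State.setReg_reg_of_ne _ _ (by omega), h1r r hr.le]

open Classical in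
-- Register 6 is described by its upper bounds, which makes the maximum over all directions easy to
-- carry through the induction.
theorem ok_markAll {ζ t : ℂ} {d N : ℕ} (hN : N ≤ B) {ca : ℕ → Fin d → ℤ} (os : List ℂ) :
    ∀ {σ : State} {a : ℕ}, (∀ o ∈ os, o ≠ 0) → 2 < a → HoldsPoints N ca (σ.mem 0) →
    σ.reg 3 = N →
    Ok O G B (markAll ζ d a os) σ fun σ' => (∀ a', a' < a → σ'.mem a' = σ.mem a') ∧
      (∀ (k : ℕ) (hk : k < os.length), ∀ i < N, σ'.mem (a + k) i =
        if IsFirst (fun i => lineThrough (t + ofCoords ζ (ca i)) os[k]) i then 1 else 0) ∧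
      (∀ x, σ'.reg 6 ≤ x ↔ σ.reg 6 ≤ x ∧ ∀ o ∈ os, ((Finset.range N).filter
        (IsFirst fun i => lineThrough (t + ofCoords ζ (ca i)) o)).card ≤ x) ∧
      ∀ r, r < 6 → σ'.reg r = σ.reg r := by
  induction os with
  | nil =>
    intro σ a _ _ _ _
    exact .skip ⟨fun _ _ => rfl, by simp, by simp, fun _ _ => rfl⟩
  | cons o os ih =>
    intro σ a hos ha h0 h3
    refine .seq ((ok_markFirst (t := t) (hos o (by simp)) (by omega) hN h0 h3
      (fun _ => rfl)).mono ?_)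
    rintro σ1 ⟨h1m, h1a, h16, h1r⟩
    refine (ih (σ := σ1) (a := a + 1) (fun o ho => hos o (by simp [ho])) (by omega) ?_ ?_).mono ?_
    · rwa [h1m 0 (by omega)]
    · rw [h1r 3 (by simp), h3]
    · rintro σ2 ⟨h2m, h2a, h26, h2r⟩
      refine ⟨fun a' ha' => ?_, fun k hk i hi => ?_, fun x => ?_, fun r hr => ?_⟩
      · rw [h2m a' (by omega), h1m a' (by omega)]
      · cases k with
        | zero =>
          rw [add_zero, h2m a (by omega), h1a i hi]
          rfl
        | succ k =>
          rw [show a + (k + 1) = a + 1 + k by omega, h2a k (by simpa using hk) i hi]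
          rfl
      · rw [h26, h16]
        simp [and_assoc]
      · rw [h2r r hr, h1r r hr]

theorem ok_parsePoints {ζ t : ℂ} {d N : ℕ} (hN : N ≤ B) {ca : ℕ → Fin d → ℤ}
    (h0 : HoldsPoints N ca (σ.mem 0)) (hre : σ.mem 0 0 = t.re) (him : σ.mem 0 1 = t.im)
    (hcard : σ.mem 0 2 = N) (h2 : σ.mem 2 0 = 0) :
    Ok O G B (parsePoints ζ d) σ fun σ' => (∀ a, a ≠ 2 → σ'.mem a = σ.mem a) ∧
      Stored (σ'.mem 2) 0
        ([0, (N : ℝ)] ++ encPoints ((List.range N).map fun i => t + ofCoords ζ (ca i))) ∧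
      σ'.reg 2 = 2 + 2 * N ∧ σ'.reg 3 = N ∧ σ'.reg 4 = N ∧ σ'.reg 6 = σ.reg 6 := by
  refine .seq (.setCell_eq (k := 1) (x := N) rfl hcard (.seq (.setReg_eq (v := 0) rfl (.seq ?_))))
  refine .loop (N := N) (fun i σ' => (∀ a, a ≠ 2 → σ'.mem a = σ.mem a) ∧
    Stored (σ'.mem 2) 0
      ([0, (N : ℝ)] ++ encPoints ((List.range i).map fun i => t + ofCoords ζ (ca i))) ∧
    σ'.reg 3 = i ∧ σ'.reg 6 = σ.reg 6) hN ?_ ?_ ?_ ?_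
  · refine ⟨fun a ha => by simp [ha], ?_, by simp, by simp⟩
    simp [encPoints, stored_cons, Stored.nil, h2]
  · rintro i σ1 - ⟨h1m, -, h13, -⟩
    simp only [Test.holds, RExp.eval, NExp.eval, h13, h1m 0 (by simp), hcard]
    exact Nat.cast_lt
  · rintro i σ1 hi ⟨h1m, h1s, h13, h16⟩
    have hcoord : ∀ σ2 : State, σ2.mem 0 = σ1.mem 0 → σ2.reg = σ1.reg → ∀ c : Fin d,
        (pointEntry d c 3).eval σ2 = ca i c := by
      intro σ2 hm hr c
      have h3 : σ2.reg 3 = i := by rw [hr, h13]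
      have h := eval_pointEntry (σ := σ2) (r := 3) (N := N) (ca := ca)
        (by rw [hm, h1m 0 (by simp)]; exact h0) (by rw [h3]; exact hi) c
      rwa [h3] at h
    have hlen : ([0, (N : ℝ)] ++
        encPoints ((List.range i).map fun i => t + ofCoords ζ (ca i))).length = 2 + 2 * i := by
      simp [length_encPoints]; omega
    refine .seq (.setCell_eq (k := 2 + 2 * i) (x := (t + ofCoords ζ (ca i)).re)
      (by simp only [NExp.eval, h13]) ?_ (.seq (.setCell_eq (k := 3 + 2 * i)
      (x := (t + ofCoords ζ (ca i)).im) (by simp only [NExp.eval, State.setCell_reg, h13]) ?_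
      (.setReg_eq (v := i + 1) (by simp only [NExp.eval, State.setCell_reg, h13]) ?_))))
    · simp only [RExp.eval, NExp.eval, eval_reExp_int (hcoord _ rfl rfl), h1m 0 (by simp), hre,
        Complex.add_re]
    · rw [Complex.add_im, ← him, ← h1m 0 (by simp)]
      simp only [RExp.eval, NExp.eval]
      rw [eval_imExp_int (hcoord (σ1.setCell 2 (2 + 2 * i) (t + ofCoords ζ (ca i)).re) (by simp) rfl)]
      simp
    · refine ⟨fun a ha => by simp [ha, h1m a ha], ?_, by simp, by simp [h16]⟩
      rw [List.range_succ, List.map_append, encPoints_append, ← List.append_assoc]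
      have h := (h1s.snoc (x := (t + ofCoords ζ (ca i)).re) (i := 2 + 2 * i) (by omega)).snoc
        (x := (t + ofCoords ζ (ca i)).im) (i := 3 + 2 * i)
        (by rw [List.length_append, hlen, List.length_singleton]; omega)
      simp only [State.setReg_mem, State.setCell_mem, if_true]
      rw [List.append_assoc] at h
      exact h
  · rintro σ1 ⟨h1m, h1s, h13, h16⟩
    exact .seq (.setReg (.setReg ⟨h1m, h1s, by simp [NExp.eval, h13], by simp [h13],
      by simp [NExp.eval, h13], by simp [h16]⟩))

open Classical in
theorem ok_parseSet {ζ t : ℂ} {d N s : ℕ} (hN : N ≤ B) {ca : ℕ → Fin d → ℤ} {os : List ℂ}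
    (hos : ∀ o ∈ os, o ≠ 0) {w : List ℝ} (h0 : HoldsPoints N ca ((State.init w).mem 0))
    (hre : (State.init w).mem 0 0 = t.re) (him : (State.init w).mem 0 1 = t.im)
    (hcard : (State.init w).mem 0 2 = N)
    (hs : ∀ x, s ≤ x ↔ ∀ o ∈ os, ((Finset.range N).filter
        (IsFirst fun i => lineThrough (t + ofCoords ζ (ca i)) o)).card ≤ x) {pre : List ℝ}
    (hpre : pre = (s : ℝ) :: (N : ℝ) ::
      encPoints ((List.range N).map fun i => t + ofCoords ζ (ca i))) :
    Ok O G B (parseSet ζ d os) (State.init w) fun S =>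
      S.mem 0 = (State.init w).mem 0 ∧ S.mem 1 = (State.init w).mem 1 ∧
      Stored (S.mem 2) 0 pre ∧ S.reg 2 = pre.length ∧ S.reg 3 = N ∧ S.reg 4 = N ∧
      ∀ (k : ℕ) (hk : k < os.length), ∀ i < N, S.mem (10 + k) i =
        if IsFirst (fun i => lineThrough (t + ofCoords ζ (ca i)) os[k]) i then 1 else 0 := by
  refine .seq ((ok_parsePoints hN h0 hre him hcard rfl).mono ?_)
  rintro σ1 ⟨h1m, h1s, h12, h13, h14, h16⟩
  refine .seq ((ok_markAll (t := t) hN os hos (by simp) (by rwa [h1m 0 (by simp)]) h13).mono ?_)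
  rintro σ2 ⟨h2m, h2a, h26, h2r⟩
  have hs6 : σ2.reg 6 = s := by
    refine eq_of_forall_ge_iff fun x => ?_
    rw [h26, hs, h16]
    simp [State.init]
  refine .setCell_eq (k := 0) (x := s) rfl (by simp [RExp.eval, NExp.eval, hs6])
    ⟨?_, ?_, ?_, ?_, ?_, ?_, ?_⟩
  · simp [h2m, h1m]
  · simp [h2m, h1m]
  · rw [hpre, stored_cons]
    simp only [State.setCell_mem, if_true, h2m 2 (by simp)]
    rw [List.cons_append, List.singleton_append, stored_cons] at h1s
    exact ⟨by simp, h1s.2.update _ (by simp)⟩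
  · rw [State.setCell_reg, h2r 2 (by simp), h12, hpre]
    simp [length_encPoints]
    omega
  · rw [State.setCell_reg, h2r 3 (by simp), h13]
  · rw [State.setCell_reg, h2r 4 (by simp), h14]
  · intro k hk i hi
    rw [State.setCell_mem, if_neg (by omega), h2a k hk i hi]

end ModelSet

/-! ### Uniqueness -/

namespace ModelSet

open RealRAM

open Classical in
theorem coe_image_lineThrough {F : Finset ℂ} {N : ℕ} {f : ℕ → ℂ}
    (hF : ∀ z, z ∈ F ↔ ∃ i < N, f i = z) (o : ℂ) :
    Function.support (xray o F) =
      ((Finset.range N).image fun i => lineThrough (f i) o : Set (LineIn o)) := by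
  rw [support_xray]
  ext ℓ
  simp only [Set.mem_image, Finset.mem_coe, hF, Finset.coe_image, Finset.coe_range, Set.mem_Iio]
  constructor
  · rintro ⟨_, ⟨i, hi, rfl⟩, rfl⟩
    exact ⟨i, hi, rfl⟩
  · rintro ⟨i, hi, rfl⟩
    exact ⟨_, ⟨i, hi, rfl⟩, rfl⟩

open Classical in
/-- A finite set has at most as many points as the product of its numbers of lines in two
directions. -/
theorem card_le_mul_card_image {F : Finset ℂ} {o o' : ℂ} (hpar : ∀ r : ℝ, o ≠ (r : ℂ) * o') :
    F.card ≤ (F.image fun z => lineThrough z o).card * (F.image fun z => lineThrough z o').card := by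
  rw [← Finset.card_product]
  refine Finset.card_le_card_of_injOn (fun z => (lineThrough z o, lineThrough z o')) ?_ ?_
  · intro z hz
    simp only [Finset.mem_coe, Finset.mem_product, Finset.mem_image] at hz ⊢
    exact ⟨⟨z, hz, rfl⟩, ⟨z, hz, rfl⟩⟩
  · intro z _ z' _ h
    simp only [Prod.mk.injEq, lineThrough_eq_iff] at h
    exact eq_of_mem_lines hpar h.1 h.2 (mem_line_self z' o) (mem_line_self z' o')

/-- Equal X-rays have equal supports, so every point of `F'` is on a line that meets `F`. -/
theorem exists_isFirst_line {N : ℕ} {o t : ℂ} {F F' : Finset ℂ} {f : ℕ → ℂ}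
    (hF : ∀ z, z ∈ F ↔ ∃ i < N, t + f i = z) (hx : xray o F' = xray o F) {z : ℂ} (hz : z ∈ F') :
    ∃ i < N, IsFirst (fun i => lineThrough (t + f i) o) i ∧ z ∈ line (t + f i) o := by
  have h1 : xray o F (lineThrough z o) ≠ 0 := by
    rw [← hx, xray_ne_zero_iff]
    exact ⟨z, hz, mem_line_self z o⟩
  obtain ⟨y, hy, hyz⟩ := xray_ne_zero_iff.1 h1
  obtain ⟨i, hi, rfl⟩ := (hF y).1 hy
  obtain ⟨j, hji, hj, hl⟩ := exists_isFirst (fun i => lineThrough (t + f i) o) i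
  refine ⟨j, by omega, hj, ?_⟩
  rw [← lineThrough_eq_iff, hl]
  exact (mem_line_iff_eq_lineThrough.1 hyz).symm

/-- In both directions the lines are indexed by the points of `F`. Candidates use only the first
point on each line, while the tuples run over all index pairs. -/
theorem polySolvable_uniqueness {n : ℕ} (hn : 0 < n) {ζ : ℂ} (hζ : IsPrimitiveRoot ζ n) {k l : ℕ}
    {σ : Fin k → (fieldK ζ ≃ₐ[ℚ] fieldK ζ)} {A : Matrix (Fin l) (Fin k × Fin 2) ℝ} {b : Fin l → ℝ}
    (hne : (interior (polyhedron A b)).Nonempty) {m : ℕ} {o : Fin (m + 2) → ℂ}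
    (ho : ∀ i, o i ∈ ringO ζ ∧ o i ≠ 0) (hpar : ∀ i j, i ≠ j → ∀ r : ℝ, o i ≠ (r : ℂ) * o j) :
    PolySolvableWithOracle (uniqueness (Nat.totient n) σ (polyhedron A b) o)
      (anchoredUniqueness o) := by
  classical
  have hpar' := hpar 0 1 (by simp)
  obtain ⟨M, hM⟩ := exists_gridMatrix hn hζ (ringO_le_fieldK (ho 0).1) (ringO_le_fieldK (ho 1).1)
    (ho 1).2 hpar'
  obtain ⟨Λ, hΛ⟩ := exists_feasibility_test A
  set p : Fin (Nat.totient n) → ℕ → RExp := fun c r => pointEntry (Nat.totient n) c r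
  refine polySolvable_of_ok (prog := .seq (parseSet ζ (Nat.totient n) (List.ofFn o))
    -- Arrays 10 and 11 contain the marks of the first points for the first two directions.
    (gridSearch ζ σ A b M Λ p p (.and (.realEq (.cell 10 (.reg 20)) (.const 1))
      (.realEq (.cell 11 (.reg 21)) (.const 1))) (.cell 0 (.const 0)) (.cell 0 (.const 1))))
    (f := fun s => 6 * (s * s) + 4) ?_ ?_
  · exact ((PolyBounded.const _).mul (PolyBounded.id.mul .id)).add (.const _)
  rintro O hO ⟨F, hFW⟩ w ⟨t, L, hL, hw⟩
  simp only [uniqueness] at hL ⊢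
  set s := maxSupport fun i => xray (o i) F
  set B := 6 * (s * s) + 4
  set N := L.length
  set ca : ℕ → Fin (Nat.totient n) → ℤ := fun i => L.getD i 0
  have hFmem : ∀ z, z ∈ F ↔ ∃ i < N, t + ofCoords ζ (ca i) = z := by
    intro z
    rw [← hL.2]
    constructor
    · intro hz
      obtain ⟨c, hc, rfl⟩ := List.mem_map.1 hz
      obtain ⟨i, hi, rfl⟩ := List.getElem_of_mem hc
      exact ⟨i, hi, by simp [ca, hi]⟩
    · rintro ⟨i, hi, rfl⟩
      exact List.mem_map.2 ⟨L[i], List.getElem_mem hi, by simp [ca, show i < L.length from hi]⟩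
  have hcount : ∀ i, ((Finset.range N).filter
      (IsFirst fun j => lineThrough (t + ofCoords ζ (ca j)) (o i))).card =
      (Function.support (xray (o i) F)).ncard := by
    intro i
    rw [coe_image_lineThrough hFmem, card_filter_isFirst, Set.ncard_coe_finset]
    congr!
  have hle : ∀ i, (Function.support (xray (o i) F)).ncard ≤ s := fun i =>
    Finset.le_sup (f := fun i => (Function.support (xray (o i) F)).ncard) (Finset.mem_univ i)
  have hcardF : F.card = N := by
    rw [← hL.length_eq, List.length_map]
  -- The input has length proportional to `|F|`, but the time is measured in `s`; the lines in two
  -- directions bound `|F|` by `s ^ 2`.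
  have hNs : N ≤ s * s := by
    have himg : ∀ i, (F.image fun z => lineThrough z (o i)).card ≤ s := by
      intro i
      refine le_trans (le_of_eq ?_) (hle i)
      rw [support_xray, ← Finset.coe_image, Set.ncard_coe_finset]
    rw [← hcardF]
    exact (card_le_mul_card_image hpar').trans (Nat.mul_le_mul (himg 0) (himg 1))
  have hNB : N ≤ B := by omega
  have hmap : L.map (fun c => t + ofCoords ζ c) =
      (List.range N).map fun i => t + ofCoords ζ (ca i) := by
    apply List.ext_getElem
    · simp [N]
    · intro i h1 h2
      simp only [List.length_map] at h1
      simp [ca, h1]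
  rw [hmap] at hL
  set pre := (s : ℝ) :: (N : ℝ) ::
    encPoints ((List.range N).map fun i => t + ofCoords ζ (ca i)) with hpre
  have hprelen : pre.length = 2 + 2 * N := by
    simp [hpre, length_encPoints]; omega
  have hin := stored_init w
  nth_rw 2 [hw] at hin
  rw [stored_cons, stored_cons, stored_cons] at hin
  obtain ⟨hin0, hin1, hin2, hin3⟩ := hin
  have hpts : HoldsPoints N ca ((State.init w).mem 0) := by
    intro i hi c
    have h := (hin3.block (k := Nat.totient n) length_encCoords (i := i) hi).encCoords c
    rw [show ca i = L[i] by simp [ca, show i < L.length from hi]]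
    exact h
  have hdesc : ∀ (Lp : List ℂ), Lp.Nodup → ∀ h : Lp.length ≤ s ^ 2,
      (anchoredUniqueness o).Describes (queryWord pre Lp)
        ⟨s, F, hle, Lp.toFinset, (List.toFinset_card_le Lp).trans h⟩ := by
    intro Lp hnd h
    refine ⟨_, Lp, hL, enumerates_toFinset hnd, ?_⟩
    simp [queryWord, hpre]
  refine .seq ((ok_parseSet (t := t) (s := s) (pre := pre) hNB ?_ hpts hin0 hin1 hin2 ?_ hpre).mono
    ?_)
  · intro o' ho'
    obtain ⟨i, rfl⟩ := List.mem_ofFn.1 ho'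
    exact (ho i).2
  · intro x
    simp only [s, maxSupport, Finset.sup_le_iff, List.mem_ofFn, forall_exists_index,
      forall_apply_eq_imp_iff, hcount, Finset.mem_univ, true_imp_iff]
  rintro S ⟨hS0, hS1, hSpre, hS2, hS3, hS4, hSmark⟩
  have hbase : Base S pre N N S :=
    ⟨fun _ _ _ => rfl, fun _ _ _ _ => rfl, hSpre, hS2, hS3, hS4⟩
  have hbase0 : ∀ S', Base S pre N N S' → S'.mem 0 = (State.init w).mem 0 := fun S' hS' => by
    rw [hS'.mem 0 (by simp) (by simp) (by simp), hS0]
  have hp : ∀ S', Base S pre N N S' → ∀ c r, S'.reg r < N → (p c r).eval S' = ca (S'.reg r) c := by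
    intro S' hS' c r hr
    exact eval_pointEntry (by rw [hbase0 S' hS']; exact hpts) hr c
  have hmark0 := hSmark 0 (by simp)
  have hmark1 := hSmark 1 (by simp)
  rw [List.getElem_ofFn] at hmark0 hmark1
  replace hmark0 : ∀ i < N, S.mem 10 i =
    if IsFirst (fun i => lineThrough (t + ofCoords ζ (ca i)) (o 0)) i then 1 else 0 := hmark0
  replace hmark1 : ∀ i < N, S.mem 11 i =
    if IsFirst (fun i => lineThrough (t + ofCoords ζ (ca i)) (o 1)) i then 1 else 0 := hmark1
  refine (((ok_gridSearch hn hζ hne hpar' hM hΛ (s := s) (B := B) (O := O) (t := t)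
    (ca := ca) (cb := ca) (VA := IsFirst fun i => lineThrough (t + ofCoords ζ (ca i)) (o 0))
    (VB := IsFirst fun i => lineThrough (t + ofCoords ζ (ca i)) (o 1))
    (R := fun F' => F' ≠ F ∧ ∀ i, xray (o i) F' = xray (o i) F)
    hbase ?_ hp hp ?_ ?_ ?_ ?_ ?_ ?_ ?_ hNB hNB ?_ answerFormat_decides ?_ ?_ ?_).weaken ?_).mono ?_)
  · rw [hS1]; rfl
  · intro S' hS' hi hj
    simp only [Test.holds, RExp.eval, NExp.eval]
    rw [hS'.mem 10 (by simp) (by simp) (by simp), hS'.mem 11 (by simp) (by simp) (by simp)]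
    refine and_congr ?_ ?_
    · refine (iff_of_eq (congrArg (· = (1 : ℝ)) (hmark0 _ hi))).trans ?_
      simp
    · refine (iff_of_eq (congrArg (· = (1 : ℝ)) (hmark1 _ hj))).trans ?_
      simp
  · intro S' hS'
    simpa only [RExp.eval, NExp.eval, hbase0 S' hS'] using hin0
  · intro S' hS'
    simpa only [RExp.eval, NExp.eval, hbase0 S' hS'] using hin1
  · intro i _ i' _ hf hf' h
    rcases lt_trichotomy i i' with hii | hii | hii
    · exact absurd h (hf' i hii)
    · exact hii
    · exact absurd h.symm (hf i' hii)
  · intro i _ i' _ hf hf' h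
    rcases lt_trichotomy i i' with hii | hii | hii
    · exact absurd h (hf' i hii)
    · exact hii
    · exact absurd h.symm (hf i' hii)
  · rw [hcount]; exact hle 0
  · rw [hcount]; exact hle 1
  · rw [hprelen, sq]
    omega
  · intro Lp hnd hlen
    have h := hO _ _ (hdesc Lp hnd hlen)
    simp only [anchoredUniqueness] at h
    simpa only [and_left_comm] using h
  · intro F' hF' f hf
    exact exists_isFirst_line hFmem (hF'.2 0) hf
  · intro F' hF' f hf
    exact exists_isFirst_line hFmem (hF'.2 1) hf
  · rintro q ⟨Lp, ⟨hnd, hlen, -⟩, rfl⟩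
    exact ⟨_, hdesc Lp hnd hlen, le_rfl⟩
  · intro S' h
    simpa only [IsSolution, and_left_comm] using h

end ModelSet

end

theorem theorem3 (n : ℕ) (hn : 3 ≤ n) (ζ : ℂ) (hζ : IsPrimitiveRoot ζ n)
    (σ : Fin (Nat.totient n / 2 - 1) → (ModelSet.fieldK ζ ≃ₐ[ℚ] ModelSet.fieldK ζ))
    (hσ : ModelSet.IsStarChoice ζ σ)
    (l : ℕ) (A : Matrix (Fin l) (Fin (Nat.totient n / 2 - 1) × Fin 2) ℝ) (b : Fin l → ℝ)
    (hW : ModelSet.IsWindow (ModelSet.polyhedron A b))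
    (m : ℕ) (hm : 2 ≤ m) (o : Fin m → ℂ)
    (ho : ∀ i, o i ∈ ModelSet.ringO ζ ∧ o i ≠ 0)
    (hpar : ∀ i j, i ≠ j → ∀ r : ℝ, o i ≠ (r : ℂ) * o j) :
    RealRAM.PolySolvableWithOracle
      (ModelSet.consistency (Nat.totient n) σ (ModelSet.polyhedron A b) o)
      (ModelSet.anchoredConsistency o) ∧
    RealRAM.PolySolvableWithOracle
      (ModelSet.reconstruction (Nat.totient n) σ (ModelSet.polyhedron A b) o)
      (ModelSet.anchoredReconstruction o) ∧
    RealRAM.PolySolvableWithOracle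
      (ModelSet.uniqueness (Nat.totient n) σ (ModelSet.polyhedron A b) o)
      (ModelSet.anchoredUniqueness o) := by
  obtain ⟨m, rfl⟩ := Nat.exists_eq_add_of_le' hm
  have hn : 0 < n := by omega
  exact ⟨ModelSet.polySolvable_moduleData hn hζ hW.1 ho hpar ModelSet.answerFormat_decides,
    ModelSet.polySolvable_moduleData hn hζ hW.1 ho hpar ModelSet.answerFormat_constructs,
    ModelSet.polySolvable_uniqueness hn hζ hW.1 ho hpar⟩
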